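/- Let $X_n=\{-1,1\}^n$, let $U_n$ be the uniform distribution on $X_n$, and for $h,f:X_n\to\{-1,1\}$ put $\mathrm{err}(h,f)=\Pr_{x\sim U_n}[h(x)\neq f(x)]$. A concept class is a family $C=(C_n)_{n\ge 0}$, where $C_n$ is a set of functions $X_n\to\{-1,1\}$. Say that $C$ is *efficiently agnostically learnable under the uniform distribution with $k$-local membership queries* if there are a randomized algorithm $L$, a deterministic algorithm $E$ and a polynomial $p$ such that for all $n$, all real $\epsilon,\delta>0$ and every target function $f:X_n\to\{-1,1\}$ (not necessarily in $C_n$), the following holds when $L$ is given $n$, $\lceil 1/\epsilon\rceil$ and $\lceil 1/\delta\rceil$ in unary. The algorithm $L$ may request random examples $(x,f(x))$ with $x\sim U_n$ independent, and may ask for the value $f(q)$ at points $q\in X_n$ of its choice, provided that in every run each such $q$ is within Hamming distance $k$ of some random example that $L$ has already received. In every run, $L$ halts after at most $p(n,1/\epsilon,1/\delta)$ steps and outputs the description of a hypothesis $h:X_n\to\{-1,1\}$, which $E$ evaluates from this description, $n$ and the point, at every point of $X_n$, in at most $p(n,1/\epsilon,1/\delta)$ steps. With probability at least $1-\delta$,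 $$\mathrm{err}(h,f)\le \mathrm{err}(c,f)+\epsilon\qquad\text{for all } c\in C_n .$$ Say that $C$ is *efficiently agnostically learnable under the uniform distribution from random examples alone* if the same holds with an algorithm $L$ that never asks for the value of $f$ at a point of its choice. **Theorem.** Let $k\ge 0$ be a constant. Every concept class that is efficiently agnostically learnable under the uniform distribution with $k$-local membership queries is efficiently agnostically learnable under the uniform distribution from random examples alone. -/

import Mathlib

namespace LocalQueries

/-! ### Instance space, targets and error -/

/-- The Boolean hypercube of dimension `n`. The two bit values (written `-1, 1` or `0, 1`) are the
two Booleans. -/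
abbrev Cube (n : ℕ) : Type := Fin n → Bool

/-- A concept class: for every dimension `n`, a set of Boolean functions on the `n`-cube. -/
abbrev ConceptClass : Type := ∀ n : ℕ, Set (Cube n → Bool)

/-- `err h f = Pr [h x ≠ f x]` for `x` uniform in the `n`-cube. -/
noncomputable def err {n : ℕ} (h f : Cube n → Bool) : ℝ :=
  ((Finset.univ.filter fun x : Cube n => h x ≠ f x).card : ℝ) / (Fintype.card (Cube n) : ℝ)

/-! ### Data: binary trees, as in the language WHILE -/

/-- The values that programs manipulate: binary trees (pairs built up from `nil`). -/
inductive Data : Type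
  | nil : Data
  | cons : Data → Data → Data

namespace Data

/-- First component (`nil` for `nil`). -/
def head : Data → Data
  | nil => nil
  | cons d _ => d

/-- Second component (`nil` for `nil`). -/
def tail : Data → Data
  | nil => nil
  | cons _ e => e

/-- The test for being a pair; `nil` counts as false, every pair as true. -/
def isPair : Data → Bool
  | nil => false
  | cons _ _ => true

/-- The code of a bit. -/
def ofBool : Bool → Data
  | false => nil
  | true => cons nil nil

/-- The code of a list. -/
def ofList : List Data → Data
  | [] => nil
  | d :: l => cons d (ofList l)

/-- The unary code of a natural number. -/
def ofNat (m : ℕ) : Data := ofList (List.replicate m nil)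

/-- The code of a point: the list of its bits. -/
def ofPoint {n : ℕ} (x : Cube n) : Data := ofList (List.ofFn fun i => ofBool (x i))

/-- The point coded by a tree (a left inverse of `ofPoint`; missing bits are read as `false`). -/
def toPoint (n : ℕ) (d : Data) : Cube n := fun i => isPair (head (tail^[(i : ℕ)] d))

end Data

/-! ### Programs -/

/-- Expressions; variables are numbered. -/
inductive Expr : Type
  | var : ℕ → Expr
  | nil : Expr
  | cons : Expr → Expr → Expr
  | head : Expr → Expr
  | tail : Expr → Expr

/-- The value of an expression in a store. -/
def Expr.eval (s : ℕ → Data) : Expr → Data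
  | .var v => s v
  | .nil => .nil
  | .cons e e' => .cons (e.eval s) (e'.eval s)
  | .head e => (e.eval s).head
  | .tail e => (e.eval s).tail

/-- Randomized programs with access to an example oracle and to a membership oracle. -/
inductive Prog : Type
  /-- `assign v e`: set variable `v` to the value of `e`. -/
  | assign : ℕ → Expr → Prog
  | seq : Prog → Prog → Prog
  /-- `cond e p q`: if the value of `e` is a pair then `p` else `q`. -/
  | cond : Expr → Prog → Prog → Prog
  /-- `loop e p`: while the value of `e` is a pair, do `p`. -/
  | loop : Expr → Prog → Prog
  /-- `flip v`: set variable `v` to a fair random bit. -/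
  | flip : ℕ → Prog
  /-- `draw v`: set variable `v` to a fresh labeled random example. -/
  | draw : ℕ → Prog
  /-- `query v`: replace the point coded by variable `v` by its label. -/
  | query : ℕ → Prog

/-- Programs that use neither coins nor oracles. -/
def Prog.Deterministic : Prog → Prop
  | .assign _ _ => True
  | .seq p q => p.Deterministic ∧ q.Deterministic
  | .cond _ p q => p.Deterministic ∧ q.Deterministic
  | .loop _ p => p.Deterministic
  | .flip _ => False
  | .draw _ => False
  | .query _ => False

/-- A configuration: the stack of programs still to be run, the store, and the list of the examples
received so far (a record that the program itself cannot read). -/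
structure Config (n : ℕ) : Type where
  todo : List Prog
  store : ℕ → Data
  sample : List (Cube n)

/-- One computation step with target function `f`. The example oracle draws a uniform point `x` and
returns the pair of `x` and `f x`; the membership oracle returns `f` at the point asked for.
A configuration with an empty stack has halted. -/
noncomputable def step {n : ℕ} (f : Cube n → Bool) (c : Config n) : PMF (Config n) :=
  match c.todo with
  | [] => PMF.pure c
  | .assign v e :: r => PMF.pure ⟨r, Function.update c.store v (e.eval c.store), c.sample⟩
  | .seq p q :: r => PMF.pure ⟨p :: q :: r, c.store, c.sample⟩
  | .cond e p q :: r =>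
      PMF.pure ⟨(if (e.eval c.store).isPair then p else q) :: r, c.store, c.sample⟩
  | .loop e p :: r =>
      PMF.pure ⟨if (e.eval c.store).isPair then p :: .loop e p :: r else r, c.store, c.sample⟩
  | .flip v :: r =>
      (PMF.uniformOfFintype Bool).bind fun b =>
        PMF.pure ⟨r, Function.update c.store v (Data.ofBool b), c.sample⟩
  | .draw v :: r =>
      (PMF.uniformOfFintype (Cube n)).bind fun x =>
        PMF.pure ⟨r, Function.update c.store v (.cons (Data.ofPoint x) (Data.ofBool (f x))),
          x :: c.sample⟩
  | .query v :: r =>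
      PMF.pure ⟨r, Function.update c.store v (Data.ofBool (f (Data.toPoint n (c.store v)))),
        c.sample⟩

/-- The distribution of the configuration after `t` steps. -/
noncomputable def runFor {n : ℕ} (f : Cube n → Bool) (c : Config n) : ℕ → PMF (Config n)
  | 0 => PMF.pure c
  | t + 1 => (runFor f c t).bind (step f)

/-- The initial configuration of `p`: variables `0, 1, …` hold the inputs, all others `nil`. -/
def start (n : ℕ) (p : Prog) (inputs : List Data) : Config n :=
  ⟨[p], fun v => inputs.getD v .nil, []⟩

/-! ### Efficient agnostic learning under the uniform distribution -/

/-- On the hypothesis code `d`, the dimension `n` and a point `x`, the deterministic program `E`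
returns `h x` in variable `0` after at most `T` steps, for all `x`. The target function of the run
is irrelevant, as `E` is deterministic. -/
def Evaluates {n : ℕ} (E : Prog) (d : Data) (T : ℕ) (h : Cube n → Bool) : Prop :=
  E.Deterministic ∧
    ∀ x : Cube n, ∀ c ∈ (runFor (fun _ : Cube n => false)
      (start n E [d, Data.ofNat n, Data.ofPoint x]) T).support,
        c.todo = [] ∧ (c.store 0).isPair = h x

/-- A rule that says which queries are permitted, given the examples received so far. -/
abbrev QueryRule : Type := ∀ n : ℕ, List (Cube n) → Cube n → Prop

/-- A query is `k`-local if some example received is at Hamming distance at most `k` from it. -/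
def kLocal (k : ℕ) : QueryRule := fun _ S q => ∃ x ∈ S, hammingDist x q ≤ k

/-- No membership queries at all. -/
def noQueries : QueryRule := fun _ _ _ => False

/-- The initial configuration of the learner `L`, given `n`, `⌈1/ε⌉` and `⌈1/δ⌉` in unary. -/
noncomputable def learnerStart (L : Prog) (n : ℕ) (ε δ : ℝ) : Config n :=
  start n L [Data.ofNat n, Data.ofNat ⌈1 / ε⌉₊, Data.ofNat ⌈1 / δ⌉₊]

/-- A time bound polynomial in `n`, `1/ε` and `1/δ`. -/
noncomputable def timeBound (K n : ℕ) (ε δ : ℝ) : ℕ := K * (n + ⌈1 / ε⌉₊ + ⌈1 / δ⌉₊ + 1) ^ K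

/-- `C` is efficiently agnostically learnable under the uniform distribution from random examples
and membership queries that obey `rule`: there are a learner `L`, a hypothesis evaluator `E` and a
polynomial time bound such that for all `n`, `ε`, `δ` and every target function `f` (not
necessarily in `C`)
* in every possible run, each query of `L` obeys `rule`,
* in every possible run, `L` halts within the time bound, with output (in variable `0`) the code of
  a hypothesis that `E` evaluates at each point within the time bound,
* with probability at least `1 - δ`, the error of this hypothesis exceeds that of no concept in `C`
  by more than `ε`. -/
def EfficientlyAgnosticallyLearnable (rule : QueryRule) (C : ConceptClass) : Prop :=
  ∃ (L E : Prog) (K : ℕ), ∀ (n : ℕ) (ε δ : ℝ), 0 < ε → 0 < δ → ∀ f : Cube n → Bool,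
    (∀ t : ℕ, ∀ c ∈ (runFor f (learnerStart L n ε δ) t).support, ∀ v r,
      c.todo = Prog.query v :: r → rule n c.sample (Data.toPoint n (c.store v))) ∧
    (∀ c ∈ (runFor f (learnerStart L n ε δ) (timeBound K n ε δ)).support,
      c.todo = [] ∧ ∃ h : Cube n → Bool, Evaluates E (c.store 0) (timeBound K n ε δ) h) ∧
    ENNReal.ofReal (1 - δ) ≤
      (runFor f (learnerStart L n ε δ) (timeBound K n ε δ)).toOuterMeasure
        {c | ∃ h : Cube n → Bool, Evaluates E (c.store 0) (timeBound K n ε δ) h ∧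
          ∀ g ∈ C n, err h f ≤ err g f + ε}

end LocalQueries

namespace LocalQueries

/-! Colour the cube with polynomially many colours such that distinct points of one colour are more
than `2 * k` apart, and learn each colour class `A` separately. For a class `A`, run the given
learner on the random target that equals `f` on `A` and is an independent fair coin elsewhere. A
ball of radius `k` contains at most one point of `A`. So among the points that may be queried near
an example at most one needs a true label, and every other answer is a coin flip.

The true label is obtained without a query as follows. If the example `x` has a neighbour `y` in
`A`, draw further examples until one of them, `(z, f z)`, falls into `A`, and present `x + y + z`
instead of `x`. For a fixed offset `x + y`, the point `y` is uniform on `A`, and so is `z`; hence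
the replacement preserves the uniform distribution, and the only point of `A` near the new example
is `z`, whose label is known. Failure to find `z` in `R` draws costs at most `p * (1 - p) ^ R ≤ 1 /
(R + 1)` per offset, where `p` is the density of `A`. This gives at most `(n + 1) ^ k / (R + 1)` per
example, however small `A` is (`mul_one_sub_pow_le`, `density_mul_pick_ge`, `avg_nearest_ge`). The
coins are flipped lazily and memoised; `avg_expect_le_simExpect` compares such a simulated run with
the average over the coins of the real runs.

The resulting hypothesis is independent of the coins that were never flipped. By Chebyshev, it and
any fixed concept err on those points almost equally often, so being near optimal for the random
target forces it to be near optimal for `f` on `A` (`avg_payoff_err_le`, `le_simExpect_of_learner`).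
The final hypothesis applies to each point the hypothesis of its colour. Mistakes add up over the
classes (`err_le_of_mistakes_le`), so an accuracy well below the inverse of the number of colours is
enough.

Concentration needs `2 ^ n` to exceed a fixed polynomial in the parameters. Otherwise polynomially
many examples contain every point with high probability (`mul_le_drawList`). One learner serves both
cases: its hypothesis also contains a table of true labels, which is consulted first.

The colour of `x` packs the power sums of the numbers `i + 1` over the coordinates `i` with `x i`
true into the digits of one number; a Vandermonde argument separates close points
(`color_injective`).

The rest realises this by programs. `expect` is the expected payoff within a given number of steps,
`Prog.val` is a compositional lower bound for it with bounded loops (`val_le_expect`), the terms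
`Fn` provide deterministic subroutines (`le_val_compile`), and `simExpect_le_stackVal` shows that
the program carries out the simulation. All loop bounds are fixed powers of one number `u`, so the
running time is polynomial (`exists_cost_le_pow`). -/

/-! ### Averages over finite types -/

/-- The average of a real function over a finite type. -/
noncomputable def avg {α : Type*} [Fintype α] (F : α → ℝ) : ℝ := (∑ x, F x) / Fintype.card α

section avg
variable {α β : Type*} [Fintype α] [Fintype β]

theorem avg_mono {F G : α → ℝ} (h : ∀ x, F x ≤ G x) : avg F ≤ avg G := by
  unfold avg; gcongr; exact h _

theorem avg_const [Nonempty α] (c : ℝ) : avg (fun _ : α => c) = c := by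
  simp [avg]

theorem avg_nonneg {F : α → ℝ} (h : ∀ x, 0 ≤ F x) : 0 ≤ avg F :=
  div_nonneg (Finset.sum_nonneg fun x _ => h x) (Nat.cast_nonneg _)

theorem le_avg [Nonempty α] {F : α → ℝ} {c : ℝ} (h : ∀ x, c ≤ F x) : c ≤ avg F :=
  (avg_const (α := α) c).symm.le.trans (avg_mono h)

theorem avg_le [Nonempty α] {F : α → ℝ} {c : ℝ} (h : ∀ x, F x ≤ c) : avg F ≤ c :=
  (avg_mono h).trans (avg_const (α := α) c).le

theorem avg_add (F G : α → ℝ) : avg (fun x => F x + G x) = avg F + avg G := by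
  simp [avg, Finset.sum_add_distrib, add_div]

theorem avg_sub (F G : α → ℝ) : avg (fun x => F x - G x) = avg F - avg G := by
  simp [avg, Finset.sum_sub_distrib, sub_div]

theorem avg_mul_left (c : ℝ) (F : α → ℝ) : avg (fun x => c * F x) = c * avg F := by
  simp [avg, ← Finset.mul_sum, mul_div_assoc]

theorem avg_comm (F : α → β → ℝ) :
    avg (fun x => avg (fun y => F x y)) = avg (fun y => avg (fun x => F x y)) := by
  simp only [avg, ← Finset.sum_div]
  rw [Finset.sum_comm, div_right_comm]

theorem avg_equiv (e : α ≃ β) (F : β → ℝ) : avg (fun x => F (e x)) = avg F := by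
  simp only [avg, Fintype.card_congr e, Equiv.sum_comp e]

theorem avg_bool (F : Bool → ℝ) : avg F = (F false + F true) / 2 := by
  simp [avg, add_comm]

/-- This is how statements about every possible run are extracted from expectations: a payoff
bounded by one has average one only if it is one for every random choice. -/
theorem forall_one_le_of_one_le_avg [Nonempty α] {F : α → ℝ} (h1 : ∀ x, F x ≤ 1)
    (h : 1 ≤ avg F) (x : α) : 1 ≤ F x := by
  by_contra hx
  have hc : (0 : ℝ) < Fintype.card α := by exact_mod_cast Fintype.card_pos
  have : ∑ y, F y < ∑ _y : α, (1 : ℝ) :=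
    Finset.sum_lt_sum (fun y _ => h1 y) ⟨x, Finset.mem_univ _, not_le.mp hx⟩
  rw [avg, le_div_iff₀ hc] at h
  simp at this
  linarith

theorem toOuterMeasure_uniform_bind {γ : Type*} [Nonempty α] (p : α → PMF γ) (s : Set γ)
    (F : α → ℝ) (hF : ∀ x, 0 ≤ F x) (h : ∀ x, (p x).toOuterMeasure s = ENNReal.ofReal (F x)) :
    ((PMF.uniformOfFintype α).bind p).toOuterMeasure s = ENNReal.ofReal (avg F) := by
  have hc : (0 : ℝ) < Fintype.card α := by exact_mod_cast Fintype.card_pos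
  rw [PMF.toOuterMeasure_bind_apply, tsum_fintype]
  simp only [h, PMF.uniformOfFintype_apply, ← Finset.mul_sum]
  rw [← ENNReal.ofReal_sum_of_nonneg fun x _ => hF x, avg, ENNReal.ofReal_div_of_pos hc,
    ENNReal.ofReal_natCast, ENNReal.div_eq_inv_mul]

end avg

/-! ### The expected value of a payoff at the end of a run -/

/-- The values of all variables. -/
abbrev Store : Type := ℕ → Data

/-- The expectation of the payoff `Φ` of the final store of a run of at most `t` steps; runs that
have not halted by then pay nothing. -/
noncomputable def expect {n : ℕ} (f : Cube n → Bool) (Φ : Store → ℝ) :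
    ℕ → List Prog → Store → ℝ
  | 0, [], s => Φ s
  | 0, _ :: _, _ => 0
  | _ + 1, [], s => Φ s
  | t + 1, .assign v e :: r, s => expect f Φ t r (Function.update s v (e.eval s))
  | t + 1, .seq p q :: r, s => expect f Φ t (p :: q :: r) s
  | t + 1, .cond e p q :: r, s => expect f Φ t ((if (e.eval s).isPair then p else q) :: r) s
  | t + 1, .loop e p :: r, s =>
      expect f Φ t (if (e.eval s).isPair then p :: .loop e p :: r else r) s
  | t + 1, .flip v :: r, s => avg fun b => expect f Φ t r (Function.update s v (Data.ofBool b))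
  | t + 1, .draw v :: r, s => avg fun x : Cube n =>
      expect f Φ t r (Function.update s v (.cons (Data.ofPoint x) (Data.ofBool (f x))))
  | t + 1, .query v :: r, s =>
      expect f Φ t r (Function.update s v (Data.ofBool (f (Data.toPoint n (s v)))))

section expect
variable {n : ℕ} {f : Cube n → Bool} {Φ Ψ : Store → ℝ}

theorem expect_nil (t : ℕ) (s : Store) : expect f Φ t [] s = Φ s := by
  cases t <;> rfl

theorem expect_nonneg (h : ∀ s, 0 ≤ Φ s) : ∀ t todo s, 0 ≤ expect f Φ t todo s := by
  intro t
  induction t with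
  | zero => intro todo s; cases todo <;> simp [expect, h]
  | succ t ih =>
    intro todo s
    rcases todo with _ | ⟨p, r⟩
    · exact h s
    · cases p <;> simp only [expect] <;> first | exact ih _ _ | exact avg_nonneg fun _ => ih _ _

theorem expect_le_one (h : ∀ s, Φ s ≤ 1) : ∀ t todo s, expect f Φ t todo s ≤ 1 := by
  intro t
  induction t with
  | zero => intro todo s; cases todo <;> simp [expect, h]
  | succ t ih =>
    intro todo s
    rcases todo with _ | ⟨p, r⟩
    · exact h s
    · cases p <;> simp only [expect] <;> first | exact ih _ _ | exact avg_le fun _ => ih _ _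

/-- A run that has not halted pays nothing and a halted run keeps its payoff, so more time can only
help. -/
theorem expect_le_succ (h : ∀ s, 0 ≤ Φ s) :
    ∀ t todo s, expect f Φ t todo s ≤ expect f Φ (t + 1) todo s := by
  intro t
  induction t with
  | zero =>
    intro todo s
    rcases todo with _ | ⟨p, r⟩
    · exact le_rfl
    · exact expect_nonneg h _ _ _
  | succ t ih =>
    intro todo s
    rcases todo with _ | ⟨p, r⟩
    · exact le_rfl
    · cases p <;> rw [expect, expect] <;> first | exact ih _ _ | exact avg_mono fun _ => ih _ _

theorem expect_mono_time (h : ∀ s, 0 ≤ Φ s) {t t' : ℕ} (ht : t ≤ t') (todo : List Prog)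
    (s : Store) : expect f Φ t todo s ≤ expect f Φ t' todo s :=
  monotone_nat_of_le_succ (f := fun t => expect f Φ t todo s) (fun t => expect_le_succ h t _ _) ht

end expect

/-- The payoff that is `1` on a set of stores and `0` elsewhere. -/
noncomputable def payoff (P : Store → Prop) (s : Store) : ℝ :=
  open Classical in if P s then 1 else 0

theorem payoff_nonneg (P : Store → Prop) (s : Store) : 0 ≤ payoff P s := by
  unfold payoff; split_ifs <;> norm_num

theorem payoff_le_one (P : Store → Prop) (s : Store) : payoff P s ≤ 1 := by
  unfold payoff; split_ifs <;> norm_num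

theorem payoff_of {P : Store → Prop} {s : Store} (h : P s) : payoff P s = 1 := if_pos h

theorem one_le_payoff {P : Store → Prop} {s : Store} : 1 ≤ payoff P s ↔ P s := by
  unfold payoff; split_ifs with h <;> simp [h]

/-! ### Probabilities of runs as expected payoffs -/

theorem runFor_succ {n : ℕ} (f : Cube n → Bool) (c : Config n) (t : ℕ) :
    runFor f c (t + 1) = (step f c).bind fun c' => runFor f c' t := by
  induction t with
  | zero => simp [runFor]
  | succ t ih =>
    rw [runFor, ih, PMF.bind_bind]
    rfl

/-- The record of examples influences neither the steps nor the event, so it can be dropped. From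
here on, correctness and running time are treated through `expect`; the record matters only for the
rule on queries. -/
theorem toOuterMeasure_runFor {n : ℕ} (f : Cube n → Bool) (P : Store → Prop) (t : ℕ)
    (c : Config n) : (runFor f c t).toOuterMeasure {c | c.todo = [] ∧ P c.store} =
      ENNReal.ofReal (expect f (payoff P) t c.todo c.store) := by
  have hn := expect_nonneg (f := f) (payoff_nonneg P)
  induction t generalizing c with
  | zero =>
    rcases c with ⟨_ | ⟨p, r⟩, s, S⟩
    · by_cases h : P s <;> simp [runFor, PMF.toOuterMeasure_pure_apply, expect, payoff, h]
    · simp [runFor, PMF.toOuterMeasure_pure_apply, expect]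
  | succ t ih =>
    rw [runFor_succ]
    rcases c with ⟨_ | ⟨p, r⟩, s, S⟩
    · simp only [step, PMF.pure_bind, ih, expect_nil]
    · cases p <;> simp only [step, PMF.pure_bind, PMF.bind_bind, ih, expect]
      · exact toOuterMeasure_uniform_bind _ _ _ (fun _ => hn _ _ _) fun x => ih _
      · exact toOuterMeasure_uniform_bind _ _ _ (fun _ => hn _ _ _) fun x => ih _

theorem support_runFor_of_expect {n : ℕ} {f : Cube n → Bool} {P : Store → Prop} {t : ℕ}
    {c : Config n} (h : 1 ≤ expect f (payoff P) t c.todo c.store) :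
    ∀ c' ∈ (runFor f c t).support, c'.todo = [] ∧ P c'.store := by
  have h1 : (runFor f c t).toOuterMeasure {c | c.todo = [] ∧ P c.store} = 1 := by
    rw [toOuterMeasure_runFor, le_antisymm (expect_le_one (payoff_le_one P) _ _ _) h,
      ENNReal.ofReal_one]
  exact ((runFor f c t).toOuterMeasure_apply_eq_one_iff _).mp h1

theorem expect_of_support_runFor {n : ℕ} {f : Cube n → Bool} {P : Store → Prop} {t : ℕ}
    {c : Config n} (h : ∀ c' ∈ (runFor f c t).support, c'.todo = [] ∧ P c'.store) :
    1 ≤ expect f (payoff P) t c.todo c.store := by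
  have h1 := ((runFor f c t).toOuterMeasure_apply_eq_one_iff {c | c.todo = [] ∧ P c.store}).mpr h
  rw [toOuterMeasure_runFor, ENNReal.ofReal_eq_one] at h1
  exact h1.ge

/-! ### Executions with bounded loops -/

/-- The number of steps of a program whose loops are iterated at most `W` times. -/
def Prog.cost (W : ℕ) : Prog → ℕ
  | .assign _ _ => 1
  | .seq p q => p.cost W + q.cost W + 1
  | .cond _ p q => p.cost W + q.cost W + 1
  | .loop _ p => W * (p.cost W + 1)
  | .flip _ => 1
  | .draw _ => 1
  | .query _ => 1

/-- The expectation of the payoff `K` of the store after the execution of a program; executions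
in which a loop is tested more than `W` times in a row pay nothing. -/
noncomputable def Prog.val (W : ℕ) {n : ℕ} (f : Cube n → Bool) :
    Prog → (Store → ℝ) → Store → ℝ
  | .assign v e, K => fun s => K (Function.update s v (e.eval s))
  | .seq p q, K => p.val W f (q.val W f K)
  | .cond e p q, K => fun s => if (e.eval s).isPair then p.val W f K s else q.val W f K s
  | .loop e p, K =>
      (fun X s => if (e.eval s).isPair then p.val W f X s else K s)^[W] (fun _ => 0)
  | .flip v, K => fun s => avg fun b => K (Function.update s v (Data.ofBool b))
  | .draw v, K => fun s => avg fun x : Cube n =>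
      K (Function.update s v (.cons (Data.ofPoint x) (Data.ofBool (f x))))
  | .query v, K => fun s => K (Function.update s v (Data.ofBool (f (Data.toPoint n (s v)))))

/-- The value of `loop e p` when at most `m` tests are made. -/
noncomputable def loopVal (W : ℕ) {n : ℕ} (f : Cube n → Bool) (e : Expr) (p : Prog)
    (K : Store → ℝ) : ℕ → Store → ℝ
  | 0 => fun _ => 0
  | m + 1 => fun s => if (e.eval s).isPair then p.val W f (loopVal W f e p K m) s else K s

section val
variable {n : ℕ} {f : Cube n → Bool}

theorem val_loop (W : ℕ) (e : Expr) (p : Prog) (K : Store → ℝ) :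
    (Prog.loop e p).val W f K = loopVal W f e p K W := by
  have : ∀ m, (fun (X : Store → ℝ) s => if (e.eval s).isPair then p.val W f X s else K s)^[m]
      (fun _ => 0) = loopVal W f e p K m := by
    intro m
    induction m with
    | zero => rfl
    | succ m ih => rw [Function.iterate_succ_apply', ih]; rfl
  exact this W

theorem val_assign (W v : ℕ) (e : Expr) (K : Store → ℝ) (s : Store) :
    (Prog.assign v e).val W f K s = K (Function.update s v (e.eval s)) := rfl

theorem val_seq (W : ℕ) (p q : Prog) (K : Store → ℝ) (s : Store) :
    (Prog.seq p q).val W f K s = p.val W f (q.val W f K) s := rfl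

theorem val_cond (W : ℕ) (e : Expr) (p q : Prog) (K : Store → ℝ) (s : Store) :
    (Prog.cond e p q).val W f K s =
      if (e.eval s).isPair then p.val W f K s else q.val W f K s := rfl

theorem val_flip (W v : ℕ) (K : Store → ℝ) (s : Store) : (Prog.flip v).val W f K s =
    avg fun b => K (Function.update s v (Data.ofBool b)) := rfl

theorem val_draw (W v : ℕ) (K : Store → ℝ) (s : Store) : (Prog.draw v).val W f K s =
    avg fun x : Cube n =>
      K (Function.update s v (.cons (Data.ofPoint x) (Data.ofBool (f x)))) := rfl

/-- Monotonicity of the body is a hypothesis here because the lemma is needed inside the induction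
that proves `val_mono`. -/
theorem loopVal_mono_payoff {W : ℕ} {e : Expr} {p : Prog}
    (hp : ∀ {K K' : Store → ℝ}, (∀ s, K s ≤ K' s) → ∀ s, p.val W f K s ≤ p.val W f K' s)
    {K K' : Store → ℝ} (h : ∀ s, K s ≤ K' s) (m : ℕ) (s : Store) :
    loopVal W f e p K m s ≤ loopVal W f e p K' m s := by
  induction m generalizing s with
  | zero => exact le_rfl
  | succ m ih =>
    simp only [loopVal]
    split_ifs
    · exact hp ih s
    · exact h s

theorem val_mono {W : ℕ} {p : Prog} {K K' : Store → ℝ} (h : ∀ s, K s ≤ K' s) (s : Store) :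
    p.val W f K s ≤ p.val W f K' s := by
  induction p generalizing K K' s with
  | assign v e => exact h _
  | seq p q ihp ihq => exact ihp (ihq h) s
  | cond e p q ihp ihq =>
    simp only [Prog.val]; split_ifs
    · exact ihp h s
    · exact ihq h s
  | loop e p ih =>
    rw [val_loop, val_loop]
    exact loopVal_mono_payoff ih h W s
  | flip v => exact avg_mono fun _ => h _
  | draw v => exact avg_mono fun _ => h _
  | query v => exact h _

theorem val_nonneg {W : ℕ} {p : Prog} {K : Store → ℝ} (h : ∀ s, 0 ≤ K s) (s : Store) :
    0 ≤ p.val W f K s := by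
  induction p generalizing K s with
  | assign v e => exact h _
  | seq p q ihp ihq => exact ihp (ihq h) s
  | cond e p q ihp ihq =>
    simp only [Prog.val]; split_ifs
    · exact ihp h s
    · exact ihq h s
  | loop e p ih =>
    rw [val_loop]
    have : ∀ m s, 0 ≤ loopVal W f e p K m s := by
      intro m
      induction m with
      | zero => intro s; exact le_rfl
      | succ m ihm =>
        intro s; simp only [loopVal]; split_ifs
        · exact ih ihm s
        · exact h s
    exact this W s
  | flip v => exact avg_nonneg fun _ => h _
  | draw v => exact avg_nonneg fun _ => h _
  | query v => exact h _

theorem loopVal_nonneg {W : ℕ} {e : Expr} {p : Prog} {K : Store → ℝ} (h : ∀ s, 0 ≤ K s) (m : ℕ)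
    (s : Store) : 0 ≤ loopVal W f e p K m s := by
  induction m generalizing s with
  | zero => exact le_rfl
  | succ m ihm =>
    simp only [loopVal]; split_ifs
    · exact val_nonneg ihm s
    · exact h s

theorem loopVal_le_succ {W : ℕ} {e : Expr} {p : Prog} {K : Store → ℝ} (h : ∀ s, 0 ≤ K s) (m : ℕ)
    (s : Store) : loopVal W f e p K m s ≤ loopVal W f e p K (m + 1) s := by
  induction m generalizing s with
  | zero => exact loopVal_nonneg h 1 s
  | succ m ihm =>
    rw [loopVal, loopVal]; dsimp only; split_ifs
    · exact val_mono ihm s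
    · exact le_rfl

theorem val_le_succ {W : ℕ} {p : Prog} {K : Store → ℝ} (h : ∀ s, 0 ≤ K s) (s : Store) :
    p.val W f K s ≤ p.val (W + 1) f K s := by
  induction p generalizing K s with
  | assign v e => exact le_rfl
  | seq p q ihp ihq => exact (ihp (val_nonneg h) s).trans (val_mono (ihq h) s)
  | cond e p q ihp ihq =>
    simp only [Prog.val]; split_ifs
    · exact ihp h s
    · exact ihq h s
  | loop e p ih =>
    rw [val_loop, val_loop]
    have : ∀ m s, loopVal W f e p K m s ≤ loopVal (W + 1) f e p K m s := by
      intro m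
      induction m with
      | zero => intro s; exact le_rfl
      | succ m ihm =>
        intro s; simp only [loopVal]; split_ifs
        · exact (ih (loopVal_nonneg h m) s).trans (val_mono ihm s)
        · exact le_rfl
    exact (this W s).trans (loopVal_le_succ h W s)
  | flip v => exact le_rfl
  | draw v => exact le_rfl
  | query v => exact le_rfl

theorem loopVal_le_succ_bound {W : ℕ} {e : Expr} {p : Prog} {K : Store → ℝ} (h : ∀ s, 0 ≤ K s)
    (m : ℕ) (s : Store) : loopVal W f e p K m s ≤ loopVal (W + 1) f e p K m s := by
  induction m generalizing s with
  | zero => exact le_rfl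
  | succ m ihm =>
    simp only [loopVal]; split_ifs
    · exact (val_le_succ (loopVal_nonneg h m) s).trans (val_mono ihm s)
    · exact le_rfl

/-- Correctness and running time in one statement: `K` is a lower bound for what the remaining stack
earns in `B` steps, and the program in front needs at most `p.cost W` more. Executions that exceed
the loop bound count as zero in `val`, so they do no harm. -/
theorem val_le_expect {Φ : Store → ℝ} (hΦ : ∀ s, 0 ≤ Φ s) {W : ℕ} {p : Prog} {K : Store → ℝ}
    {B : ℕ} {r : List Prog} (h : ∀ s, K s ≤ expect f Φ B r s) (s : Store) :
    p.val W f K s ≤ expect f Φ (B + p.cost W) (p :: r) s := by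
  induction p generalizing K B r s with
  | assign v e => exact h _
  | seq p q ihp ihq =>
    refine (ihp (ihq h) s).trans (le_of_eq ?_)
    rw [Prog.cost, show B + (p.cost W + q.cost W + 1) = (B + q.cost W + p.cost W) + 1 by ring]
    rfl
  | cond e p q ihp ihq =>
    rw [Prog.cost, ← add_assoc, expect]
    simp only [Prog.val]; split_ifs
    · exact (ihp h s).trans (expect_mono_time hΦ (by omega) _ _)
    · exact (ihq h s).trans (expect_mono_time hΦ (by omega) _ _)
  | loop e p ih =>
    rw [val_loop]
    have : ∀ m s, loopVal W f e p K m s ≤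
        expect f Φ (B + m * (p.cost W + 1)) (.loop e p :: r) s := by
      intro m
      induction m with
      | zero => intro s; exact expect_nonneg hΦ _ _ _
      | succ m ihm =>
        intro s
        rw [show B + (m + 1) * (p.cost W + 1) = (B + m * (p.cost W + 1) + p.cost W) + 1 by ring,
          expect]
        simp only [loopVal]; split_ifs
        · exact ih ihm s
        · exact (h s).trans (expect_mono_time hΦ (by omega) _ _)
    exact this W s
  | flip v => exact avg_mono fun _ => h _
  | draw v => exact avg_mono fun _ => h _
  | query v => exact h _

end val

/-- The value of a stack of programs. -/
noncomputable def stackVal (W : ℕ) {n : ℕ} (f : Cube n → Bool) (todo : List Prog)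
    (K : Store → ℝ) : Store → ℝ :=
  todo.foldr (fun p X => p.val W f X) K

theorem stackVal_cons {W n : ℕ} {f : Cube n → Bool} {K : Store → ℝ} (p : Prog)
    (r : List Prog) : stackVal W f (p :: r) K = p.val W f (stackVal W f r K) := rfl

theorem stackVal_nonneg {W n : ℕ} {f : Cube n → Bool} {K : Store → ℝ} (h : ∀ s, 0 ≤ K s)
    (todo : List Prog) (s : Store) : 0 ≤ stackVal W f todo K s := by
  induction todo generalizing s with
  | nil => exact h s
  | cons p r ih => exact val_nonneg ih s

theorem stackVal_le_succ {W n : ℕ} {f : Cube n → Bool} {K : Store → ℝ} (h : ∀ s, 0 ≤ K s)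
    (todo : List Prog) (s : Store) : stackVal W f todo K s ≤ stackVal (W + 1) f todo K s := by
  induction todo generalizing s with
  | nil => exact le_rfl
  | cons p r ih => exact (val_le_succ (stackVal_nonneg h r) s).trans (val_mono ih s)

/-- The step of a stack that starts with a loop. -/
theorem stackVal_loop_le {W n : ℕ} {f : Cube n → Bool} {K : Store → ℝ} (h : ∀ s, 0 ≤ K s)
    (e : Expr) (p : Prog) (r : List Prog) (s : Store) :
    stackVal W f (if (e.eval s).isPair then p :: .loop e p :: r else r) K s ≤
      stackVal (W + 1) f (.loop e p :: r) K s := by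
  rw [stackVal_cons, val_loop, loopVal]
  dsimp only
  split_ifs with hs
  · rw [stackVal_cons, stackVal_cons]
    refine (val_le_succ (val_nonneg (stackVal_nonneg h r)) s).trans (val_mono (fun s => ?_) s)
    rw [val_loop]
    refine (loopVal_mono_payoff val_mono (stackVal_le_succ h r) W s).trans ?_
    exact loopVal_le_succ_bound (stackVal_nonneg h r) W s
  · exact stackVal_le_succ h r s

/-! ### A functional language compiled to deterministic programs -/

/-- Replace every variable of an expression by `b`. -/
def Expr.at (b : ℕ) : Expr → Expr
  | .var _ => .var b
  | .nil => .nil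
  | .cons e e' => .cons (e.at b) (e'.at b)
  | .head e => .head (e.at b)
  | .tail e => .tail (e.at b)

theorem Expr.eval_at (b : ℕ) (e : Expr) (s : Store) :
    (e.at b).eval s = e.eval fun _ => s b := by
  induction e <;> simp_all [Expr.at, Expr.eval]

/-- Functions on trees. In `prim e` and `cond e F G` every variable of `e` stands for the argument;
`iter F` iterates `F` a number of times that is a global parameter. -/
inductive Fn : Type
  | prim : Expr → Fn
  | comp : Fn → Fn → Fn
  | pair : Fn → Fn → Fn
  | cond : Expr → Fn → Fn → Fn
  | iter : Fn → Fn

/-- The function denoted by a term when `u` is the number of iterations; `comp F G` is `F` followed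
by `G`. -/
def Fn.eval (u : ℕ) : Fn → Data → Data
  | .prim e, d => e.eval fun _ => d
  | .comp F G, d => G.eval u (F.eval u d)
  | .pair F G, d => .cons (F.eval u d) (G.eval u d)
  | .cond e F G, d => if (e.eval fun _ => d).isPair then F.eval u d else G.eval u d
  | .iter F, d => (F.eval u)^[u] d

/-- The program that replaces the value of variable `b` by its image. It uses only variables from
`b` on and reads the number of iterations from variable `w`. -/
def Fn.compile (w : ℕ) : ℕ → Fn → Prog
  | b, .prim e => .assign b (e.at b)
  | b, .comp F G => .seq (F.compile w b) (G.compile w b)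
  | b, .pair F G =>
      .seq (.assign (b + 1) (.var b)) (.seq (F.compile w (b + 1)) (.seq (.assign (b + 2) (.var b))
        (.seq (G.compile w (b + 2)) (.assign b (.cons (.var (b + 1)) (.var (b + 2)))))))
  | b, .cond e F G => .cond (e.at b) (F.compile w b) (G.compile w b)
  | b, .iter F =>
      .seq (.assign (b + 1) (.var b)) (.seq (.assign b (.var w)) (.seq
        (.loop (.var b) (.seq (.assign b (.tail (.var b))) (F.compile w (b + 1))))
        (.assign b (.var (b + 1)))))

theorem Fn.compile_deterministic (w b : ℕ) (F : Fn) : (F.compile w b).Deterministic := by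
  induction F generalizing b <;> simp_all [Fn.compile, Prog.Deterministic]

theorem Data.ofNat_zero : Data.ofNat 0 = .nil := rfl

theorem Data.ofNat_succ (m : ℕ) : Data.ofNat (m + 1) = .cons .nil (Data.ofNat m) := rfl

/-- The rule for a loop that counts down a unary number in variable `c`. -/
theorem le_loopVal {n W : ℕ} {f : Cube n → Bool} {c : ℕ} {p : Prog} {K : Store → ℝ}
    (I : ℕ → Store → Prop) (v : ℕ → ℝ)
    (hI : ∀ i s, I i s → s c = Data.ofNat i)
    (hstep : ∀ i s m, I (i + 1) s → (∀ s', I i s' → v i ≤ loopVal W f (.var c) p K m s') →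
      v (i + 1) ≤ p.val W f (loopVal W f (.var c) p K m) s)
    (hend : ∀ s, I 0 s → v 0 ≤ K s) {m i : ℕ} (hi : i < m) {s : Store} (hs : I i s) :
    v i ≤ loopVal W f (.var c) p K m s := by
  induction m generalizing i s with
  | zero => omega
  | succ m ih =>
    rcases i with _ | i
    · simp [loopVal, Expr.eval, hI _ _ hs, Data.ofNat_zero, Data.isPair, hend _ hs]
    · simp only [loopVal, Expr.eval, hI _ _ hs, Data.ofNat_succ, Data.isPair, if_true]
      exact hstep i s m hs fun s' hs' => ih (by omega) hs'

/-- A rule in the style of weakest preconditions. Compiled terms are deterministic, so nothing of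
the value is lost; variables from `b` on are scratch space, about which only the result in `b` is
known. -/
theorem le_val_compile {n W : ℕ} {f : Cube n → Bool} {u w b : ℕ} (F : Fn) {K : Store → ℝ}
    {s : Store} {v : ℝ} (hw : w < b) (hu : s w = Data.ofNat u) (hW : u < W)
    (h : ∀ s', s' b = F.eval u (s b) → (∀ x < b, s' x = s x) → v ≤ K s') :
    v ≤ (F.compile w b).val W f K s := by
  induction F generalizing b K s with
  | prim e =>
    refine h _ ?_ fun x hx => Function.update_of_ne hx.ne _ _
    rw [Function.update_self, Expr.eval_at]; rfl
  | comp F G ihF ihG =>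
    refine ihF hw hu fun s' h1 h2 => ihG hw ((h2 _ hw).trans hu) fun s'' h3 h4 => h _ ?_ ?_
    · rw [h3, h1]; rfl
    · intro x hx; rw [h4 x hx, h2 x hx]
  | pair F G ihF ihG =>
    simp only [Fn.compile, Prog.val]
    refine ihF (by omega) (by simp [Function.update, hu]; omega) fun s1 h1 h2 => ?_
    have h2' : ∀ x < b + 1, s1 x = s x := fun x hx => by
      rw [h2 x hx, Function.update_of_ne hx.ne]
    refine ihG (by omega) ?_ fun s2 h3 h4 => h _ ?_ ?_
    · rw [Function.update_of_ne (by omega), h2' _ (by omega), hu]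
    · rw [Function.update_self]
      simp only [Expr.eval, Fn.eval, h3, h4 (b + 1) (by omega)]
      simp [Function.update, h1, Expr.eval, h2' b]
    · intro x hx
      rw [Function.update_of_ne hx.ne, h4 x (by omega), Function.update_of_ne (by omega),
        h2' x (by omega)]
  | cond e F G ihF ihG =>
    simp only [Fn.compile, Prog.val, Expr.eval_at]
    split_ifs with he
    · exact ihF hw hu fun s' h1 h2 => h s' (by rw [h1, Fn.eval, if_pos he]) h2
    · exact ihG hw hu fun s' h1 h2 => h s' (by rw [h1, Fn.eval, if_neg he]) h2
  | iter F ih =>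
    simp only [Fn.compile, val_seq, val_assign, val_loop]
    -- Invariant: with `i` rounds to go, `i` more applications of `F` to the current value in `b +
    -- 1` give the final result. The bound `u < W` is strict because the loop is tested once more at
    -- the end.
    refine le_loopVal (fun i s' => s' b = Data.ofNat i ∧ (∀ x < b, s' x = s x) ∧
      (F.eval u)^[i] (s' (b + 1)) = (F.eval u)^[u] (s b)) (fun _ => v) (fun i s' h => h.1)
      ?_ ?_ hW ?_
    · rintro i s1 m ⟨h1, h2, h3⟩ hX
      refine ih (by omega) ?_ fun s2 h4 h5 => hX _ ⟨?_, ?_, ?_⟩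
      · rw [Function.update_of_ne (by omega), h2 _ hw, hu]
      · rw [h5 b (by omega), Function.update_self, Expr.eval, Expr.eval, h1]; rfl
      · intro x hx; rw [h5 x (by omega), Function.update_of_ne hx.ne, h2 x hx]
      · rw [← h3, h4, Function.update_of_ne (by omega)]; rfl
    · rintro s1 ⟨h1, h2, h3⟩
      refine h _ ?_ fun x hx => by rw [Function.update_of_ne hx.ne, h2 x hx]
      rw [Function.update_self]; exact h3
    · refine ⟨?_, ?_, ?_⟩
      · rw [Function.update_self]; simp only [Expr.eval]; rw [Function.update_of_ne (by omega), hu]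
      · intro x hx; rw [Function.update_of_ne hx.ne, Function.update_of_ne (by omega)]
      · rw [Function.update_of_ne (by omega), Function.update_self]; rfl

/-- The power of the number of iterations. -/
def Fn.iterPow (F : Fn) : ℕ → Fn
  | 0 => F
  | c + 1 => .iter (F.iterPow c)

theorem Fn.eval_iterPow (u : ℕ) (F : Fn) (c : ℕ) (d : Data) :
    (F.iterPow c).eval u d = (F.eval u)^[u ^ c] d := by
  induction c generalizing d with
  | zero => simp [Fn.iterPow]
  | succ c ih =>
    rw [Fn.iterPow, Fn.eval, pow_succ, Function.iterate_mul]
    congr 1; funext d; exact ih d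

/-- Fold over the list in the first component of the argument: as long as it is not empty, the
argument is replaced by its image under `F`, which has to remove the first element. -/
def Fn.fold (c : ℕ) (F : Fn) : Fn :=
  (Fn.cond (.head (.var 0)) F (.prim (.var 0))).iterPow c

/-- All `u ^ c` iterations are carried out, but those after the end of the list do nothing. The
invariant `P` allows `F` to be correct only on states that are small enough for its own inner
iterations. -/
theorem Fn.eval_fold {u c : ℕ} {F : Fn} {α β : Type*} (eα : α → Data) (eβ : β → Data)
    (g : α → β → α) (P : List β → α → Prop) (hP : ∀ a b l, P (b :: l) a → P l (g a b))
    (hF : ∀ a b l d, P (b :: l) a →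
      F.eval u (.cons (.cons (eβ b) d) (eα a)) = .cons d (eα (g a b)))
    (l : List β) (hl : l.length ≤ u ^ c) (a : α) (ha : P l a) :
    (Fn.fold c F).eval u (.cons (Data.ofList (l.map eβ)) (eα a)) =
      .cons .nil (eα (l.foldl g a)) := by
  rw [Fn.fold, Fn.eval_iterPow]
  generalize u ^ c = m at hl
  induction m generalizing l a with
  | zero =>
    obtain rfl : l = [] := by simpa using hl
    rfl
  | succ m ih =>
    rw [Function.iterate_succ_apply]
    rcases l with _ | ⟨b, l⟩
    · exact ih [] a ha (by simp)
    · rw [List.foldl_cons, ← ih l _ (hP _ _ _ ha) (by simpa using hl)]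
      congr 1
      simp only [Fn.eval, Expr.eval, Data.head, List.map_cons, Data.ofList, Data.isPair, if_true]
      exact hF _ _ _ _ ha

theorem Data.ofNat_eq (m : ℕ) :
    Data.ofNat m = Data.ofList ((List.replicate m ()).map fun _ => Data.nil) := by
  simp [Data.ofNat]

/-- `Fn.eval_fold` for a unary number in place of a list. -/
theorem Fn.eval_fold_nat {u c : ℕ} {F : Fn} {α : Type*} (eα : α → Data) (g : α → α)
    (P : ℕ → α → Prop) (hP : ∀ a m, P (m + 1) a → P m (g a))
    (hF : ∀ a m d, P (m + 1) a → F.eval u (.cons (.cons .nil d) (eα a)) = .cons d (eα (g a)))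
    (m : ℕ) (hm : m ≤ u ^ c) (a : α) (ha : P m a) :
    (Fn.fold c F).eval u (.cons (Data.ofNat m) (eα a)) = .cons .nil (eα (g^[m] a)) := by
  rw [Data.ofNat_eq, Fn.eval_fold eα (fun _ => .nil) (fun a _ => g a) (fun l a => P l.length a)
    (fun a _ l h => hP a _ h) (fun a _ l d h => hF a _ d h) _ (by simpa) a (by simpa)]
  congr 2
  clear ha hm
  induction m generalizing a with
  | zero => rfl
  | succ m ih => exact ih (g a)

/-- Every program runs in polynomial time in the bound on its loops. -/
theorem exists_cost_le_pow (p : Prog) (J : ℕ) : ∃ J', ∀ u, 2 ≤ u → p.cost (u ^ J) ≤ u ^ J' := by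
  have hadd : ∀ {a b c u : ℕ}, 2 ≤ u → b ≤ u ^ a → c ≤ u ^ a → b + c + 1 ≤ u ^ (a + 2) := by
    intro a b c u hu hb hc
    have h1 : 1 ≤ u ^ a := Nat.one_le_pow _ _ (by omega)
    have h4 : 4 ≤ u ^ 2 := Nat.pow_le_pow_left hu 2
    rw [pow_add]
    nlinarith
  induction p with
  | seq p q ihp ihq =>
    obtain ⟨a, ha⟩ := ihp
    obtain ⟨b, hb⟩ := ihq
    refine ⟨max a b + 2, fun u hu => hadd hu ((ha u hu).trans ?_) ((hb u hu).trans ?_)⟩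
    · exact Nat.pow_le_pow_right (by omega) (le_max_left _ _)
    · exact Nat.pow_le_pow_right (by omega) (le_max_right _ _)
  | cond e p q ihp ihq =>
    obtain ⟨a, ha⟩ := ihp
    obtain ⟨b, hb⟩ := ihq
    refine ⟨max a b + 2, fun u hu => hadd hu ((ha u hu).trans ?_) ((hb u hu).trans ?_)⟩
    · exact Nat.pow_le_pow_right (by omega) (le_max_left _ _)
    · exact Nat.pow_le_pow_right (by omega) (le_max_right _ _)
  | loop e p ih =>
    obtain ⟨a, ha⟩ := ih
    refine ⟨J + (a + 2), fun u hu => ?_⟩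
    rw [Prog.cost, pow_add]
    refine Nat.mul_le_mul_left _ ?_
    simpa using hadd hu (ha u hu) (Nat.zero_le _)
  | _ => exact ⟨0, fun u hu => by simp [Prog.cost]⟩

/-! ### The functions computed by the learner and by its evaluator -/

/-- The argument without its first `i` components. -/
def Expr.rest : ℕ → Expr
  | 0 => .var 0
  | i + 1 => .tail (Expr.rest i)

/-- Component `i` of the argument. -/
def Expr.arg (i : ℕ) : Expr := .head (Expr.rest i)

/-- The code of the bit `true`. -/
def Expr.one : Expr := .cons .nil .nil

/-- Put `p` empty trees in front of a list. -/
def Data.pad (p : ℕ) (d : Data) : Data := (Data.cons .nil)^[p] d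

theorem Data.pad_succ (p : ℕ) (d : Data) : Data.pad (p + 1) d = .cons .nil (Data.pad p d) :=
  Function.iterate_succ_apply' _ _ _

theorem Data.pad_ofNat (p q : ℕ) : Data.pad p (Data.ofNat q) = Data.ofNat (p + q) := by
  induction p with
  | zero => simp [Data.pad]
  | succ p ih => rw [Data.pad_succ, ih, Nat.add_right_comm, Data.ofNat_succ]

/-! ### Unary arithmetic, and the colour of a list of bits -/

section Fn
variable {u : ℕ}

open LocalQueries.Expr (arg rest one)
open LocalQueries.Fn (prim comp pair cond fold)

/-- Add `u ^ c` to a unary number. -/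
def incFn (c : ℕ) : Fn := (prim (.cons .nil (.var 0))).iterPow c

theorem eval_incFn (c m : ℕ) : (incFn c).eval u (Data.ofNat m) = Data.ofNat (u ^ c + m) := by
  rw [incFn, Fn.eval_iterPow, ← Data.pad_ofNat]
  rfl

/-- `(p, d) ↦ (nil, d)` with `p` empty trees in front of `d`. -/
def addFn (c : ℕ) : Fn := fold c (prim (.cons (.tail (arg 0)) (.cons .nil (rest 1))))

theorem eval_addFn {c p : ℕ} (hp : p ≤ u ^ c) (d : Data) :
    (addFn c).eval u (.cons (Data.ofNat p) d) = .cons .nil (Data.pad p d) :=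
  Fn.eval_fold_nat id (Data.cons .nil) (fun _ _ => True) (fun _ _ _ => trivial)
    (fun _ _ _ _ => rfl) p hp d trivial

/-- `(y, (b, a)) ↦ (nil, (b, y * b + a))`. -/
def mulFn (c : ℕ) : Fn :=
  fold c (pair (prim (.tail (arg 0))) (pair (prim (arg 1))
    (comp (prim (.cons (arg 1) (rest 2))) (comp (addFn c) (prim (rest 1))))))

theorem eval_mulFn {c y b : ℕ} (hy : y ≤ u ^ c) (hb : b ≤ u ^ c) (a : ℕ) :
    (mulFn c).eval u (.cons (Data.ofNat y) (.cons (Data.ofNat b) (Data.ofNat a))) =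
      .cons .nil (.cons (Data.ofNat b) (Data.ofNat (y * b + a))) := by
  rw [mulFn, Fn.eval_fold_nat (fun a => .cons (Data.ofNat b) (Data.ofNat a)) (fun a => b + a)
    (fun _ _ => True) (fun _ _ _ => trivial) ?_ y hy a trivial]
  · congr 3
    induction y with
    | zero => simp
    | succ y ih => rw [Function.iterate_succ_apply', ih (by omega)]; ring
  · intro a m d _
    simp [Fn.eval, Expr.eval, arg, rest, Data.head, Data.tail, eval_addFn hb, Data.pad_ofNat]

/-- The geometric sum `1 + b + ⋯ + b ^ (d - 1)`. -/
def geom (b : ℕ) : ℕ → ℕ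
  | 0 => 0
  | d + 1 => 1 + geom b d * b

/-- `(y, b) ↦ (1 + y * b, b)`. -/
def hornerFn (c : ℕ) : Fn :=
  comp (prim (.cons (arg 0) (.cons (rest 1) .nil)))
    (comp (mulFn c) (prim (.cons (.cons .nil (rest 2)) (arg 1))))

theorem eval_hornerFn {c y b : ℕ} (hy : y ≤ u ^ c) (hb : b ≤ u ^ c) :
    (hornerFn c).eval u (.cons (Data.ofNat y) (Data.ofNat b)) =
      .cons (Data.ofNat (1 + y * b)) (Data.ofNat b) := by
  have := eval_mulFn hy hb 0
  rw [Data.ofNat_zero] at this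
  simp [hornerFn, Fn.eval, Expr.eval, arg, rest, Data.head, Data.tail, this, add_comm 1,
    Data.ofNat_succ]

/-- `F`, applied `d` times. -/
def Fn.times (F : Fn) : ℕ → Fn
  | 0 => prim (.var 0)
  | d + 1 => comp (F.times d) F

/-- `b ↦ geom b d`. -/
def geomFn (c d : ℕ) : Fn :=
  comp (prim (.cons .nil (.var 0))) (comp ((hornerFn c).times d) (prim (arg 0)))

theorem geom_le_succ (b d : ℕ) : geom b d ≤ geom b (d + 1) := by
  induction d with
  | zero => simp [geom]
  | succ d ih => rw [geom, geom]; gcongr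

theorem eval_geomFn {c b d : ℕ} (hb : b ≤ u ^ c) (hd : geom b d ≤ u ^ c) :
    (geomFn c d).eval u (Data.ofNat b) = Data.ofNat (geom b d) := by
  have : ((hornerFn c).times d).eval u (.cons .nil (Data.ofNat b)) =
      .cons (Data.ofNat (geom b d)) (Data.ofNat b) := by
    induction d with
    | zero => rfl
    | succ d ih =>
      have hd' := (geom_le_succ b d).trans hd
      rw [Fn.times, Fn.eval, ih hd', eval_hornerFn hd' hb, geom]
  simp [geomFn, Fn.eval, Expr.eval, this, arg, rest, Data.head]

/-- The weighted sum of the bits of a list, where bit number `i` has weight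
`geom ((i + 1) * q) d`. -/
def weightSum (q d : ℕ) : ℕ → List Bool → ℕ
  | _, [] => 0
  | i, b :: l => (if b then geom ((i + 1) * q) d else 0) + weightSum q d (i + 1) l

/-- The code of a list of bits is mapped to its weighted sum for `q = u ^ e`. -/
def colorFn (c e d : ℕ) : Fn :=
  comp (prim (.cons (.var 0) (.cons .nil .nil))) (comp
    (fold 1 (comp (pair (comp (prim (arg 1)) (incFn e)) (prim (.var 0)))
      (cond (.head (arg 1))
        (pair (prim (.tail (arg 1))) (pair (prim (arg 0))
          (comp (pair (comp (prim (arg 0)) (geomFn c d)) (prim (rest 3)))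
            (comp (addFn c) (prim (rest 1))))))
        (prim (.cons (.tail (arg 1)) (.cons (arg 0) (rest 3)))))))
    (prim (rest 2)))

theorem eval_colorFn {c e d : ℕ} (l : List Bool) (hl : l.length ≤ u)
    (hc : ∀ i ≤ l.length, i * u ^ e ≤ u ^ c ∧ geom (i * u ^ e) d ≤ u ^ c) :
    (colorFn c e d).eval u (Data.ofList (l.map Data.ofBool)) =
      Data.ofNat (weightSum (u ^ e) d 0 l) := by
  have key := Fn.eval_fold (u := u) (c := 1)
    (F := comp (pair (comp (prim (arg 1)) (incFn e)) (prim (.var 0)))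
      (cond (.head (arg 1))
        (pair (prim (.tail (arg 1))) (pair (prim (arg 0))
          (comp (pair (comp (prim (arg 0)) (geomFn c d)) (prim (rest 3)))
            (comp (addFn c) (prim (rest 1))))))
        (prim (.cons (.tail (arg 1)) (.cons (arg 0) (rest 3))))))
    (fun a : ℕ × ℕ => .cons (Data.ofNat (a.1 * u ^ e)) (Data.ofNat a.2)) Data.ofBool
    (fun a b => (a.1 + 1, (if b then geom ((a.1 + 1) * u ^ e) d else 0) + a.2))
    (fun l' a => a.1 + l'.length ≤ l.length) (fun a b l' h => by simp at h ⊢; omega)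
    (fun a b l' d' h => ?_) l (by simpa using hl) (0, 0) (by simp)
  · have hfold : ∀ (l : List Bool) (a : ℕ × ℕ),
        (l.foldl (fun a b => (a.1 + 1,
          (if b then geom ((a.1 + 1) * u ^ e) d else 0) + a.2)) a).2 =
          weightSum (u ^ e) d a.1 l + a.2 := by
      intro l
      induction l with
      | nil => intro a; simp [weightSum]
      | cons b l ih => intro a; rw [List.foldl_cons, ih, weightSum]; dsimp only; ring
    simp only [zero_mul, Data.ofNat_zero] at key
    simp only [colorFn, Fn.eval, Expr.eval]
    rw [key]
    simp [rest, Expr.eval, Data.tail, hfold]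
  · have h1 := hc (a.1 + 1) (by simp at h; omega)
    have h2 : u ^ e + a.1 * u ^ e = (a.1 + 1) * u ^ e := by ring
    cases b <;> simp [Fn.eval, Expr.eval, arg, rest, Data.head, Data.tail, eval_incFn, h2,
      Data.ofBool, Data.isPair, eval_geomFn h1.1 h1.2, eval_addFn h1.2, Data.pad_ofNat]

/-- `(p, (q, nil))` is mapped to the code of the bit `p = q`. -/
def eqFn (c : ℕ) : Fn :=
  comp (fold c (cond (arg 1) (prim (.cons (.tail (arg 0)) (.cons (.tail (arg 1)) (rest 2))))
      (prim (.cons (.tail (arg 0)) (.cons .nil one)))))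
    (cond (rest 2) (prim .nil) (cond (arg 1) (prim .nil) (prim one)))

theorem eval_eqFn {c p : ℕ} (hp : p ≤ u ^ c) (q : ℕ) :
    (eqFn c).eval u (.cons (Data.ofNat p) (.cons (Data.ofNat q) .nil)) =
      Data.ofBool (decide (p = q)) := by
  have key := Fn.eval_fold_nat (u := u) (c := c)
    (F := cond (arg 1) (prim (.cons (.tail (arg 0)) (.cons (.tail (arg 1)) (rest 2))))
      (prim (.cons (.tail (arg 0)) (.cons .nil one))))
    (fun a : ℕ × Bool => .cons (Data.ofNat a.1) (Data.ofBool a.2))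
    (fun a => (a.1 - 1, if a.1 = 0 then true else a.2)) (fun _ _ => True)
    (fun _ _ _ => trivial) (fun a m d' _ => ?_) p hp (q, false) trivial
  · have hit : ∀ p : ℕ, (fun a : ℕ × Bool => (a.1 - 1, if a.1 = 0 then true else a.2))^[p]
        (q, false) = (q - p, decide (q < p)) := by
      intro p
      induction p with
      | zero => simp
      | succ p ih =>
        rw [Function.iterate_succ_apply', ih]
        ext
        · simp; omega
        · simp only
          split_ifs with h
          · simp; omega
          · simp; omega
    rw [hit] at key
    rw [eqFn, Fn.eval, show Data.nil = Data.ofBool false from rfl, key]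
    rcases lt_trichotomy p q with h | h | h
    · obtain ⟨m, hm⟩ : ∃ m, q - p = m + 1 := ⟨q - p - 1, by omega⟩
      simp [Fn.eval, Expr.eval, rest, arg, Data.head, Data.tail, hm, Data.ofNat_succ, h.ne,
        Data.isPair, h.not_gt, Data.ofBool]
    · simp [Fn.eval, Expr.eval, rest, arg, Data.head, Data.tail, h, Data.isPair, Data.ofBool, one,
        Data.ofNat_zero]
    · simp [Fn.eval, Expr.eval, rest, Data.tail, h, Data.isPair, Data.ofBool, h.ne']
  · rcases a with ⟨_ | q, b⟩ <;>
      simp [Fn.eval, Expr.eval, rest, arg, one, Data.head, Data.tail, Data.isPair, Data.ofBool,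
        Data.ofNat_succ, Data.ofNat_zero]

end Fn

/-! ### Points and tables of labelled points -/

section Fn
variable {u : ℕ}

open LocalQueries.Expr (arg rest one)
open LocalQueries.Fn (prim comp pair cond fold)

/-- The coordinatewise sum modulo two. -/
def bitXor {n : ℕ} (x y : Cube n) : Cube n := fun i => xor (x i) (y i)

theorem Data.tail_iterate_cons (i : ℕ) (d e : Data) :
    Data.tail^[i + 1] (.cons d e) = Data.tail^[i] e := rfl

theorem Data.toPoint_ofPoint {n : ℕ} (x : Cube n) : Data.toPoint n (Data.ofPoint x) = x := by
  have h : ∀ (l : List Bool) (i : ℕ) (hi : i < l.length),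
      (Data.tail^[i] (Data.ofList (l.map Data.ofBool))).head = Data.ofBool l[i] := by
    intro l
    induction l with
    | nil => intro i hi; simp at hi
    | cons b l ih =>
      intro i hi
      rcases i with _ | i
      · rfl
      · exact ih i (by simpa using hi)
  funext i
  have := h (List.ofFn x) i (by simp)
  simp only [List.map_ofFn, List.getElem_ofFn] at this
  rw [Data.toPoint, Data.ofPoint]
  change Data.isPair (Data.head (Data.tail^[(i : ℕ)]
    (Data.ofList (List.ofFn (Data.ofBool ∘ x))))) = _
  rw [this]
  cases x i <;> rfl

/-- Since `nil` is read as the zero vector, the sum of three points also serves for fewer summands.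
-/
theorem Data.toPoint_nil (n : ℕ) : Data.toPoint n .nil = fun _ => false := by
  funext i
  have : ∀ i : ℕ, Data.tail^[i] .nil = .nil := fun i => by
    induction i with
    | zero => rfl
    | succ i ih => exact ih
  rw [Data.toPoint, this]; rfl

theorem Data.toPoint_pad {n : ℕ} (i : ℕ) :
    Data.toPoint n (Data.pad i (.cons (.cons .nil .nil) .nil)) = fun j : Fin n => decide ((j : ℕ) = i) := by
  have h : ∀ i j : ℕ, (Data.tail^[j] (Data.pad i (.cons (.cons .nil .nil) .nil))).head.isPair =
      decide (j = i) := by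
    intro i
    induction i with
    | zero =>
      intro j
      rcases j with _ | j
      · rfl
      · have := congrArg (fun x : Cube (j + 1) => x (Fin.last j)) (Data.toPoint_nil (j + 1))
        have h2 : (Data.tail^[j] .nil).head.isPair = false := by simpa [Data.toPoint] using this
        simpa [Data.pad, Data.tail] using h2
    | succ i ih =>
      intro j
      rw [Data.pad_succ]
      rcases j with _ | j
      · simp [Data.head, Data.isPair]
      · rw [Data.tail_iterate_cons, ih]; simp
  funext j
  exact h i j

theorem Data.ofPoint_eq {n : ℕ} (x : Cube n) :
    Data.ofPoint x = Data.ofList ((List.ofFn x).map Data.ofBool) := by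
  rw [List.map_ofFn]; rfl

/-- Reversal of a list. -/
def revFn : Fn :=
  comp (prim (.cons (.var 0) .nil))
    (comp (fold 1 (prim (.cons (.tail (arg 0)) (.cons (.head (arg 0)) (rest 1))))) (prim (rest 1)))

theorem eval_revFn (l : List Data) (hl : l.length ≤ u) :
    revFn.eval u (Data.ofList l) = Data.ofList l.reverse := by
  have key := Fn.eval_fold (u := u) (c := 1)
    (F := prim (.cons (.tail (arg 0)) (.cons (.head (arg 0)) (rest 1)))) Data.ofList id
    (fun a b => b :: a) (fun _ _ => True) (fun _ _ _ _ => trivial) (fun _ _ _ _ _ => rfl) l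
    (by simpa using hl) [] trivial
  simp only [revFn, Fn.eval, Expr.eval]
  rw [List.map_id] at key
  rw [show Data.nil = Data.ofList [] from rfl, key]
  simp [rest, Expr.eval, Data.tail]

/-- The parity of three bits, passed to one of two functions. -/
def parityFn (e e' e'' : Expr) (F G : Fn) : Fn :=
  cond e (cond e' (cond e'' F G) (cond e'' G F)) (cond e' (cond e'' G F) (cond e'' F G))

theorem eval_parityFn (e e' e'' : Expr) (F G : Fn) (d : Data) :
    (parityFn e e' e'' F G).eval u d = if xor (xor (e.eval fun _ => d).isPair
      (e'.eval fun _ => d).isPair) (e''.eval fun _ => d).isPair then F.eval u d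
      else G.eval u d := by
  simp only [parityFn, Fn.eval]
  cases (e.eval fun _ => d).isPair <;> cases (e'.eval fun _ => d).isPair <;>
    cases (e''.eval fun _ => d).isPair <;> rfl

/-- `(n, (x, (y, z)))` is mapped to the sum of the points coded by `x`, `y` and `z`. -/
def xorFn : Fn :=
  comp (prim (.cons (arg 0) (.cons (arg 1) (.cons (arg 2) (.cons (rest 3) .nil))))) (comp
    (fold 1 (parityFn (.head (arg 1)) (.head (arg 2)) (.head (arg 3))
      (prim (.cons (.tail (arg 0)) (.cons (.tail (arg 1)) (.cons (.tail (arg 2))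
        (.cons (.tail (arg 3)) (.cons one (rest 4)))))))
      (prim (.cons (.tail (arg 0)) (.cons (.tail (arg 1)) (.cons (.tail (arg 2))
        (.cons (.tail (arg 3)) (.cons .nil (rest 4)))))))))
    (comp (prim (rest 4)) revFn))

/-- The arguments are arbitrary trees while the result is a canonical code. This matters for
queries, since the simulated learner may present a point in any encoding. -/
theorem eval_xorFn {n : ℕ} (hn : n ≤ u) (x y z : Data) :
    xorFn.eval u (.cons (Data.ofNat n) (.cons x (.cons y z))) =
      Data.ofPoint (bitXor (bitXor (Data.toPoint n x) (Data.toPoint n y)) (Data.toPoint n z)) := by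
  let bit : ℕ → Bool := fun i => xor (xor (Data.tail^[i] x).head.isPair
    (Data.tail^[i] y).head.isPair) (Data.tail^[i] z).head.isPair
  let g : Data × Data × Data × List Data → Data × Data × Data × List Data := fun a =>
    (a.1.tail, a.2.1.tail, a.2.2.1.tail,
      Data.ofBool (xor (xor a.1.head.isPair a.2.1.head.isPair) a.2.2.1.head.isPair) :: a.2.2.2)
  have hg : ∀ i, g^[i] (x, y, z, []) = (Data.tail^[i] x, Data.tail^[i] y, Data.tail^[i] z,
      ((List.range i).map fun i => Data.ofBool (bit i)).reverse) := by
    intro i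
    induction i with
    | zero => rfl
    | succ i ih =>
      rw [Function.iterate_succ_apply', ih]
      simp only [g, ← Function.iterate_succ_apply', List.range_succ, List.map_append,
        List.reverse_append]
      rfl
  have key := Fn.eval_fold_nat (u := u) (c := 1)
    (F := parityFn (.head (arg 1)) (.head (arg 2)) (.head (arg 3))
      (prim (.cons (.tail (arg 0)) (.cons (.tail (arg 1)) (.cons (.tail (arg 2))
        (.cons (.tail (arg 3)) (.cons one (rest 4)))))))
      (prim (.cons (.tail (arg 0)) (.cons (.tail (arg 1)) (.cons (.tail (arg 2))
        (.cons (.tail (arg 3)) (.cons .nil (rest 4))))))))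
    (fun a : Data × Data × Data × List Data =>
      .cons a.1 (.cons a.2.1 (.cons a.2.2.1 (Data.ofList a.2.2.2)))) g (fun _ _ => True)
    (fun _ _ _ => trivial) (fun a m d _ => ?_) n (by simpa using hn) (x, y, z, []) trivial
  · rw [hg] at key
    simp only [xorFn, Fn.eval, Expr.eval, arg, rest, Data.head, Data.tail] at key ⊢
    rw [show Data.nil = Data.ofList [] from rfl] at key ⊢
    rw [key]
    dsimp only
    rw [eval_revFn _ (by simpa using hn), List.reverse_reverse, Data.ofPoint]
    congr 1
    refine List.ext_getElem (by simp) fun i h1 h2 => ?_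
    simp [bit, bitXor, Data.toPoint]
  · rw [eval_parityFn]
    simp only [Fn.eval, Expr.eval, arg, rest, Data.head, Data.tail, g, one]
    split_ifs with h <;> simp [h, Data.ofBool, Data.ofList]

/-- The code of the test whether two points, coded as `(x, (y, nil))`, are different. -/
def neFn : Fn :=
  comp (fold 1 (cond (.head (arg 0))
      (cond (.head (arg 1)) (prim (.cons (.tail (arg 0)) (.cons (.tail (arg 1)) (rest 2))))
        (prim (.cons (.tail (arg 0)) (.cons (.tail (arg 1)) one))))
      (cond (.head (arg 1)) (prim (.cons (.tail (arg 0)) (.cons (.tail (arg 1)) one)))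
        (prim (.cons (.tail (arg 0)) (.cons (.tail (arg 1)) (rest 2)))))))
    (prim (rest 2))

theorem eval_neFn {n : ℕ} (hn : n ≤ u) (x y : Cube n) :
    neFn.eval u (.cons (Data.ofPoint x) (.cons (Data.ofPoint y) .nil)) =
      Data.ofBool (decide (x ≠ y)) := by
  let g : List Bool × Bool → Bool → List Bool × Bool := fun a b =>
    (a.1.tail, if b = a.1.headD false then a.2 else true)
  have hg : ∀ (l l' : List Bool) (b : Bool), l.length = l'.length →
      (l.foldl g (l', b)).2 = (b || decide (l ≠ l')) := by
    intro l
    induction l with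
    | nil =>
      intro l' b h
      obtain rfl : l' = [] := by simpa using h.symm
      simp
    | cons c l ih =>
      intro l' b h
      rcases l' with _ | ⟨c', l'⟩
      · simp at h
      · rw [List.foldl_cons, ih _ _ (by simpa using h)]
        by_cases hc : c = c' <;> by_cases hl : l = l' <;> simp [hc, hl]
  have key := Fn.eval_fold (u := u) (c := 1)
    (F := cond (.head (arg 0))
      (cond (.head (arg 1)) (prim (.cons (.tail (arg 0)) (.cons (.tail (arg 1)) (rest 2))))
        (prim (.cons (.tail (arg 0)) (.cons (.tail (arg 1)) one))))
      (cond (.head (arg 1)) (prim (.cons (.tail (arg 0)) (.cons (.tail (arg 1)) one)))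
        (prim (.cons (.tail (arg 0)) (.cons (.tail (arg 1)) (rest 2))))))
    (fun a : List Bool × Bool => .cons (Data.ofList (a.1.map Data.ofBool)) (Data.ofBool a.2))
    Data.ofBool g (fun _ _ => True) (fun _ _ _ _ => trivial) (fun a b l d _ => ?_) (List.ofFn x)
    (by simpa using hn) (List.ofFn y, false) trivial
  · rw [neFn, Fn.eval, Data.ofPoint_eq, Data.ofPoint_eq,
      show Data.nil = Data.ofBool false from rfl, key]
    simp only [Fn.eval, Expr.eval, rest, Data.tail]
    rw [hg _ _ _ (by simp)]
    simp
  · rcases a with ⟨_ | ⟨c, l'⟩, b'⟩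
    · cases b <;> simp [Fn.eval, Expr.eval, arg, rest, one, g, Data.head, Data.tail, Data.ofBool,
        Data.isPair, Data.ofList]
    · cases b <;> cases c <;> simp [Fn.eval, Expr.eval, arg, rest, one, g, Data.head, Data.tail,
        Data.ofBool, Data.isPair, Data.ofList]

/-- The label of a point in a list of labeled points. -/
def lookupLabel {n : ℕ} (x : Cube n) : List (Cube n × Bool) → Option Bool
  | [] => none
  | e :: l => if x = e.1 then some e.2 else lookupLabel x l

/-- The code of a labeled point. -/
def Data.ofExample {n : ℕ} (e : Cube n × Bool) : Data :=
  .cons (Data.ofPoint e.1) (Data.ofBool e.2)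

/-- The code of a list of labeled points. -/
def Data.ofTable {n : ℕ} (l : List (Cube n × Bool)) : Data := Data.ofList (l.map Data.ofExample)

/-- The code of an optional bit. -/
def Data.ofLabel : Option Bool → Data
  | none => .nil
  | some b => .cons (Data.ofBool b) .nil

/-- A table and a point, `(l, x)`, are mapped to the label of `x` in `l`. -/
def lookupFn (c : ℕ) : Fn :=
  comp (prim (.cons (arg 0) (.cons .nil (rest 1)))) (comp
    (fold c (cond (arg 1) (prim (.cons (.tail (arg 0)) (rest 1)))
      (comp (pair (comp (prim (.cons (rest 2) (.cons (.head (.head (arg 0))) .nil))) neFn)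
          (prim (.var 0)))
        (cond (arg 0) (prim (.cons (.tail (arg 1)) (rest 2)))
          (prim (.cons (.tail (arg 1)) (.cons (.cons (.tail (.head (arg 1))) .nil)
            (rest 3))))))))
    (prim (arg 1)))

theorem eval_lookupFn {n c : ℕ} (hn : n ≤ u) (l : List (Cube n × Bool)) (hl : l.length ≤ u ^ c)
    (x : Cube n) : (lookupFn c).eval u (.cons (Data.ofTable l) (Data.ofPoint x)) =
      Data.ofLabel (lookupLabel x l) := by
  let g : Option Bool → Cube n × Bool → Option Bool := fun a e =>
    if a.isSome then a else if x = e.1 then some e.2 else none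
  have hg : ∀ (l : List (Cube n × Bool)) (a : Option Bool),
      l.foldl g a = if a.isSome then a else lookupLabel x l := by
    intro l
    induction l with
    | nil => intro a; cases a <;> rfl
    | cons e l ih =>
      intro a
      rw [List.foldl_cons, ih, lookupLabel]
      cases a <;> by_cases h : x = e.1 <;> simp [g, h]
  have key := Fn.eval_fold (u := u) (c := c)
    (F := cond (arg 1) (prim (.cons (.tail (arg 0)) (rest 1)))
      (comp (pair (comp (prim (.cons (rest 2) (.cons (.head (.head (arg 0))) .nil))) neFn)
          (prim (.var 0)))
        (cond (arg 0) (prim (.cons (.tail (arg 1)) (rest 2)))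
          (prim (.cons (.tail (arg 1)) (.cons (.cons (.tail (.head (arg 1))) .nil)
            (rest 3)))))))
    (fun a : Option Bool => .cons (Data.ofLabel a) (Data.ofPoint x))
    Data.ofExample g (fun _ _ => True) (fun _ _ _ _ => trivial) (fun a e l d _ => ?_) l
    hl none trivial
  · rw [hg] at key
    simp only [lookupFn, Fn.eval, Expr.eval]
    rw [Data.ofTable]
    simp only [arg, rest, Expr.eval, Data.head, Data.tail] at key ⊢
    rw [show Data.nil = Data.ofLabel none from rfl] at key ⊢
    rw [key]
    simp
  · rcases a with _ | b
    · have := eval_neFn hn x e.1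
      have := eval_neFn hn e.1 e.1
      by_cases h : x = e.1 <;>
        simp [Fn.eval, Expr.eval, arg, rest, g, Data.head, Data.tail, Data.ofLabel, Data.isPair,
          Data.ofExample, *, Data.ofBool]
    · simp [Fn.eval, Expr.eval, arg, rest, g, Data.head, Data.tail, Data.ofLabel, Data.isPair]

/-- `(p, d)` is mapped to the tail of order `p` of `d`. -/
def dropFn (c : ℕ) : Fn :=
  comp (fold c (prim (.cons (.tail (arg 0)) (.tail (rest 1))))) (prim (rest 1))

theorem eval_dropFn {c p : ℕ} (hp : p ≤ u ^ c) (d : Data) :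
    (dropFn c).eval u (.cons (Data.ofNat p) d) = Data.tail^[p] d := by
  have := Fn.eval_fold_nat (u := u) (c := c)
    (F := prim (.cons (.tail (arg 0)) (.tail (rest 1)))) id Data.tail (fun _ _ => True)
    (fun _ _ _ => trivial) (fun _ _ _ _ => rfl) p hp d trivial
  rw [dropFn, Fn.eval]
  simp only [id] at this
  rw [this]; rfl

end Fn

/-! ### Colours of points, and the search for a neighbour in a colour class -/

/-- The colour of a point. -/
def color (u e d : ℕ) {n : ℕ} (x : Cube n) : ℕ := weightSum (u ^ e) d 0 (List.ofFn x)

/-- All numbers that occur in the computation of colours are at most `u ^ c`. -/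
structure ColorBound (u c e d n : ℕ) : Prop where
  dim_le : n ≤ u
  mul_le : ∀ i ≤ n, i * u ^ e ≤ u ^ c
  geom_le : ∀ i ≤ n, geom (i * u ^ e) d ≤ u ^ c
  color_lt : ∀ x : Cube n, color u e d x < u ^ c

/-- The point `x` with coordinate number `i` changed. -/
def flipAt {n : ℕ} (x : Cube n) (i : ℕ) : Cube n := bitXor x fun j => decide ((j : ℕ) = i)

/-- A point of the set `A` at distance at most `k` from a point, if there is one. -/
def nearest {n : ℕ} (A : Cube n → Bool) : ℕ → Cube n → Option (Cube n)
  | 0, x => if A x then some x else none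
  | k + 1, x => (List.range n).foldl
      (fun r i => if r.isSome then r else nearest A k (flipAt x i)) (nearest A k x)

/-- The code of an optional point. -/
def Data.ofNearest {n : ℕ} : Option (Cube n) → Data
  | none => .nil
  | some y => .cons (Data.ofPoint y) .nil

section Fn
variable {u c e d n : ℕ}

open LocalQueries.Expr (arg rest one)
open LocalQueries.Fn (prim comp pair cond fold)

theorem eval_colorFn_ofPoint (h : ColorBound u c e d n) (x : Cube n) :
    (colorFn c e d).eval u (Data.ofPoint x) = Data.ofNat (color u e d x) := by
  rw [Data.ofPoint_eq, eval_colorFn _ (by simpa using h.dim_le)]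
  · rfl
  · intro i hi
    have hi' : i ≤ n := by simpa using hi
    exact ⟨h.mul_le i hi', h.geom_le i hi'⟩

/-- `(x, (n, a))` is mapped to the code of the test whether `x` has colour `a`. -/
def testFn (c e d : ℕ) : Fn :=
  comp (pair (comp (prim (arg 0)) (colorFn c e d)) (prim (.cons (rest 2) .nil))) (eqFn c)

theorem eval_testFn (h : ColorBound u c e d n) (x : Cube n) (a : ℕ) (m : Data) :
    (testFn c e d).eval u (.cons (Data.ofPoint x) (.cons m (Data.ofNat a))) =
      Data.ofBool (decide (color u e d x = a)) := by
  simp only [testFn, Fn.eval, Expr.eval, arg, rest, Data.head, Data.tail,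
    eval_colorFn_ofPoint h, eval_eqFn (h.color_lt x).le]

/-- `(x, (n, a))` is mapped to a point of colour `a` near `x`, if there is one. -/
def nearFn (c e d : ℕ) : ℕ → Fn
  | 0 => comp (pair (testFn c e d) (prim (.var 0)))
      (cond (arg 0) (prim (.cons (arg 1) .nil)) (prim .nil))
  | k + 1 =>
    comp (pair (prim (arg 1)) (pair (prim .nil) (pair (nearFn c e d k) (prim (.var 0))))) (comp
      (fold 1 (pair (prim (.tail (arg 0))) (pair (prim (.cons .nil (arg 1)))
        (pair (cond (arg 2) (prim (arg 2))
          (comp (pair (comp (pair (prim (arg 4)) (pair (prim (arg 3))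
              (pair (comp (prim (.cons (arg 1) (.cons one .nil)))
                (comp (addFn 1) (prim (rest 1)))) (prim .nil)))) xorFn) (prim (rest 4)))
            (nearFn c e d k))) (prim (rest 3))))))
      (prim (arg 2)))

/-- The recursion on `k` is unfolded when the term is built, giving loops nested to depth `k`. This
is polynomial because `k` is constant. -/
theorem eval_nearFn (h : ColorBound u c e d n) (a k : ℕ) (x : Cube n) :
    (nearFn c e d k).eval u (.cons (Data.ofPoint x) (.cons (Data.ofNat n) (Data.ofNat a))) =
      Data.ofNearest (nearest (fun y => decide (color u e d y = a)) k x) := by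
  induction k generalizing x with
  | zero =>
    have := eval_testFn h x a (Data.ofNat n)
    by_cases hx : color u e d x = a <;>
      simp [nearFn, Fn.eval, Expr.eval, arg, rest, Data.head, Data.tail, this, hx, Data.ofBool,
        Data.isPair, nearest, Data.ofNearest]
  | succ k ih =>
    let A : Cube n → Bool := fun y => decide (color u e d y = a)
    let g : ℕ × Option (Cube n) → ℕ × Option (Cube n) := fun r =>
      (r.1 + 1, if r.2.isSome then r.2 else nearest A k (flipAt x r.1))
    have hg : ∀ (m : ℕ) (r : Option (Cube n)), g^[m] (0, r) = (m, (List.range m).foldl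
        (fun r i => if r.isSome then r else nearest A k (flipAt x i)) r) := by
      intro m r
      induction m with
      | zero => rfl
      | succ m ihm => rw [Function.iterate_succ_apply', ihm, List.range_succ, List.foldl_append]; rfl
    have key := Fn.eval_fold_nat (u := u) (c := 1)
      (F := pair (prim (.tail (arg 0))) (pair (prim (.cons .nil (arg 1)))
        (pair (cond (arg 2) (prim (arg 2))
          (comp (pair (comp (pair (prim (arg 4)) (pair (prim (arg 3))
              (pair (comp (prim (.cons (arg 1) (.cons one .nil)))
                (comp (addFn 1) (prim (rest 1)))) (prim .nil)))) xorFn) (prim (rest 4)))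
            (nearFn c e d k))) (prim (rest 3)))))
      (fun r : ℕ × Option (Cube n) => .cons (Data.ofNat r.1) (.cons (Data.ofNearest r.2)
        (.cons (Data.ofPoint x) (.cons (Data.ofNat n) (Data.ofNat a)))))
      g (fun m r => r.1 + m ≤ n) (fun r m hr => by simp only [g]; omega)
      (fun r m b hr => ?_) n (by simpa using h.dim_le) (0, nearest A k x) (by simp)
    · rw [hg] at key
      simp only [nearFn, Fn.eval, Expr.eval]
      simp only [arg, rest, Expr.eval, Data.head, Data.tail, ih, Data.ofNat_zero] at key ⊢
      rw [key]
      rfl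
    · have hr1 : r.1 ≤ u ^ 1 := by have := h.dim_le; rw [pow_one]; omega
      rcases r with ⟨i, _ | y⟩
      · have hx := eval_xorFn h.dim_le (Data.ofPoint x) (Data.pad i (.cons (.cons .nil .nil) .nil))
          .nil
        rw [Data.toPoint_ofPoint, Data.toPoint_pad, Data.toPoint_nil] at hx
        have hz : bitXor (bitXor x fun j : Fin n => decide ((j : ℕ) = i)) (fun _ => false) =
            flipAt x i := by
          funext j; simp [bitXor, flipAt]
        rw [hz] at hx
        simp [Fn.eval, Expr.eval, arg, rest, one, Data.head, Data.tail, Data.ofNearest,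
          Data.isPair, eval_addFn hr1, hx, ih, g, Data.ofNat_succ, A]
      · simp [Fn.eval, Expr.eval, arg, rest, Data.head, Data.tail, Data.ofNearest,
          Data.isPair, g, Data.ofNat_succ]

end Fn

/-! ### Hamming balls -/

section Hamming
variable {n : ℕ}

theorem bitXor_comm (x y : Cube n) : bitXor x y = bitXor y x := by
  funext i; simp [bitXor, Bool.xor_comm]

theorem bitXor_bitXor_cancel (x y : Cube n) : bitXor (bitXor x y) y = x := by
  funext i; simp [bitXor]

theorem bitXor_cancel_left (x y : Cube n) : bitXor x (bitXor x y) = y := by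
  funext i; simp [bitXor]

/-- Addition of a fixed point as a permutation of the cube. -/
def xorEquiv (e : Cube n) : Cube n ≃ Cube n where
  toFun x := bitXor x e
  invFun x := bitXor x e
  left_inv x := bitXor_bitXor_cancel x e
  right_inv x := bitXor_bitXor_cancel x e

theorem hammingDist_bitXor (x y e : Cube n) :
    hammingDist (bitXor x e) (bitXor y e) = hammingDist x y := by
  simp only [hammingDist, bitXor]
  congr 1; ext i
  simp

theorem hammingDist_bitXor_left (x e : Cube n) :
    hammingDist x (bitXor x e) = hammingDist e fun _ => false := by
  have h := hammingDist_bitXor (fun _ => false) e x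
  rw [bitXor_comm e x, hammingDist_comm _ e] at h
  rw [← h]
  congr 1
  funext i; simp [bitXor]

theorem hammingDist_flipAt_le (x : Cube n) (i : ℕ) : hammingDist x (flipAt x i) ≤ 1 := by
  rw [flipAt, hammingDist_bitXor_left, hammingDist]
  refine Finset.card_le_one.mpr fun a ha b hb => Fin.ext ?_
  simp at ha hb
  omega

theorem exists_flipAt_closer {k : ℕ} {x y : Cube n} (h : hammingDist x y ≤ k + 1)
    (h0 : ¬hammingDist x y ≤ k) : ∃ i : Fin n, hammingDist (flipAt x i) y ≤ k := by
  have hne : x ≠ y := by rintro rfl; simp at h0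
  obtain ⟨i, hi⟩ := Function.ne_iff.mp hne
  refine ⟨i, Nat.le_of_lt_succ (lt_of_lt_of_le (Finset.card_lt_card ?_) h)⟩
  have hfi : flipAt x i i = y i := by
    have : ∀ a b : Bool, a ≠ b → xor a true = b := by decide
    simpa [flipAt, bitXor] using this _ _ hi
  rw [Finset.ssubset_iff_of_subset]
  · exact ⟨i, by simpa using hi, by simpa using hfi⟩
  · intro j hj
    rcases eq_or_ne j i with rfl | hji
    · simp [hfi] at hj
    · have : (j : ℕ) ≠ i := fun h => hji (Fin.ext h)
      simp only [Finset.mem_filter, Finset.mem_univ, true_and] at hj ⊢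
      simpa [flipAt, bitXor, this] using hj

theorem foldl_orElse_eq_some {α β : Type*} (F : α → Option β) (l : List α) (r : Option β) (y : β)
    (h : l.foldl (fun r i => if r.isSome then r else F i) r = some y) :
    r = some y ∨ ∃ i ∈ l, F i = some y := by
  induction l generalizing r with
  | nil => exact Or.inl h
  | cons a l ih =>
    rcases ih _ h with h1 | ⟨i, hi, h1⟩
    · dsimp only at h1
      split_ifs at h1 with hr
      · exact Or.inl h1
      · exact Or.inr ⟨a, by simp, h1⟩
    · exact Or.inr ⟨i, by simp [hi], h1⟩

theorem foldl_orElse_isSome {α β : Type*} (F : α → Option β) (l : List α) (r : Option β)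
    (h : r.isSome ∨ ∃ i ∈ l, (F i).isSome) :
    (l.foldl (fun r i => if r.isSome then r else F i) r).isSome := by
  induction l generalizing r with
  | nil => simpa using h
  | cons a l ih =>
    refine ih _ ?_
    by_cases hr : r.isSome
    · simp [hr]
    · rcases h with h | ⟨i, hi, h⟩
      · exact absurd h hr
      · rcases List.mem_cons.mp hi with rfl | hi
        · left; simpa [hr] using h
        · exact Or.inr ⟨i, hi, h⟩

theorem nearest_eq_some {A : Cube n → Bool} {k : ℕ} {x y : Cube n}
    (h : nearest A k x = some y) : A y ∧ hammingDist x y ≤ k := by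
  induction k generalizing x with
  | zero =>
    simp only [nearest] at h
    split_ifs at h with hx
    obtain rfl : x = y := by simpa using h
    exact ⟨hx, by simp⟩
  | succ k ih =>
    rcases foldl_orElse_eq_some _ _ _ _ h with h1 | ⟨i, -, h1⟩
    · exact ⟨(ih h1).1, (ih h1).2.trans (Nat.le_succ k)⟩
    · refine ⟨(ih h1).1, (hammingDist_triangle x (flipAt x i) y).trans ?_⟩
      have := (ih h1).2
      have := hammingDist_flipAt_le x i
      omega

theorem nearest_isSome {A : Cube n → Bool} {k : ℕ} {x y : Cube n} (hy : A y)
    (h : hammingDist x y ≤ k) : (nearest A k x).isSome := by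
  induction k generalizing x with
  | zero =>
    obtain rfl : x = y := by simpa using h
    simp [nearest, hy]
  | succ k ih =>
    refine foldl_orElse_isSome _ _ _ ?_
    by_cases h0 : hammingDist x y ≤ k
    · exact Or.inl (ih h0)
    · obtain ⟨i, hi⟩ := exists_flipAt_closer h h0
      exact Or.inr ⟨i, by simp, ih hi⟩

/-- The ball of radius `k` around the origin. -/
def ball (n k : ℕ) : Finset (Cube n) :=
  Finset.univ.filter fun e => hammingDist e (fun _ => false) ≤ k

/-- A point of the larger ball is in the smaller one or one flip away from it, which accounts for a
factor `n + 1`. -/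
theorem card_ball_le (n k : ℕ) : (ball n k).card ≤ (n + 1) ^ k := by
  induction k with
  | zero =>
    refine Finset.card_le_one.mpr fun a ha b hb => ?_
    simp only [ball, Finset.mem_filter, Finset.mem_univ, true_and, Nat.le_zero,
      hammingDist_eq_zero] at ha hb
    rw [ha, hb]
  | succ k ih =>
    have hsub : ball n (k + 1) ⊆ ball n k ∪
        Finset.univ.biUnion fun i : Fin n => (ball n k).image fun e => flipAt e i := by
      intro e he
      by_cases h0 : hammingDist e (fun _ => false) ≤ k
      · exact Finset.mem_union_left _ (by simpa [ball] using h0)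
      · obtain ⟨i, hi⟩ := exists_flipAt_closer (by simpa [ball] using he) h0
        refine Finset.mem_union_right _ (Finset.mem_biUnion.mpr ⟨i, Finset.mem_univ _,
          Finset.mem_image.mpr ⟨flipAt e i, by simpa [ball] using hi, ?_⟩⟩)
        exact bitXor_bitXor_cancel _ _
    calc (ball n (k + 1)).card ≤ _ := Finset.card_le_card hsub
      _ ≤ (ball n k).card + n * (ball n k).card := by
        refine (Finset.card_union_le _ _).trans (Nat.add_le_add_left ?_ _)
        refine Finset.card_biUnion_le.trans ?_
        refine (Finset.sum_le_card_nsmul _ _ (ball n k).card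
          fun i _ => Finset.card_image_le).trans ?_
        simp
      _ = (n + 1) * (ball n k).card := by ring
      _ ≤ (n + 1) ^ (k + 1) := by rw [pow_succ']; exact Nat.mul_le_mul_left _ ih

end Hamming

/-! ### Points of the same colour are far apart -/

/-- The lowest digit is a multiple of `Q` and smaller than `Q` in absolute value, so it vanishes;
divide by `Q` and repeat. Signs of the digits play no role. -/
theorem digits_eq_zero {Q : ℤ} {d : ℕ} {p : ℕ → ℤ} (hp : ∀ j < d, |p j| < Q)
    (h : ∑ j ∈ Finset.range d, Q ^ j * p j = 0) : ∀ j < d, p j = 0 := by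
  induction d generalizing p with
  | zero => intro j hj; omega
  | succ d ih =>
    have hQ : 0 < Q := (abs_nonneg _).trans_lt (hp 0 (Nat.succ_pos d))
    rw [Finset.sum_range_succ'] at h
    have hs : ∑ j ∈ Finset.range d, Q ^ (j + 1) * p (j + 1) =
        Q * ∑ j ∈ Finset.range d, Q ^ j * p (j + 1) := by
      rw [Finset.mul_sum]; exact Finset.sum_congr rfl fun j _ => by ring
    rw [hs] at h
    have h0 : p 0 = 0 := by
      refine Int.eq_zero_of_abs_lt_dvd (m := Q) ⟨-∑ j ∈ Finset.range d, Q ^ j * p (j + 1), ?_⟩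
        (hp 0 (Nat.succ_pos d))
      simp at h; linarith
    have hr := ih (p := fun j => p (j + 1)) (fun j hj => hp _ (by omega)) (by
      rw [h0] at h
      simpa [hQ.ne'] using h)
    rintro (_ | j) hj
    · exact h0
    · exact hr j (by omega)

theorem geom_eq_sum (b d : ℕ) : geom b d = ∑ j ∈ Finset.range d, b ^ j := by
  induction d with
  | zero => rfl
  | succ d ih =>
    rw [geom, ih, Finset.sum_range_succ', Finset.sum_mul]
    simp [pow_succ, add_comm]

theorem weightSum_eq (q d : ℕ) {n : ℕ} (x : Cube n) (i : ℕ) : weightSum q d i (List.ofFn x) =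
    ∑ j : Fin n, if x j then geom ((i + j + 1) * q) d else 0 := by
  induction n generalizing i with
  | zero => simp [weightSum]
  | succ n ih =>
    rw [List.ofFn_succ, weightSum, ih, Fin.sum_univ_succ]
    simp [add_comm, add_left_comm]

theorem color_eq (u e d : ℕ) {n : ℕ} (x : Cube n) :
    color u e d x = ∑ j : Fin n, if x j then geom ((j + 1) * u ^ e) d else 0 := by
  simp [color, weightSum_eq]

/-- The colour is a sum over `j < d` of `Q ^ j` times the power sum of the numbers `(i + 1) ^ j`
over the true coordinates, with `Q = u ^ (d + 1)`. Differences of these power sums are smaller than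
`Q`, so equal colours force all `d` of them to agree. At most `d` coordinates differ, and a
Vandermonde system shows that none does. -/
theorem color_injective {u d n : ℕ} (hn : n < u) {x y : Cube n}
    (hc : color u (d + 1) d x = color u (d + 1) d y) (hd : hammingDist x y ≤ d) : x = y := by
  set s : Fin n → ℤ := fun i => (if x i then 1 else 0) - (if y i then 1 else 0) with hs
  have hs1 : ∀ i, |s i| ≤ 1 := fun i => by
    simp only [hs]; cases x i <;> cases y i <;> simp
  set Q : ℤ := (u : ℤ) ^ (d + 1) with hQ
  set p : ℕ → ℤ := fun j => ∑ i, s i * ((i : ℤ) + 1) ^ j with hp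
  have hsum : ∑ j ∈ Finset.range d, Q ^ j * p j = 0 := by
    have h1 : ∑ i, s i * (geom ((i + 1) * u ^ (d + 1)) d : ℤ) = 0 := by
      have := congrArg (Nat.cast : ℕ → ℤ) hc
      rw [color_eq, color_eq, ← sub_eq_zero, Nat.cast_sum, Nat.cast_sum,
        ← Finset.sum_sub_distrib] at this
      rw [← this]
      refine Finset.sum_congr rfl fun i _ => ?_
      simp only [hs]; cases x i <;> cases y i <;> simp
    rw [← h1]
    simp only [hp, Finset.mul_sum, geom_eq_sum, Nat.cast_sum]
    rw [Finset.sum_comm]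
    refine Finset.sum_congr rfl fun i _ => Finset.sum_congr rfl fun j _ => ?_
    push_cast
    rw [mul_pow]; ring
  have hbound : ∀ j < d, |p j| < Q := by
    intro j hj
    calc |p j| ≤ ∑ i : Fin n, |s i * ((i : ℤ) + 1) ^ j| := Finset.abs_sum_le_sum_abs _ _
      _ ≤ ∑ i : Fin n, (u : ℤ) ^ j := by
        refine Finset.sum_le_sum fun i _ => ?_
        have h0 : (0 : ℤ) ≤ ((i : ℤ) + 1) ^ j := by positivity
        have h1 : ((i : ℤ) + 1) ^ j ≤ (u : ℤ) ^ j := by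
          gcongr
          have := i.2
          omega
        rw [abs_mul, abs_of_nonneg h0]
        nlinarith [hs1 i, abs_nonneg (s i)]
      _ = n * (u : ℤ) ^ j := by simp
      _ < u * (u : ℤ) ^ j := by
        have : (0 : ℤ) < (u : ℤ) ^ j := by
          have : (0 : ℤ) < u := by omega
          positivity
        have : (n : ℤ) < u := by exact_mod_cast hn
        nlinarith
      _ = (u : ℤ) ^ (j + 1) := by ring
      _ ≤ Q := by
        rw [hQ]
        exact pow_le_pow_right₀ (by omega) (by omega)
  have hp0 := digits_eq_zero hbound hsum
  -- Only the coordinates in `D` are unknowns. The nodes `i + 1` are distinct, and the first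
  -- `D.card` of the `d` equations already form a square system.
  let D : Finset (Fin n) := Finset.univ.filter fun i => x i ≠ y i
  have hD : D.card ≤ d := hd
  have hsD : ∀ i, i ∉ D → s i = 0 := by
    intro i hi
    have : x i = y i := by simpa [D] using hi
    simp [hs, this]
  let ι := D.orderEmbOfFin rfl
  have hv := Matrix.eq_zero_of_forall_pow_sum_mul_pow_eq_zero
    (f := fun j : Fin D.card => ((ι j : ℕ) : ℤ) + 1) (v := fun j => s (ι j))
    (fun a b hab => ι.injective (Fin.ext (by simpa using hab))) (fun j => by
      rw [← hp0 j (j.2.trans_le hD)]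
      simp only [hp]
      rw [← Finset.sum_subset (Finset.subset_univ D)
        (fun i _ hi => by rw [hsD i hi, zero_mul])]
      have := Finset.sum_map Finset.univ ι.toEmbedding
        fun i : Fin n => s i * ((i : ℤ) + 1) ^ (j : ℕ)
      rw [Finset.map_orderEmbOfFin_univ] at this
      exact this.symm)
  funext i
  by_contra hi
  have hiD : i ∈ D := by simpa [D] using hi
  rw [← Finset.map_orderEmbOfFin_univ D rfl, Finset.mem_map] at hiD
  obtain ⟨j, -, hj⟩ := hiD
  have h0 : s i = 0 := by rw [← hj]; exact congrFun hv j
  simp only [hs] at h0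
  revert h0 hi
  cases x i <;> cases y i <;> simp

theorem geom_le_pow {b B : ℕ} (h : b + 1 ≤ B) (d : ℕ) : geom b d ≤ B ^ d := by
  induction d with
  | zero => simp [geom]
  | succ d ih =>
    have h1 : 1 ≤ B ^ d := Nat.one_le_pow _ _ (by omega)
    rw [geom, pow_succ]
    nlinarith

/-- Each weight is at most `(u ^ (d + 3)) ^ d`. Summing `n ≤ u` weights adds one to the exponent,
and strictness of the bound on colours adds another. -/
theorem colorBound {u n : ℕ} (hu : 2 ≤ u) (hn : n ≤ u) (d : ℕ) :
    ColorBound u ((d + 3) * d + 2) (d + 1) d n := by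
  have hg : ∀ i ≤ n, geom (i * u ^ (d + 1)) d ≤ u ^ ((d + 3) * d) := by
    intro i hi
    rw [pow_mul]
    refine geom_le_pow ?_ d
    have h1 : i * u ^ (d + 1) ≤ u ^ (d + 2) := by
      rw [pow_succ' u (d + 1)]; exact Nat.mul_le_mul_right _ (hi.trans hn)
    have h2 : 1 ≤ u ^ (d + 2) := Nat.one_le_pow _ _ (by omega)
    rw [pow_succ u (d + 2)]
    nlinarith
  refine ⟨hn, fun i hi => ?_, fun i hi => (hg i hi).trans ?_, fun x => ?_⟩
  · calc i * u ^ (d + 1) ≤ u * u ^ (d + 1) := Nat.mul_le_mul_right _ (hi.trans hn)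
      _ = u ^ (d + 2) := by ring
      _ ≤ _ := Nat.pow_le_pow_right (by omega) (by nlinarith)
  · exact Nat.pow_le_pow_right (by omega) (by omega)
  · rw [color_eq]
    calc _ ≤ ∑ j : Fin n, u ^ ((d + 3) * d) := by
          refine Finset.sum_le_sum fun j _ => ?_
          split_ifs
          · exact hg _ (by omega)
          · exact Nat.zero_le _
      _ = n * u ^ ((d + 3) * d) := by simp
      _ ≤ u * u ^ ((d + 3) * d) := Nat.mul_le_mul_right _ hn
      _ = u ^ ((d + 3) * d + 1) := by ring
      _ < _ := Nat.pow_lt_pow_right (by omega) (by omega)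

/-! ### Sampling a uniform point together with the label of a nearby point of a sparse set -/

/-- No two points of `A` lie in a common ball of radius `k`. -/
def Sparse {n : ℕ} (A : Cube n → Bool) (k : ℕ) : Prop :=
  ∀ x y z, A y → A z → hammingDist x y ≤ k → hammingDist x z ≤ k → y = z

/-- The expectation of `κ` at the first point of `A` in a sequence of `R` uniform points. -/
noncomputable def pick {n : ℕ} (A : Cube n → Bool) (κ : Option (Cube n) → ℝ) : ℕ → ℝ
  | 0 => κ none
  | R + 1 => avg fun w => if A w then κ (some w) else pick A κ R

section pick
variable {n : ℕ} {A : Cube n → Bool}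

theorem pick_mono {κ κ' : Option (Cube n) → ℝ} (h0 : κ none ≤ κ' none)
    (h : ∀ z, A z → κ (some z) ≤ κ' (some z)) (R : ℕ) : pick A κ R ≤ pick A κ' R := by
  induction R with
  | zero => exact h0
  | succ R ih =>
    refine avg_mono fun w => ?_
    split_ifs with hw
    · exact h w hw
    · exact ih

theorem pick_mul_left (v : ℝ) (κ : Option (Cube n) → ℝ) (R : ℕ) :
    pick A (fun o => v * κ o) R = v * pick A κ R := by
  induction R with
  | zero => rfl
  | succ R ih => simp only [pick, ih, ← avg_mul_left, mul_ite]

theorem le_pick {κ : Option (Cube n) → ℝ} {v : ℝ} (h0 : v ≤ κ none)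
    (h : ∀ z, A z → v ≤ κ (some z)) (R : ℕ) : v ≤ pick A κ R := by
  induction R with
  | zero => exact h0
  | succ R ih =>
    refine le_avg fun w => ?_
    split_ifs with hw
    · exact h w hw
    · exact ih

/-- The fraction of points in `A`. -/
noncomputable def density (A : Cube n → Bool) : ℝ := avg fun w => if A w then 1 else 0

/-- Bernoulli gives `1 + R * p ≤ (1 + p) ^ R`, and `(1 - p) ^ R * (1 + p) ^ R ≤ 1`. A bound uniform
in `p` is what allows classes of any density: a rare class is hard to hit, but also rarely needed.
It serves again for the chance of missing a point in the table. -/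
theorem mul_one_sub_pow_le {p : ℝ} (h0 : 0 ≤ p) (h1 : p ≤ 1) (R : ℕ) :
    p * (1 - p) ^ R ≤ 1 / (R + 1) := by
  have hb : 1 + (R : ℝ) * p ≤ (1 + p) ^ R := one_add_mul_le_pow (by linarith) R
  have hq : (0 : ℝ) ≤ (1 - p) ^ R := pow_nonneg (by linarith) R
  have hs : (1 - p) ^ R * (1 + p) ^ R ≤ 1 := by
    rw [← mul_pow]
    exact pow_le_one₀ (by nlinarith) (by nlinarith)
  have hm : (1 - p) ^ R * (1 + R * p) ≤ 1 := (mul_le_mul_of_nonneg_left hb hq).trans hs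
  rw [le_div_iff₀ (by positivity)]
  have hR : (0 : ℝ) ≤ R := Nat.cast_nonneg R
  calc p * (1 - p) ^ R * (R + 1) = (1 - p) ^ R * (p * R + p) := by ring
    _ ≤ (1 - p) ^ R * (1 + R * p) := by
      refine mul_le_mul_of_nonneg_left ?_ hq
      linarith
    _ ≤ 1 := hm

/-- Conditioning on the first draw gives the recursion `q (R + 1) = α + (1 - p) * q R`, where `α` is
the average of `F` restricted to `A`. Hence `p * q R` falls short of `α` by at most `p * (1 - p) ^
R`. Payoffs need an upper bound only, since an unsuccessful search pays zero. -/
theorem density_mul_pick_ge {F : Cube n → ℝ} (hF : ∀ x, F x ≤ 1) (R : ℕ) :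
    avg (fun w => if A w then F w else 0) - 1 / (R + 1) ≤
      density A * pick A (fun o => o.elim 0 F) R := by
  set p := density A
  set α := avg (fun w => if A w then F w else 0)
  have hp0 : 0 ≤ p := avg_nonneg fun w => by split_ifs <;> norm_num
  have hp1 : p ≤ 1 := avg_le fun w => by split_ifs <;> norm_num
  have hα : α ≤ p := avg_mono fun w => by
    split_ifs
    · exact hF w
    · exact le_rfl
  have hrec : ∀ R, pick A (fun o => o.elim 0 F) (R + 1) =
      α + (1 - p) * pick A (fun o => o.elim 0 F) R := by
    intro R
    set q := pick A (fun o => o.elim 0 F) R with hq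
    have : (1 - p) * q = avg fun w => q - q * (if A w then 1 else 0) := by
      rw [avg_sub, avg_mul_left, avg_const]
      change (1 - p) * q = q - q * p
      ring
    rw [this, ← avg_add, pick, ← hq]
    congr 1; funext w
    split_ifs <;> simp
  have hind : ∀ R : ℕ, α - p * (1 - p) ^ R ≤ p * pick A (fun o => o.elim 0 F) R := by
    intro R
    induction R with
    | zero => simp [pick, hα]
    | succ R ih =>
      rw [hrec, pow_succ]
      have := mul_le_mul_of_nonneg_left ih (sub_nonneg.mpr hp1)
      nlinarith
  have := hind R
  have := mul_one_sub_pow_le hp0 hp1 R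
  linarith

/-- Sparsity makes the neighbour of `x` in `A` unique, so at most one offset `e` in the ball
contributes. The average over `x` can thus be split by offsets. -/
theorem nearest_elim_eq {k : ℕ} (hA : Sparse A k) (x : Cube n) (a : ℝ) (G : Cube n → ℝ) :
    (nearest A k x).elim a (fun y => G (bitXor x y)) = (nearest A k x).elim a (fun _ => 0) +
      ∑ e ∈ ball n k, if A (bitXor x e) then G e else 0 := by
  have hdist : ∀ e ∈ ball n k, hammingDist x (bitXor x e) ≤ k := by
    intro e he
    rw [hammingDist_bitXor_left]
    simpa [ball] using he
  rcases hx : nearest A k x with _ | y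
  · rw [Finset.sum_eq_zero, add_zero]
    · rfl
    · intro e he
      refine if_neg fun hAe => ?_
      have := nearest_isSome hAe (hdist e he)
      rw [hx] at this
      simp at this
  · obtain ⟨hy, hxy⟩ := nearest_eq_some hx
    have hm : bitXor x y ∈ ball n k := by
      have := hammingDist_bitXor_left x (bitXor x y)
      rw [bitXor_cancel_left] at this
      simp [ball, ← this, hxy]
    rw [Finset.sum_eq_single_of_mem _ hm, bitXor_cancel_left, if_pos hy]
    · simp
    · intro e he hne
      refine if_neg fun hAe => hne ?_
      rw [hA x y _ hy hAe hxy (hdist e he), bitXor_cancel_left]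

/-- The simulated example is nearly uniform. For each offset `e`, the points `x` with `x + e` in `A`
form a translate of `A`, and `e + z` with `z` uniform on `A` is uniform on the same translate. A
bounded search loses `1 / (R + 1)` per offset. -/
theorem avg_nearest_ge {k : ℕ} (hA : Sparse A k) {F : Cube n → ℝ} (hF : ∀ x, F x ≤ 1)
    (R : ℕ) : avg F - (n + 1) ^ k / (R + 1) ≤ avg fun x => (nearest A k x).elim (F x) fun y =>
      pick A (fun o => o.elim 0 fun z => F (bitXor (bitXor x y) z)) R := by
  set G : Cube n → ℝ := fun e => pick A (fun o => o.elim 0 fun z => F (bitXor e z)) R with hG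
  have h1 : ∀ x, (nearest A k x).elim (F x) (fun y =>
      pick A (fun o => o.elim 0 fun z => F (bitXor (bitXor x y) z)) R) =
      (nearest A k x).elim (F x) (fun _ => 0) +
        ∑ e ∈ ball n k, if A (bitXor x e) then G e else 0 :=
    fun x => nearest_elim_eq hA x (F x) G
  have h2 : ∀ x, F x = (nearest A k x).elim (F x) (fun _ => 0) +
        ∑ e ∈ ball n k, if A (bitXor x e) then F x else 0 := by
    intro x
    rw [← nearest_elim_eq hA x (F x) fun _ => F x]
    cases nearest A k x <;> rfl
  have hsum : ∀ H : Cube n → Cube n → ℝ, avg (fun x => ∑ e ∈ ball n k, H e x) =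
      ∑ e ∈ ball n k, avg (H e) := by
    intro H
    simp only [avg, Finset.sum_div]
    exact Finset.sum_comm
  have h3 : avg F = avg (fun x => (nearest A k x).elim (F x) (fun _ => 0)) +
      ∑ e ∈ ball n k, avg fun x => if A (bitXor x e) then F x else 0 := by
    rw [← hsum, ← avg_add]
    exact congrArg avg (funext h2)
  simp only [h1]
  rw [avg_add, hsum, h3]
  have h4 : ∀ e ∈ ball n k, (avg fun x => if A (bitXor x e) then F x else 0) - 1 / (R + 1) ≤
      avg fun x => if A (bitXor x e) then G e else 0 := by
    intro e _
    have ha := density_mul_pick_ge (A := A) (F := fun z => F (bitXor e z)) (fun _ => hF _) R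
    have hb : (avg fun x => if A (bitXor x e) then F x else 0) =
        avg fun w => if A w then F (bitXor e w) else 0 := by
      rw [← avg_equiv (xorEquiv e) fun w => if A w then F (bitXor e w) else 0]
      congr 1; funext x
      change (if A (bitXor x e) then F x else 0) =
        if A (bitXor x e) then F (bitXor e (bitXor x e)) else 0
      rw [bitXor_comm x e, bitXor_cancel_left]
    have hc : (avg fun x => if A (bitXor x e) then G e else 0) = density A * G e := by
      rw [density, mul_comm, ← avg_mul_left,
        ← avg_equiv (xorEquiv e) fun w => G e * if A w then 1 else 0]
      congr 1; funext x
      change _ = G e * if A (bitXor x e) then 1 else 0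
      split_ifs <;> simp
    rw [hb, hc]
    exact ha
  have h5 := Finset.sum_le_sum h4
  rw [Finset.sum_sub_distrib, Finset.sum_const, nsmul_eq_mul, mul_one_div] at h5
  have h6 : ((ball n k).card : ℝ) / (R + 1) ≤ (n + 1) ^ k / (R + 1) := by
    gcongr
    exact_mod_cast card_ball_le n k
  linarith

end pick

/-! ### Lazily sampled labels -/

/-- A list of labeled points. -/
abbrev Memo (n : ℕ) : Type := List (Cube n × Bool)

section memo
variable {n : ℕ}

/-- Add a labeled point, unless the point has a label. -/
def insertLabel (D : Memo n) (e : Cube n × Bool) : Memo n :=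
  if (lookupLabel e.1 D).isSome then D else e :: D

/-- The expectation of `κ` at the label of `x`, which is read from the list or, if it is not there,
chosen at random and added to the list. -/
noncomputable def memoVal (D : Memo n) (x : Cube n) (κ : Bool → Memo n → ℝ) : ℝ :=
  (lookupLabel x D).elim (avg fun b => κ b ((x, b) :: D)) fun b => κ b D

/-- The expectation of `κ` at a simulated labeled example. -/
noncomputable def drawVal (f : Cube n → Bool) (A : Cube n → Bool) (k R : ℕ) (D : Memo n)
    (κ : Cube n → Bool → Memo n → ℝ) : ℝ :=
  avg fun x => (nearest A k x).elim (memoVal D x (κ x)) fun y =>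
    pick A (fun o => o.elim (memoVal D x (κ x)) fun z =>
      memoVal (insertLabel D (z, f z)) (bitXor (bitXor x y) z) (κ (bitXor (bitXor x y) z))) R

/-- The expectation of the payoff of a run of at most `t` steps in which examples and queries are
simulated. -/
noncomputable def simExpect (f : Cube n → Bool) (A : Cube n → Bool) (k R : ℕ) (Ψ : Store → ℝ) :
    ℕ → List Prog → Store → Memo n → ℝ
  | 0, [], s, _ => Ψ s
  | 0, _ :: _, _, _ => 0
  | _ + 1, [], s, _ => Ψ s
  | t + 1, .assign v e :: r, s, D =>
      simExpect f A k R Ψ t r (Function.update s v (e.eval s)) D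
  | t + 1, .seq p q :: r, s, D => simExpect f A k R Ψ t (p :: q :: r) s D
  | t + 1, .cond e p q :: r, s, D =>
      simExpect f A k R Ψ t ((if (e.eval s).isPair then p else q) :: r) s D
  | t + 1, .loop e p :: r, s, D =>
      simExpect f A k R Ψ t (if (e.eval s).isPair then p :: .loop e p :: r else r) s D
  | t + 1, .flip v :: r, s, D =>
      avg fun b => simExpect f A k R Ψ t r (Function.update s v (Data.ofBool b)) D
  | t + 1, .draw v :: r, s, D => drawVal f A k R D fun x b D' =>
      simExpect f A k R Ψ t r (Function.update s v (.cons (Data.ofPoint x) (Data.ofBool b))) D'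
  | t + 1, .query v :: r, s, D => memoVal D (Data.toPoint n (s v)) fun b D' =>
      simExpect f A k R Ψ t r (Function.update s v (Data.ofBool b)) D'

theorem memoVal_mul_left (v : ℝ) (D : Memo n) (x : Cube n) (κ : Bool → Memo n → ℝ) :
    memoVal D x (fun b D' => v * κ b D') = v * memoVal D x κ := by
  rw [memoVal, memoVal]
  cases lookupLabel x D
  · exact avg_mul_left v _
  · rfl

theorem drawVal_mul_left (f A : Cube n → Bool) (k R : ℕ) (v : ℝ) (D : Memo n)
    (κ : Cube n → Bool → Memo n → ℝ) :
    drawVal f A k R D (fun x b D' => v * κ x b D') = v * drawVal f A k R D κ := by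
  rw [drawVal, drawVal, ← avg_mul_left]
  congr 1; funext x
  cases nearest A k x with
  | none => exact memoVal_mul_left _ _ _ _
  | some y =>
    simp only [Option.elim_some]
    rw [← pick_mul_left]
    congr 1; funext o
    cases o <;> exact memoVal_mul_left _ _ _ _

/-- Used to pull the value `v` of everything that happens after a simulated run out of its payoff.
-/
theorem simExpect_mul_left (f A : Cube n → Bool) (k R : ℕ) (v : ℝ) (Ψ : Store → ℝ) (t : ℕ)
    (todo : List Prog) (s : Store) (D : Memo n) :
    simExpect f A k R (fun s => v * Ψ s) t todo s D = v * simExpect f A k R Ψ t todo s D := by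
  induction t generalizing todo s D with
  | zero => cases todo <;> simp [simExpect]
  | succ t ih =>
    rcases todo with _ | ⟨p, r⟩
    · rfl
    · cases p <;> simp only [simExpect, ih, avg_mul_left, memoVal_mul_left, drawVal_mul_left]

theorem le_memoVal {D : Memo n} {x : Cube n} {κ : Bool → Memo n → ℝ} {v : ℝ}
    (h1 : ∀ b, lookupLabel x D = some b → v ≤ κ b D)
    (h2 : lookupLabel x D = none → ∀ b, v ≤ κ b ((x, b) :: D)) : v ≤ memoVal D x κ := by
  rw [memoVal]
  rcases h : lookupLabel x D with _ | b
  · exact le_avg (h2 h)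
  · exact h1 b h

theorem le_drawVal {f A : Cube n → Bool} {k R : ℕ} {D : Memo n}
    {κ : Cube n → Bool → Memo n → ℝ} {v : ℝ} (h1 : ∀ x, v ≤ memoVal D x (κ x))
    (h2 : ∀ x z, v ≤ memoVal (insertLabel D (z, f z)) x (κ x)) : v ≤ drawVal f A k R D κ := by
  refine le_avg fun x => ?_
  cases nearest A k x with
  | none => exact h1 x
  | some y => exact le_pick (h1 x) (fun z _ => h2 _ z) R

theorem simExpect_nonneg {f A : Cube n → Bool} {k R : ℕ} {Ψ : Store → ℝ} (h : ∀ s, 0 ≤ Ψ s)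
    (t : ℕ) (todo : List Prog) (s : Store) (D : Memo n) :
    0 ≤ simExpect f A k R Ψ t todo s D := by
  induction t generalizing todo s D with
  | zero => cases todo <;> simp [simExpect, h]
  | succ t ih =>
    have hm : ∀ (D : Memo n) x (κ : Bool → Memo n → ℝ), (∀ b D', 0 ≤ κ b D') →
        0 ≤ memoVal D x κ :=
      fun D x κ hκ => le_memoVal (fun b _ => hκ _ _) fun _ b => hκ _ _
    rcases todo with _ | ⟨p, r⟩
    · exact h s
    · cases p <;> simp only [simExpect]
      case flip => exact avg_nonneg fun _ => ih _ _ _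
      case draw =>
        exact le_drawVal (fun x => hm _ _ _ fun _ _ => ih _ _ _)
          (fun x z => hm _ _ _ fun _ _ => ih _ _ _)
      case query => exact hm _ _ _ fun _ _ => ih _ _ _
      all_goals exact ih _ _ _

/-- The target functions that have the labels in the list. -/
def Extends (D : Memo n) (g : Cube n → Bool) : Prop :=
  ∀ x b, lookupLabel x D = some b → g x = b

theorem Extends.of_cons {D : Memo n} {g : Cube n → Bool} {e : Cube n × Bool}
    (h : Extends (e :: D) g) (he : lookupLabel e.1 D = none) : Extends D g := by
  intro x b hx
  refine h x b ?_
  rw [lookupLabel, if_neg, hx]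
  rintro rfl
  simp [he] at hx

theorem Extends.of_insertLabel {D : Memo n} {g : Cube n → Bool} {e : Cube n × Bool}
    (h : Extends (insertLabel D e) g) : Extends D g := by
  rw [insertLabel] at h
  split_ifs at h with he
  · exact h
  · exact h.of_cons (by simpa using he)

theorem Extends.head {D : Memo n} {g : Cube n → Bool} {x : Cube n} {b : Bool}
    (h : Extends ((x, b) :: D) g) : g x = b :=
  h x b (by simp [lookupLabel])

theorem exists_extends (D : Memo n) : ∃ g, Extends D g :=
  ⟨fun x => (lookupLabel x D).getD false, fun x b h => by simp [h]⟩

/-- A property of the final store that holds in all runs for all target functions also holds in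
all simulated runs. -/
theorem one_le_simExpect {f A : Cube n → Bool} {k R : ℕ} {P : Store → Prop} (t : ℕ)
    (todo : List Prog) (s : Store) (D : Memo n)
    (h : ∀ g, Extends D g → 1 ≤ expect g (payoff P) t todo s) :
    1 ≤ simExpect f A k R (payoff P) t todo s D := by
  induction t generalizing todo s D with
  | zero =>
    obtain ⟨g, hg⟩ := exists_extends D
    have := h g hg
    cases todo with
    | nil => exact this
    | cons p r => exact absurd this (by simp [expect])
  | succ t ih =>
    have hle : ∀ (g : Cube n → Bool) todo s, expect g (payoff P) t todo s ≤ 1 := fun g =>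
      expect_le_one (payoff_le_one P) t
    -- Whichever bit is chosen for a new label, some target has all labels chosen so far. Hence the
    -- simulated learner is never in a situation that no real target could produce.
    have hmemo : ∀ (D : Memo n) (x : Cube n) r (u : Bool → Store), (∀ g, Extends D g →
        1 ≤ expect g (payoff P) t r (u (g x))) →
        1 ≤ memoVal D x fun b D' => simExpect f A k R (payoff P) t r (u b) D' := by
      intro D x r u hu
      refine le_memoVal (fun b hb => ih _ _ _ fun g hg => ?_) fun hx b => ih _ _ _ fun g hg => ?_
      · rw [← hg x b hb]; exact hu g hg
      · rw [← hg.head]; exact hu g (hg.of_cons hx)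
    rcases todo with _ | ⟨p, r⟩
    · obtain ⟨g, hg⟩ := exists_extends D
      exact h g hg
    · cases p <;> simp only [expect, simExpect] at h ⊢
      case flip v =>
        exact le_avg fun b => ih _ _ _ fun g hg =>
          forall_one_le_of_one_le_avg (fun b => hle _ _ _) (h g hg) b
      case draw v =>
        have h' : ∀ g, Extends D g → ∀ x, 1 ≤ expect g (payoff P) t r
            (Function.update s v (.cons (Data.ofPoint x) (Data.ofBool (g x)))) := fun g hg x =>
          forall_one_le_of_one_le_avg (fun x => hle _ _ _) (h g hg) x
        exact le_drawVal
          (fun x => hmemo D x r (fun b => Function.update s v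
            (.cons (Data.ofPoint x) (Data.ofBool b))) fun g hg => h' g hg x)
          fun x z => hmemo _ x r (fun b => Function.update s v
            (.cons (Data.ofPoint x) (Data.ofBool b))) fun g hg => h' g hg.of_insertLabel x
      case query v => exact hmemo D _ r (fun b => Function.update s v (Data.ofBool b)) h
      all_goals exact ih _ _ _ h

end memo

/-! ### Deferred decisions: simulated runs against real runs with random labels -/

section lazy
variable {n : ℕ}

/-- The target function that agrees with `f` on `A`, has the labels in the list `D`, and agrees with
`r` elsewhere. -/
def labels (f A : Cube n → Bool) (D : Memo n) (r : Cube n → Bool) : Cube n → Bool := fun x =>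
  if A x then f x else (lookupLabel x D).getD (r x)

/-- The labels in the list agree with `f` on `A`, and all points of `A` near the sample have one. -/
structure Consistent (f A : Cube n → Bool) (k : ℕ) (D : Memo n) (S : List (Cube n)) : Prop where
  eq_of_mem : ∀ x b, A x → lookupLabel x D = some b → b = f x
  isSome_of_near : ∀ x ∈ S, ∀ y, A y → hammingDist x y ≤ k → (lookupLabel y D).isSome

/-- All queries in runs from a configuration obey a rule. -/
def Obeys (rule : QueryRule) (g : Cube n → Bool) (c : Config n) : Prop :=
  ∀ t : ℕ, ∀ c' ∈ (runFor g c t).support, ∀ v r,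
    c'.todo = Prog.query v :: r → rule n c'.sample (Data.toPoint n (c'.store v))

theorem Obeys.step {rule : QueryRule} {g : Cube n → Bool} {c c' : Config n} (h : Obeys rule g c)
    (hc : c' ∈ (step g c).support) : Obeys rule g c' := by
  intro t c'' hc''
  refine h (t + 1) c'' ?_
  rw [runFor_succ, PMF.mem_support_bind_iff]
  exact ⟨c', hc, hc''⟩

/-- Flipping the value at `x` is an involution, so the value of a uniform function at `x` may be
resampled. -/
theorem avg_update (x : Cube n) (H : (Cube n → Bool) → ℝ) :
    avg H = avg fun b => avg fun r => H (Function.update r x b) := by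
  have h : avg (fun r => H (Function.update r x (!r x))) = avg H := by
    refine avg_equiv (Function.Involutive.toPerm
      (fun r : Cube n → Bool => Function.update r x (!r x)) fun r => ?_) H
    simp
  rw [avg_bool, ← avg_add]
  have h2 : (avg H + avg fun r => H (Function.update r x (!r x))) / 2 = avg H := by rw [h]; ring
  rw [← h2, ← avg_add]
  congr 2; funext r
  cases hr : r x
  · rw [← hr, Function.update_eq_self, hr]; rfl
  · rw [add_comm, ← hr, Function.update_eq_self, hr]; rfl

/-- Writing a coin into the memo amounts to fixing that value of the random function `r`; with
`avg_update` this justifies flipping coins only when they are needed. -/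
theorem labels_cons (f A : Cube n → Bool) {D : Memo n} {x : Cube n}
    (hD : lookupLabel x D = none) (b : Bool) (r : Cube n → Bool) :
    labels f A ((x, b) :: D) r = labels f A D (Function.update r x b) := by
  funext y
  simp only [labels, lookupLabel]
  by_cases hy : y = x
  · subst hy; simp [hD]
  · simp [hy]

theorem labels_cons_apply {f A : Cube n → Bool} {D : Memo n} {x : Cube n} (hx : A x = false)
    (b : Bool) (r : Cube n → Bool) : labels f A ((x, b) :: D) r x = b := by
  simp [labels, hx, lookupLabel]

theorem labels_insertLabel {f A : Cube n → Bool} {D : Memo n} {z : Cube n} (hz : A z)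
    (r : Cube n → Bool) : labels f A (insertLabel D (z, f z)) r = labels f A D r := by
  rw [insertLabel]
  split_ifs with h
  · rfl
  · funext y
    simp only [labels, lookupLabel]
    by_cases hy : y = z
    · subst hy; simp [hz]
    · simp [hy]

theorem lookupLabel_insertLabel_of_ne {D : Memo n} {e : Cube n × Bool} {y : Cube n}
    (hy : y ≠ e.1) : lookupLabel y (insertLabel D e) = lookupLabel y D := by
  rw [insertLabel]
  split_ifs
  · rfl
  · simp [lookupLabel, hy]

theorem isSome_lookupLabel_insertLabel (D : Memo n) (e : Cube n × Bool) :
    (lookupLabel e.1 (insertLabel D e)).isSome := by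
  rw [insertLabel]
  split_ifs with h
  · exact h
  · simp [lookupLabel]

theorem length_insertLabel_le (D : Memo n) (e : Cube n × Bool) :
    (insertLabel D e).length ≤ D.length + 1 := by
  rw [insertLabel]; split_ifs <;> simp

theorem Consistent.cons {f A : Cube n → Bool} {k : ℕ} {D : Memo n} {S : List (Cube n)}
    (h : Consistent f A k D S) {x : Cube n} (hx : A x = false) (b : Bool) :
    Consistent f A k ((x, b) :: D) S := by
  constructor
  · intro y c hy hc
    rw [lookupLabel, if_neg (by rintro rfl; simp [hx] at hy)] at hc
    exact h.eq_of_mem y c hy hc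
  · intro y hy z hz hd
    rw [lookupLabel]
    split_ifs
    · rfl
    · exact h.isSome_of_near y hy z hz hd

theorem Consistent.insertLabel {f A : Cube n → Bool} {k : ℕ} {D : Memo n} {S : List (Cube n)}
    (h : Consistent f A k D S) (z : Cube n) : Consistent f A k (insertLabel D (z, f z)) S := by
  constructor
  · intro y c hy hc
    by_cases hyz : y = z
    · subst hyz
      rw [LocalQueries.insertLabel] at hc
      split_ifs at hc
      · exact h.eq_of_mem y c hy hc
      · simpa [lookupLabel, eq_comm] using hc
    · rw [lookupLabel_insertLabel_of_ne (e := (z, f z)) hyz] at hc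
      exact h.eq_of_mem y c hy hc
  · intro x hx y hy hd
    by_cases hyz : y = z
    · subst hyz; exact isSome_lookupLabel_insertLabel D (y, f y)
    · rw [lookupLabel_insertLabel_of_ne (e := (z, f z)) hyz]
      exact h.isSome_of_near x hx y hy hd

/-- A simulated run earns almost as much as a real run for a random target function with the given
labels. -/
theorem avg_expect_le_simExpect {f A : Cube n → Bool} {k R : ℕ} (hA : Sparse A k)
    {φ : (Cube n → Bool) → Store → ℝ} (hφ1 : ∀ g s, φ g s ≤ 1)
    {Ψ : Store → ℝ} (hΨ0 : ∀ s, 0 ≤ Ψ s) {β : ℝ} (hβ : 0 ≤ β) {ℓ : ℕ}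
    (hΨ : ∀ s (D : Memo n), D.length ≤ ℓ →
      avg (fun r => φ (labels f A D r) s) ≤ Ψ s + β) (t : ℕ) (todo : List Prog) (s : Store)
    (S : List (Cube n)) (D : Memo n) (hℓ : D.length + 2 * t ≤ ℓ) (hD : Consistent f A k D S)
    (hobey : ∀ r, Obeys (kLocal k) (labels f A D r) ⟨todo, s, S⟩) :
    avg (fun r => expect (labels f A D r) (φ (labels f A D r)) t todo s) ≤
      simExpect f A k R Ψ t todo s D + β + t * ((n + 1) ^ k / (R + 1)) := by
  set η : ℝ := (n + 1) ^ k / (R + 1) with hη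
  have hη0 : 0 ≤ η := by positivity
  induction t generalizing todo s S D with
  | zero =>
    cases todo with
    | nil => simpa [expect, simExpect] using hΨ s D (by omega)
    | cons p r => simpa [expect, simExpect, avg_const] using hβ
  | succ t ih =>
    have hstep : ∀ {todo' s'}, (∀ r, ⟨todo', s', S⟩ ∈
        (step (labels f A D r) ⟨todo, s, S⟩).support) →
        avg (fun r => expect (labels f A D r) (φ (labels f A D r)) t todo' s') ≤
          simExpect f A k R Ψ t todo' s' D + β + (t + 1 : ℕ) * η := by
      intro todo' s' h
      refine (ih todo' s' S D (by omega) hD fun r => (hobey r).step (h r)).trans ?_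
      push_cast; linarith
    -- the value of a label that is looked up or chosen
    have hmemo : ∀ (D : Memo n) (S : List (Cube n)) (x : Cube n) (r0 : List Prog)
        (u : Bool → Store), D.length + 1 + 2 * t ≤ ℓ → Consistent f A k D S →
        (A x → (lookupLabel x D).isSome) →
        (∀ r, Obeys (kLocal k) (labels f A D r) ⟨r0, u (labels f A D r x), S⟩) →
        avg (fun r => expect (labels f A D r) (φ (labels f A D r)) t r0
          (u (labels f A D r x))) - β - t * η ≤
          memoVal D x fun b D' => simExpect f A k R Ψ t r0 (u b) D' := by
      intro D S x r0 u hl hD hx hob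
      rw [memoVal]
      rcases hlx : lookupLabel x D with _ | b
      · have hAx : A x = false := by
          by_contra hAx
          have := hx (by simpa using hAx)
          simp [hlx] at this
        have hlab : ∀ b r, labels f A D (Function.update r x b) x = b := by
          intro b r
          rw [← labels_cons f A hlx, labels_cons_apply hAx]
        -- A point without a label is outside `A` here, so its label is a coin that has not been
        -- used: resample it and move it into the memo.
        rw [avg_update x]
        simp only [hlab]
        have hb : ∀ b, avg (fun r => expect (labels f A D (Function.update r x b))
            (φ (labels f A D (Function.update r x b))) t r0 (u b)) - (β + t * η) ≤
            simExpect f A k R Ψ t r0 (u b) ((x, b) :: D) := by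
          intro b
          simp only [← labels_cons f A hlx]
          have := ih r0 (u b) S ((x, b) :: D) (by simp; omega) (hD.cons hAx b) (fun r => by
            have := hob (Function.update r x b)
            rw [← labels_cons f A hlx, labels_cons_apply hAx] at this
            exact this)
          linarith
        have := avg_mono hb
        rw [avg_sub, avg_const] at this
        simp only [Option.elim_none]
        linarith
      · have hlab : ∀ r, labels f A D r x = b := by
          intro r
          simp only [labels, hlx]
          split_ifs with hAx
          · exact (hD.eq_of_mem x b hAx hlx).symm
          · rfl
        simp only [hlab, Option.elim_some] at hob ⊢
        have := ih r0 (u b) S D (by omega) hD hob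
        linarith
    rcases todo with _ | ⟨p, r0⟩
    · have := hΨ s D (by omega)
      simp only [expect, simExpect]
      have : 0 ≤ ((t + 1 : ℕ) : ℝ) * η := by positivity
      linarith
    · cases p with
      | assign v e => exact hstep fun r => by simp [step]
      | seq p q => exact hstep fun r => by simp [step]
      | cond e p q => exact hstep fun r => by simp [step]
      | loop e p => exact hstep fun r => by simp [step]
      | flip v =>
        simp only [expect, simExpect]
        rw [avg_comm]
        have := avg_mono fun b => hstep (todo' := r0)
          (s' := Function.update s v (Data.ofBool b)) fun r => by cases b <;> simp [step]
        refine this.trans (le_of_eq ?_)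
        rw [avg_add, avg_add, avg_const, avg_const]
      | draw v =>
        simp only [expect, simExpect]
        rw [avg_comm]
        set u : Cube n → Bool → Store := fun x b =>
          Function.update s v (.cons (Data.ofPoint x) (Data.ofBool b)) with hu
        set G : Cube n → ℝ := fun x => avg fun r => expect (labels f A D r)
          (φ (labels f A D r)) t r0 (u x (labels f A D r x)) with hG
        have hG1 : ∀ x, G x ≤ 1 := fun x => avg_le fun r => expect_le_one (hφ1 _) _ _ _
        have hob : ∀ x r, Obeys (kLocal k) (labels f A D r)
            ⟨r0, u x (labels f A D r x), x :: S⟩ := fun x r => (hobey r).step (by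
          simp only [step, PMF.mem_support_bind_iff]
          exact ⟨x, by simp, by simp [hu]⟩)
        -- Truncation at zero covers the failed search: the simulation then goes on with a possibly
        -- wrong label, and all that is known of its payoff is that it is nonnegative.
        let F : Cube n → ℝ := fun x => max 0 (G x - β - t * η)
        have hF1 : ∀ x, F x ≤ 1 := fun x => max_le zero_le_one (by
          have := hG1 x
          have : 0 ≤ (t : ℝ) * η := by positivity
          linarith)
        have hmono : ∀ (D : Memo n) x, 0 ≤ memoVal D x fun b D' =>
            simExpect f A k R Ψ t r0 (u x b) D' := fun D x =>
          le_memoVal (fun b _ => simExpect_nonneg hΨ0 _ _ _ _)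
            fun _ b => simExpect_nonneg hΨ0 _ _ _ _
        have hdraw : avg F - η ≤ drawVal f A k R D fun x b D' =>
            simExpect f A k R Ψ t r0 (u x b) D' := by
          refine (avg_nearest_ge hA hF1 R).trans (avg_mono fun x => ?_)
          rcases hx : nearest A k x with _ | y
          · simp only [Option.elim_none]
            have hnear : ∀ y, A y → ¬hammingDist x y ≤ k := by
              intro y hy hd
              have := nearest_isSome hy hd
              simp [hx] at this
            -- With no point of `A` near `x`, consistency with the longer sample needs no new label,
            -- and `x` itself is outside `A`.
            refine max_le (hmono D x) (hmemo D (x :: S) x r0 (u x) (by omega) ?_ ?_ (hob x))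
            · refine ⟨hD.eq_of_mem, fun x' hx' y hy hd => ?_⟩
              rcases List.mem_cons.mp hx' with rfl | hx'
              · exact absurd hd (hnear y hy)
              · exact hD.isSome_of_near x' hx' y hy hd
            · intro hAx
              exact absurd (by simp) (hnear x hAx)
          · obtain ⟨hy, hxy⟩ := nearest_eq_some hx
            simp only [Option.elim_some]
            refine pick_mono (hmono D x) (fun z hz => ?_) R
            simp only [Option.elim_some]
            -- The point `x'` differs from `z` exactly where `x` differs from `y`. So `z` is within
            -- distance `k` of `x'`, and by sparsity it is the only such point of `A`. The memo
            -- grows by at most two labels, those of `z` and of `x'`.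
            set x' := bitXor (bitXor x y) z
            have hx'z : hammingDist x' z ≤ k := by
              have := hammingDist_bitXor x y (bitXor y z)
              rw [bitXor_cancel_left] at this
              rw [← this] at hxy
              convert hxy using 2
              funext i
              simp [x', bitXor]
            refine max_le (hmono _ x') ?_
            have := hmemo (insertLabel D (z, f z)) (x' :: S) x' r0 (u x')
              (by have := length_insertLabel_le D (z, f z); omega) ?_ ?_ ?_
            · simpa only [labels_insertLabel hz] using this
            · have hc := hD.insertLabel z
              refine ⟨hc.eq_of_mem, fun x'' hx'' y' hy' hd => ?_⟩
              rcases List.mem_cons.mp hx'' with rfl | hx''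
              · rw [hA _ _ _ hy' hz hd hx'z]
                exact isSome_lookupLabel_insertLabel D (z, f z)
              · exact hc.isSome_of_near x'' hx'' y' hy' hd
            · intro hAx'
              rw [hA _ _ _ hAx' hz (by simp) hx'z]
              exact isSome_lookupLabel_insertLabel D (z, f z)
            · intro r
              rw [labels_insertLabel hz]
              exact hob x' r
        have hGF : avg G - β - t * η ≤ avg F := by
          have : avg (fun x => G x - (β + t * η)) ≤ avg F := avg_mono fun x => by
            have := le_max_right 0 (G x - β - t * η)
            change _ ≤ max 0 (G x - β - t * η)
            linarith
          rw [avg_sub, avg_const] at this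
          linarith
        change avg G ≤ _
        push_cast
        linarith
      | query v =>
        simp only [expect, simExpect]
        have hx : A (Data.toPoint n (s v)) →
            (lookupLabel (Data.toPoint n (s v)) D).isSome := by
          intro hAx
          -- Locality is used here: the query is near a received example, so if it lies in `A`,
          -- consistency says that its true label is already in the memo. Any choice of the
          -- remaining coins will do.
          obtain ⟨x, hx, hd⟩ := hobey (fun _ => false) 0 ⟨Prog.query v :: r0, s, S⟩
            (by simp [runFor]) v r0 rfl
          exact hD.isSome_of_near x hx _ hAx hd
        have := hmemo D S (Data.toPoint n (s v)) r0
          (fun b => Function.update s v (Data.ofBool b)) (by omega) hD hx fun r =>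
            (hobey r).step (by simp [step])
        push_cast
        linarith

end lazy

/-! ### Second moments: coins outside the class favour no hypothesis -/

section fluctuation
variable {n : ℕ}

/-- The bits as signs. -/
def sgn (b : Bool) : ℝ := if b then 1 else -1

theorem avg_sgn_mul_sgn (x y : Cube n) :
    avg (fun r : Cube n → Bool => sgn (r x) * sgn (r y)) = if x = y then 1 else 0 := by
  split_ifs with h
  · subst h
    rw [show (fun r : Cube n → Bool => sgn (r x) * sgn (r x)) = fun _ => 1 from
      funext fun r => by cases r x <;> simp [sgn], avg_const]
  · rw [avg_update x, avg_bool, ← avg_add]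
    have : ∀ r : Cube n → Bool, sgn (Function.update r x false x) *
        sgn (Function.update r x false y) + sgn (Function.update r x true x) *
        sgn (Function.update r x true y) = 0 := by
      intro r
      rw [Function.update_of_ne (Ne.symm h), Function.update_of_ne (Ne.symm h)]
      cases r y <;> simp [sgn]
    simp only [this, avg_const, zero_div]

/-- The signs at distinct points are uncorrelated, so only the diagonal terms survive. -/
theorem avg_sum_sq_le (W : Finset (Cube n)) (s : Cube n → ℝ) (hs : ∀ x, s x ^ 2 ≤ 1) :
    avg (fun r : Cube n → Bool => (∑ x ∈ W, s x * sgn (r x)) ^ 2) ≤ Fintype.card (Cube n) := by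
  have hsum : ∀ H : Cube n → (Cube n → Bool) → ℝ, avg (fun r => ∑ x ∈ W, H x r) =
      ∑ x ∈ W, avg (H x) := by
    intro H
    simp only [avg, Finset.sum_div]
    exact Finset.sum_comm
  have h : ∀ r : Cube n → Bool, (∑ x ∈ W, s x * sgn (r x)) ^ 2 =
      ∑ x ∈ W, ∑ y ∈ W, s x * s y * (sgn (r x) * sgn (r y)) := by
    intro r
    rw [sq, Finset.sum_mul_sum]
    exact Finset.sum_congr rfl fun x _ => Finset.sum_congr rfl fun y _ => by ring
  simp only [h, hsum, avg_mul_left, avg_sgn_mul_sgn]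
  calc ∑ x ∈ W, ∑ y ∈ W, s x * s y * (if x = y then 1 else 0) = ∑ x ∈ W, s x ^ 2 := by
        refine Finset.sum_congr rfl fun x hx => ?_
        simp [hx, sq]
    _ ≤ ∑ x ∈ W, (1 : ℝ) := Finset.sum_le_sum fun x _ => hs x
    _ = W.card := by simp
    _ ≤ _ := by exact_mod_cast Finset.card_le_univ W

/-- The number of points of `A` at which two functions differ. -/
def mistakes (A : Cube n → Bool) (h f : Cube n → Bool) : ℝ :=
  ∑ x, if A x ∧ h x ≠ f x then 1 else 0

theorem err_mul_card (h f : Cube n → Bool) :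
    err h f * Fintype.card (Cube n) = ∑ x, if h x ≠ f x then (1 : ℝ) else 0 := by
  have : (Fintype.card (Cube n) : ℝ) ≠ 0 := by exact_mod_cast Fintype.card_ne_zero
  rw [err, div_mul_cancel₀ _ this, Finset.card_filter]
  push_cast
  rfl

theorem card_isSome_lookupLabel_le (D : Memo n) :
    (Finset.univ.filter fun x => (lookupLabel x D).isSome).card ≤ D.length := by
  calc _ ≤ (D.map Prod.fst).toFinset.card := by
        refine Finset.card_le_card fun x hx => ?_
        simp only [Finset.mem_filter, Finset.mem_univ, true_and] at hx
        induction D with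
        | nil => simp [lookupLabel] at hx
        | cons e D ih =>
          rw [lookupLabel] at hx
          split_ifs at hx with h
          · simp [h]
          · have := ih hx
            simp only [List.map_cons, List.toFinset_cons, Finset.mem_insert]
            exact Or.inr this
    _ ≤ _ := (List.toFinset_card_le _).trans (by simp)

/-- A hypothesis that makes many more mistakes on `A` than a concept is unlikely to be about as good
as this concept for a random target function. -/
theorem avg_payoff_err_le {f A : Cube n → Bool} {D : Memo n} {h c : Cube n → Bool} {ε γ : ℝ}
    (hγ : 0 < γ) (hD : (D.length : ℝ) ≤ γ * Fintype.card (Cube n))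
    (hc : mistakes A c f + (ε + 2 * γ) * Fintype.card (Cube n) < mistakes A h f) :
    avg (fun r => if err h (labels f A D r) ≤ err c (labels f A D r) + ε then (1 : ℝ) else 0) ≤
      1 / (γ ^ 2 * Fintype.card (Cube n)) := by
  set N : ℝ := ((Fintype.card (Cube n) : ℕ) : ℝ) with hN
  have hN0 : 0 < N := by rw [hN]; exact_mod_cast Fintype.card_pos
  set W : Finset (Cube n) :=
    Finset.univ.filter fun x => A x = false ∧ (lookupLabel x D).isSome = false with hW
  set s : Cube n → ℝ := fun x => if h x = c x then 0 else if h x then -1 else 1 with hs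
  have hs1 : ∀ x, s x ^ 2 ≤ 1 := fun x => by simp only [hs]; split_ifs <;> norm_num
  -- One point's share of the excess error of `h` over `c`: exact on `A` up to the cost of labels,
  -- at least `-1` at a labelled point, and a signed coin at an unlabelled point outside `A` where
  -- `h` and `c` differ.
  have aux : ∀ (a h c f r : Bool) (l : Option Bool),
      ((if a ∧ h ≠ f then (1 : ℝ) else 0) - if a ∧ c ≠ f then 1 else 0) -
        (if l.isSome then 1 else 0) + (if a = false ∧ l.isSome = false then
          (if h = c then 0 else if h then -1 else 1) * sgn r else 0) ≤
      (if h ≠ (if a then f else l.getD r) then (1 : ℝ) else 0) -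
        if c ≠ (if a then f else l.getD r) then 1 else 0 := by
    intro a h c f r l
    cases a
    · rcases l with _ | b
      · cases h <;> cases c <;> cases r <;> simp [sgn]
      · cases h <;> cases c <;> cases b <;> simp
    · cases h <;> cases c <;> cases f <;> rcases l with _ | b <;> simp
  have hpt : ∀ r x, ((if A x ∧ h x ≠ f x then (1 : ℝ) else 0) - if A x ∧ c x ≠ f x then 1 else 0) -
      (if (lookupLabel x D).isSome then 1 else 0) + (if x ∈ W then s x * sgn (r x) else 0) ≤
      (if h x ≠ labels f A D r x then (1 : ℝ) else 0) -
        if c x ≠ labels f A D r x then 1 else 0 := by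
    intro r x
    simp only [hW, Finset.mem_filter, Finset.mem_univ, true_and, labels, hs]
    convert aux (A x) (h x) (c x) (f x) (r x) (lookupLabel x D) using 2 <;> rfl
  have hlb : ∀ r, mistakes A h f - mistakes A c f - D.length + ∑ x ∈ W, s x * sgn (r x) ≤
      (err h (labels f A D r) - err c (labels f A D r)) * N := by
    intro r
    rw [sub_mul, err_mul_card, err_mul_card, ← Finset.sum_sub_distrib]
    refine le_trans ?_ (Finset.sum_le_sum fun x _ => hpt r x)
    rw [Finset.sum_add_distrib, Finset.sum_sub_distrib, Finset.sum_sub_distrib,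
      ← Finset.sum_filter (fun x => x ∈ W)]
    have h1 : (∑ x : Cube n, if (lookupLabel x D).isSome then (1 : ℝ) else 0) ≤ D.length := by
      rw [← Finset.sum_filter, Finset.sum_const, nsmul_eq_mul, mul_one]
      exact_mod_cast card_isSome_lookupLabel_le D
    have h2 : Finset.univ.filter (fun x => x ∈ W) = W := by ext; simp
    rw [h2]
    simp only [mistakes]
    linarith
  have hcheb : ∀ r, (if err h (labels f A D r) ≤ err c (labels f A D r) + ε then (1 : ℝ) else 0) ≤
      1 / (γ * N) ^ 2 * (∑ x ∈ W, s x * sgn (r x)) ^ 2 := by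
    intro r
    split_ifs with hr
    · have h1 := hlb r
      have h2 : (err h (labels f A D r) - err c (labels f A D r)) * N ≤ ε * N :=
        mul_le_mul_of_nonneg_right (by linarith) hN0.le
      -- Of the surplus `2 * γ * N` beyond the tolerance, labelled points can cancel at most `γ *
      -- N`; the coins must cancel the rest.
      have h3 : ∑ x ∈ W, s x * sgn (r x) ≤ -(γ * N) := by linarith
      have h4 : 0 < γ * N := mul_pos hγ hN0
      rw [one_div, ← div_eq_inv_mul, le_div_iff₀ (by positivity)]
      nlinarith
    · positivity
  refine (avg_mono hcheb).trans ?_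
  rw [avg_mul_left]
  calc 1 / (γ * N) ^ 2 * avg (fun r : Cube n → Bool => (∑ x ∈ W, s x * sgn (r x)) ^ 2) ≤
        1 / (γ * N) ^ 2 * N := by
        gcongr
        exact avg_sum_sq_le W s hs1
    _ = 1 / (γ ^ 2 * N) := by field_simp

/-- The final store determines the hypothesis, which is therefore fixed before the remaining coins
are averaged over. -/
theorem Evaluates.unique {E : Prog} {d : Data} {T : ℕ} {h h' : Cube n → Bool}
    (hh : Evaluates E d T h) (hh' : Evaluates E d T h') : h = h' := by
  funext x
  obtain ⟨c, hc⟩ := (runFor (fun _ : Cube n => false)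
    (start n E [d, Data.ofNat n, Data.ofPoint x]) T).support_nonempty
  rw [← (hh.2 x c hc).2, (hh'.2 x c hc).2]

/-- The simulated runs of a learner produce a hypothesis that is good on `A`. -/
theorem le_simExpect_of_learner {C : ConceptClass} {L E : Prog} {k T : ℕ} {ε δ γ : ℝ} {s0 : Store}
    {f A : Cube n → Bool} (hA : Sparse A k) (R : ℕ)
    (hobey : ∀ g : Cube n → Bool, Obeys (kLocal k) g ⟨[L], s0, []⟩)
    (hprob : ∀ g : Cube n → Bool, 1 - δ ≤ expect g (payoff fun s => ∃ h : Cube n → Bool,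
      Evaluates E (s 0) T h ∧ ∀ c ∈ C n, err h g ≤ err c g + ε) T [L] s0)
    (hγ : 0 < γ) (hT : (2 * T : ℝ) ≤ γ * Fintype.card (Cube n)) :
    1 - δ - 1 / (γ ^ 2 * Fintype.card (Cube n)) - T * ((n + 1) ^ k / (R + 1)) ≤
      simExpect f A k R (payoff fun s => ∃ h : Cube n → Bool, Evaluates E (s 0) T h ∧
        ∀ c ∈ C n, mistakes A h f ≤ mistakes A c f + (ε + 2 * γ) * Fintype.card (Cube n))
        T [L] s0 [] := by
  have hN0 : (0 : ℝ) < Fintype.card (Cube n) := by exact_mod_cast Fintype.card_pos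
  have hβ : 0 ≤ 1 / (γ ^ 2 * Fintype.card (Cube n)) := by positivity
  have key := avg_expect_le_simExpect (f := f) (R := R) hA
    (φ := fun g => payoff fun s => ∃ h : Cube n → Bool,
      Evaluates E (s 0) T h ∧ ∀ c ∈ C n, err h g ≤ err c g + ε)
    (fun g => payoff_le_one _)
    (Ψ := payoff fun s => ∃ h : Cube n → Bool, Evaluates E (s 0) T h ∧
        ∀ c ∈ C n, mistakes A h f ≤ mistakes A c f + (ε + 2 * γ) * Fintype.card (Cube n))
    (payoff_nonneg _) hβ (ℓ := 2 * T) (fun s D hD => ?_) T [L] s0 [] [] (by simp)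
    ⟨fun x b _ h => by simp [lookupLabel] at h, fun x hx => by simp at hx⟩ fun r => hobey _
  · have := (le_avg fun r => hprob (labels f A [] r)).trans key
    linarith
  · set P := ∃ h : Cube n → Bool, Evaluates E (s 0) T h ∧
        ∀ c ∈ C n, mistakes A h f ≤ mistakes A c f + (ε + 2 * γ) * Fintype.card (Cube n)
      with hP
    by_cases hgood : P
    · rw [payoff_of (P := fun s => ∃ h : Cube n → Bool, Evaluates E (s 0) T h ∧
        ∀ c ∈ C n, mistakes A h f ≤ mistakes A c f + (ε + 2 * γ) * Fintype.card (Cube n)) hgood]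
      have := avg_le fun r => payoff_le_one (fun s => ∃ h : Cube n → Bool,
        Evaluates E (s 0) T h ∧ ∀ c ∈ C n, err h (labels f A D r) ≤
          err c (labels f A D r) + ε) s
      linarith
    · refine le_trans ?_ (le_add_of_nonneg_left (payoff_nonneg _ _))
      by_cases hev : ∃ h : Cube n → Bool, Evaluates E (s 0) T h
      · obtain ⟨h, hh⟩ := hev
        -- Failure on `A` is witnessed by one concept that does not depend on the remaining coins.
        -- So no union bound over the class is needed, and its size is irrelevant.
        have : ∃ c ∈ C n, mistakes A c f + (ε + 2 * γ) * Fintype.card (Cube n) <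
            mistakes A h f := by
          by_contra hno
          push Not at hno
          exact hgood ⟨h, hh, hno⟩
        obtain ⟨c, hc, hlt⟩ := this
        refine le_trans (avg_mono fun r => ?_) (avg_payoff_err_le (D := D) hγ
          (le_trans (by exact_mod_cast hD) hT) hlt)
        unfold payoff
        split_ifs with h1 h2
        · exact le_rfl
        · obtain ⟨h', hh', hle⟩ := h1
          rw [hh.unique hh'] at h2
          exact absurd (hle c hc) h2
        · exact zero_le_one
        · exact le_rfl
      · refine le_trans (avg_le fun r => ?_) hβ
        rw [payoff, if_neg]
        rintro ⟨h, hh, -⟩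
        exact hev ⟨h, hh⟩

end fluctuation

/-! ### Variables -/

/-- All variables of an expression are smaller than this bound. -/
def Expr.bound : Expr → ℕ
  | .var v => v + 1
  | .nil => 0
  | .cons e e' => max e.bound e'.bound
  | .head e => e.bound
  | .tail e => e.bound

/-- All variables of a program are smaller than this bound. -/
def Prog.bound : Prog → ℕ
  | .assign v e => max (v + 1) e.bound
  | .seq p q => max p.bound q.bound
  | .cond e p q => max e.bound (max p.bound q.bound)
  | .loop e p => max e.bound p.bound
  | .flip v => v + 1
  | .draw v => v + 1
  | .query v => v + 1

theorem Expr.eval_congr {V : ℕ} {s s' : Store} (h : ∀ v < V, s v = s' v) (e : Expr)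
    (he : e.bound ≤ V) : e.eval s = e.eval s' := by
  induction e with
  | var v => exact h v he
  | nil => rfl
  | cons e e' ih ih' =>
    have := max_le_iff.mp he
    rw [Expr.eval, Expr.eval, ih this.1, ih' this.2]
  | head e ih => rw [Expr.eval, Expr.eval, ih he]
  | tail e ih => rw [Expr.eval, Expr.eval, ih he]

theorem update_congr {V v : ℕ} {s s' : Store} (h : ∀ v < V, s v = s' v) (d : Data) :
    ∀ x < V, Function.update s v d x = Function.update s' v d x := by
  intro x hx
  rcases eq_or_ne x v with rfl | hne
  · simp
  · rw [Function.update_of_ne hne, Function.update_of_ne hne, h x hx]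

/-- A run of a program is described by the value of the program, and depends only on the values of
its variables. -/
theorem expect_le_stackVal {n : ℕ} {f : Cube n → Bool} {V : ℕ} {Φ K : Store → ℝ}
    (hK0 : ∀ s, 0 ≤ K s) (hK : ∀ s s', (∀ v < V, s v = s' v) → Φ s ≤ K s') (t : ℕ) {W : ℕ}
    (hW : t ≤ W) (todo : List Prog) (htodo : ∀ p ∈ todo, p.bound ≤ V) (s s' : Store)
    (hs : ∀ v < V, s v = s' v) : expect f Φ t todo s ≤ stackVal W f todo K s' := by
  induction t generalizing W todo s s' with
  | zero =>
    rcases todo with _ | ⟨p, r⟩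
    · exact hK _ _ hs
    · exact stackVal_nonneg hK0 _ _
  | succ t ih =>
    obtain ⟨W, rfl⟩ : ∃ W', W = W' + 1 := ⟨W - 1, by omega⟩
    have hW' : t ≤ W + 1 := by omega
    rcases todo with _ | ⟨p, r⟩
    · exact hK _ _ hs
    · rw [List.forall_mem_cons] at htodo
      obtain ⟨hp, hr⟩ := htodo
      cases p with
      | assign v e =>
        have he := (max_le_iff.mp hp).2
        rw [stackVal_cons, val_assign, ← Expr.eval_congr hs e he]
        exact ih hW' r hr _ _ (update_congr hs _)
      | seq p q =>
        obtain ⟨h1, h2⟩ := max_le_iff.mp hp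
        exact ih hW' (p :: q :: r) (by simp [h1, h2]; exact hr) _ _ hs
      | cond e p q =>
        obtain ⟨h1, h2⟩ := max_le_iff.mp hp
        obtain ⟨h3, h4⟩ := max_le_iff.mp h2
        rw [stackVal_cons, val_cond, expect, Expr.eval_congr hs e h1]
        split_ifs
        · exact ih hW' (p :: r) (by simp [h3]; exact hr) _ _ hs
        · exact ih hW' (q :: r) (by simp [h4]; exact hr) _ _ hs
      | loop e p =>
        obtain ⟨h1, h2⟩ := max_le_iff.mp hp
        rw [expect, Expr.eval_congr hs e h1]
        refine (ih (W := W) (by omega) _ ?_ s s' hs).trans (stackVal_loop_le hK0 e p r s')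
        split_ifs
        · simp only [List.forall_mem_cons]
          exact ⟨h2, hp, hr⟩
        · exact hr
      | flip v => exact avg_mono fun b => ih hW' r hr _ _ (update_congr hs _)
      | draw v => exact avg_mono fun b => ih hW' r hr _ _ (update_congr hs _)
      | query v =>
        rw [stackVal_cons, expect, hs v hp]
        exact ih hW' r hr _ _ (update_congr hs _)

/-! ### The simulation -/

section simulation

open LocalQueries.Expr (var)

/-- The label of the point in variable `V + 7` is stored in variable `V + 8`. -/
def labelProg (V l : ℕ) : Prog :=
  .seq (.assign (V + 8) (.cons (var (V + 3)) (var (V + 7)))) (.seq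
    ((lookupFn l).compile V (V + 8)) (.cond (var (V + 8))
      (.assign (V + 8) (.head (var (V + 8))))
      (.seq (.flip (V + 8))
        (.assign (V + 3) (.cons (.cons (var (V + 7)) (var (V + 8))) (var (V + 3)))))))

/-- The simulation of a query. -/
def queryProg (V l v : ℕ) : Prog :=
  .seq (.assign (V + 7) (.cons (var (V + 1)) (.cons (var v) (.cons .nil .nil)))) (.seq
    (xorFn.compile V (V + 7)) (.seq (labelProg V l) (.assign v (var (V + 8)))))

/-- Draw examples until one of the current colour is found, at most `u ^ ρ` times. -/
def searchProg (V c e d ρ : ℕ) : Prog :=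
  .seq (.assign (V + 9) .nil) (.seq (.assign (V + 10) .nil) (.seq
    ((incFn ρ).compile V (V + 10)) (.loop (var (V + 10))
      (.seq (.assign (V + 10) (.tail (var (V + 10)))) (.seq (.draw (V + 11)) (.seq
        (.assign (V + 12) (.cons (.head (var (V + 11))) (.cons (var (V + 1)) (var (V + 2)))))
        (.seq ((testFn c e d).compile V (V + 12)) (.cond (var (V + 12))
          (.seq (.assign (V + 9) (var (V + 11))) (.assign (V + 10) .nil))
          (.assign (V + 9) .nil)))))))))

/-- Record the labeled example in variable `V + 9` and add its point to the points in the variables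
`V + 7` and `V + 8`. -/
def recordProg (V l : ℕ) : Prog :=
  .seq (.assign (V + 11) (.cons (var (V + 3)) (.head (var (V + 9))))) (.seq
    ((lookupFn l).compile V (V + 11)) (.seq
      (.cond (var (V + 11)) (.assign (V + 11) .nil)
        (.assign (V + 3) (.cons (var (V + 9)) (var (V + 3))))) (.seq
      (.assign (V + 7) (.cons (var (V + 1)) (.cons (var (V + 7)) (.cons (.head (var (V + 8)))
        (.head (var (V + 9))))))) (xorFn.compile V (V + 7)))))

/-- The simulation of a random example. -/
def drawProg (V c e d k ρ l v : ℕ) : Prog :=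
  .seq (.draw (V + 7)) (.seq (.assign (V + 7) (.head (var (V + 7)))) (.seq
    (.assign (V + 8) (.cons (var (V + 7)) (.cons (var (V + 1)) (var (V + 2))))) (.seq
    ((nearFn c e d k).compile V (V + 8)) (.seq
    (.cond (var (V + 8))
      (.seq (searchProg V c e d ρ) (.cond (var (V + 9)) (recordProg V l) (.assign (V + 9) .nil)))
      (.assign (V + 8) .nil)) (.seq
    (labelProg V l) (.assign v (.cons (var (V + 7)) (var (V + 8)))))))))

/-- The program with examples and queries replaced by their simulations. -/
def Prog.simulate (V c e d k ρ l : ℕ) : Prog → Prog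
  | .assign v e => .assign v e
  | .seq p q => .seq (p.simulate V c e d k ρ l) (q.simulate V c e d k ρ l)
  | .cond e' p q => .cond e' (p.simulate V c e d k ρ l) (q.simulate V c e d k ρ l)
  | .loop e' p => .loop e' (p.simulate V c e d k ρ l)
  | .flip v => .flip v
  | .draw v => drawProg V c e d k ρ l v
  | .query v => queryProg V l v

/-- The store of a simulation: the variables below `V` belong to the simulated program, the next
ones hold the number of iterations, the dimension, the colour, the list of labels, and two
values that are kept. -/
structure SimStore (V u n a : ℕ) (o τ : Data) (D : Memo n) (s₀ s : Store) : Prop where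
  low : ∀ v < V, s v = s₀ v
  driver : s V = Data.ofNat u
  dim : s (V + 1) = Data.ofNat n
  col : s (V + 2) = Data.ofNat a
  memo : s (V + 3) = Data.ofTable D
  out : s (V + 4) = o
  tab : s (V + 5) = τ

section
variable {V u n a c e d k ρ l W : ℕ} {o τ : Data} {D : Memo n} {s₀ s s' : Store}
  {f : Cube n → Bool}

theorem SimStore.congr (h : SimStore V u n a o τ D s₀ s) (h' : ∀ v < V + 7, s' v = s v) :
    SimStore V u n a o τ D s₀ s' := by
  constructor
  · intro v hv; rw [h' v (by omega), h.low v hv]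
  all_goals rw [h' _ (by omega)]
  exacts [h.driver, h.dim, h.col, h.memo, h.out, h.tab]

theorem SimStore.update_high (h : SimStore V u n a o τ D s₀ s) {v : ℕ} (hv : V + 7 ≤ v)
    (x : Data) : SimStore V u n a o τ D s₀ (Function.update s v x) :=
  h.congr fun _ hw => Function.update_of_ne (by omega) _ _

theorem SimStore.update_low (h : SimStore V u n a o τ D s₀ s) {v : ℕ} (hv : v < V) (x : Data) :
    SimStore V u n a o τ D (Function.update s₀ v x) (Function.update s v x) := by
  constructor
  · exact update_congr h.low x
  all_goals rw [Function.update_of_ne (by omega)]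
  exacts [h.driver, h.dim, h.col, h.memo, h.out, h.tab]

theorem SimStore.update_memo (h : SimStore V u n a o τ D s₀ s) (D' : Memo n) :
    SimStore V u n a o τ D' s₀ (Function.update s (V + 3) (Data.ofTable D')) := by
  constructor
  · intro v hv; rw [Function.update_of_ne (by omega), h.low v hv]
  · rw [Function.update_of_ne (by omega), h.driver]
  · rw [Function.update_of_ne (by omega), h.dim]
  · rw [Function.update_of_ne (by omega), h.col]
  · simp
  · rw [Function.update_of_ne (by omega), h.out]
  · rw [Function.update_of_ne (by omega), h.tab]

theorem memoVal_le_val_labelProg {K : Store → ℝ} {κ : Bool → Memo n → ℝ} {x : Cube n}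
    (hn : n ≤ u) (huW : u < W) (hl : D.length ≤ u ^ l) (hs : SimStore V u n a o τ D s₀ s)
    (hx : s (V + 7) = Data.ofPoint x)
    (hK : ∀ b D' s', D'.length ≤ D.length + 1 → SimStore V u n a o τ D' s₀ s' →
      s' (V + 7) = Data.ofPoint x → s' (V + 8) = Data.ofBool b → κ b D' ≤ K s') :
    memoVal D x κ ≤ (labelProg V l).val W f K s := by
  simp only [labelProg, val_seq, val_assign]
  refine le_val_compile (u := u) _ (by omega) ?_ huW fun s1 h1 h2 => ?_
  · rw [Function.update_of_ne (by omega), hs.driver]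
  have hs1 : SimStore V u n a o τ D s₀ s1 :=
    (hs.update_high (by omega) _).congr fun v hv => h2 v (by omega)
  have hx1 : s1 (V + 7) = Data.ofPoint x := by
    rw [h2 _ (by omega), Function.update_of_ne (by omega), hx]
  rw [Function.update_self] at h1
  simp only [Expr.eval, hs.memo, hx, eval_lookupFn hn D hl x] at h1
  rw [val_cond, memoVal]
  simp only [Expr.eval, h1]
  rcases hlx : lookupLabel x D with _ | b
  · simp only [Data.ofLabel, Data.isPair, Bool.false_eq_true, if_false, Option.elim_none]
    rw [val_seq, val_flip]
    refine avg_mono fun b => ?_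
    rw [val_assign]
    have h8 := hs1.update_high (v := V + 8) (by omega) (Data.ofBool b)
    have he : Expr.eval (Function.update s1 (V + 8) (Data.ofBool b))
        (.cons (.cons (var (V + 7)) (var (V + 8))) (var (V + 3))) =
        Data.ofTable ((x, b) :: D) := by
      simp only [Expr.eval, h8.memo, Function.update_self]
      rw [Function.update_of_ne (by omega), hx1]
      rfl
    rw [he]
    refine hK b _ _ (by simp) (h8.update_memo _) ?_ ?_
    · rw [Function.update_of_ne (by omega), Function.update_of_ne (by omega), hx1]
    · rw [Function.update_of_ne (by omega), Function.update_self]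
  · simp only [Data.ofLabel, Data.isPair, if_true, Option.elim_some]
    rw [val_assign]
    refine hK b D _ (by omega) (hs1.update_high (by omega) _) ?_ ?_
    · rw [Function.update_of_ne (by omega), hx1]
    · rw [Function.update_self]
      simp only [Expr.eval, h1, hlx, Data.head, Data.ofLabel]

/-- Adding two zero vectors brings the queried point into canonical form, as the table lookup
requires. -/
theorem le_val_queryProg {K : Store → ℝ} {κ : Bool → Memo n → ℝ} {v : ℕ} (hv : v < V)
    (hn : n ≤ u) (huW : u < W) (hl : D.length ≤ u ^ l) (hs : SimStore V u n a o τ D s₀ s)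
    (hK : ∀ b D' s', D'.length ≤ D.length + 1 →
      SimStore V u n a o τ D' (Function.update s₀ v (Data.ofBool b)) s' → κ b D' ≤ K s') :
    memoVal D (Data.toPoint n (s₀ v)) κ ≤ (queryProg V l v).val W f K s := by
  simp only [queryProg, val_seq, val_assign]
  refine le_val_compile (u := u) _ (by omega) ?_ huW fun s1 h1 h2 => ?_
  · rw [Function.update_of_ne (by omega), hs.driver]
  have hs1 : SimStore V u n a o τ D s₀ s1 :=
    (hs.update_high le_rfl _).congr fun v hv => h2 v (by omega)
  rw [Function.update_self] at h1
  simp only [Expr.eval, hs.dim, eval_xorFn hn, Data.toPoint_nil, hs.low v hv] at h1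
  refine memoVal_le_val_labelProg (x := Data.toPoint n (s₀ v)) hn huW hl hs1 ?_
    fun b D' s' hD' hs' _ hb => ?_
  · rw [h1]; congr 1; funext i; simp [bitXor]
  · rw [val_assign]
    simp only [Expr.eval, hb]
    exact hK b D' _ hD' (hs'.update_low hv _)

theorem pick_le_val_searchProg {K : Store → ℝ} {κ : Option (Cube n) → ℝ}
    (hcol : ColorBound u c e d n) (huW : u < W) (hρ : u ^ ρ < W)
    (hs : SimStore V u n a o τ D s₀ s)
    (hK : ∀ (z : Option (Cube n)) s', SimStore V u n a o τ D s₀ s' → s' (V + 7) = s (V + 7) →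
      s' (V + 8) = s (V + 8) →
      s' (V + 9) = z.elim .nil (fun z => Data.ofExample (z, f z)) → κ z ≤ K s') :
    pick (fun y => decide (color u e d y = a)) κ (u ^ ρ) ≤
      (searchProg V c e d ρ).val W f K s := by
  set A : Cube n → Bool := fun y => decide (color u e d y = a) with hA
  simp only [searchProg, val_seq, val_assign]
  refine le_val_compile (u := u) _ (by omega) ?_ huW fun s1 h1 h2 => ?_
  · rw [Function.update_of_ne (by omega), Function.update_of_ne (by omega), hs.driver]
  have hs1 : SimStore V u n a o τ D s₀ s1 := ((hs.update_high (v := V + 9) (by omega) _).update_high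
    (v := V + 10) (by omega) _).congr fun v hv => h2 v (by omega)
  have h7 : s1 (V + 7) = s (V + 7) := by
    rw [h2 _ (by omega), Function.update_of_ne (by omega), Function.update_of_ne (by omega)]
  have h8 : s1 (V + 8) = s (V + 8) := by
    rw [h2 _ (by omega), Function.update_of_ne (by omega), Function.update_of_ne (by omega)]
  have h9 : s1 (V + 9) = .nil := by
    rw [h2 _ (by omega), Function.update_of_ne (by omega), Function.update_self]; rfl
  rw [Function.update_self] at h1
  simp only [Expr.eval] at h1
  rw [← Data.ofNat_zero, eval_incFn, add_zero] at h1
  rw [val_loop]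
  clear h2
  -- one test of the loop
  generalize hm : u ^ ρ = R at h1 hρ
  clear hm
  have main : ∀ R m s1, R < m → SimStore V u n a o τ D s₀ s1 → s1 (V + 7) = s (V + 7) →
      s1 (V + 8) = s (V + 8) → s1 (V + 9) = .nil → s1 (V + 10) = Data.ofNat R →
      pick A κ R ≤ loopVal W f (var (V + 10))
      (.seq (.assign (V + 10) (.tail (var (V + 10)))) (.seq (.draw (V + 11)) (.seq
        (.assign (V + 12) (.cons (.head (var (V + 11))) (.cons (var (V + 1)) (var (V + 2)))))
        (.seq ((testFn c e d).compile V (V + 12)) (.cond (var (V + 12))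
          (.seq (.assign (V + 9) (var (V + 11))) (.assign (V + 10) .nil))
          (.assign (V + 9) .nil)))))) K m s1 := by
    intro R
    induction R with
    | zero =>
      rintro (_ | m) s1 hm hs1 h7 h8 h9 h10
      · omega
      · simp only [loopVal, Expr.eval, h10, Data.ofNat_zero, Data.isPair, Bool.false_eq_true,
          if_false, pick]
        exact hK none _ hs1 h7 h8 h9
    | succ R ih =>
      rintro (_ | m) s1 hm hs1 h7 h8 h9 h10
      · omega
      · simp only [loopVal, Expr.eval, h10, Data.ofNat_succ, Data.isPair, if_true, pick]
        rw [val_seq, val_assign, val_seq, val_draw]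
        refine avg_mono fun w => ?_
        rw [val_seq, val_assign, val_seq]
        simp only [Expr.eval, h10, Data.ofNat_succ, Data.tail, Function.update_self, Data.head]
        set s2 := Function.update (Function.update s1 (V + 10) (Data.ofNat R)) (V + 11)
          (Data.cons (Data.ofPoint w) (Data.ofBool (f w))) with hs2
        have hr2 : SimStore V u n a o τ D s₀ s2 :=
          (hs1.update_high (by omega) _).update_high (by omega) _
        refine le_val_compile (u := u) _ (by omega) ?_ huW fun s3 h31 h32 => ?_
        · rw [Function.update_of_ne (by omega), hr2.driver]
        have hr3 : SimStore V u n a o τ D s₀ s3 :=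
          (hr2.update_high (v := V + 12) (by omega) _).congr fun v hv => h32 v (by omega)
        have h32' : ∀ v < V + 12, s3 v = s2 v := fun v hv => by
          rw [h32 v hv, Function.update_of_ne (by omega)]
        rw [Function.update_self, hr2.dim, hr2.col, eval_testFn hcol] at h31
        have h37 : s3 (V + 7) = s (V + 7) := by
          rw [h32' _ (by omega), hs2, Function.update_of_ne (by omega),
            Function.update_of_ne (by omega), h7]
        have h38 : s3 (V + 8) = s (V + 8) := by
          rw [h32' _ (by omega), hs2, Function.update_of_ne (by omega),
            Function.update_of_ne (by omega), h8]
        have h310 : s3 (V + 10) = Data.ofNat R := by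
          rw [h32' _ (by omega), hs2, Function.update_of_ne (by omega), Function.update_self]
        have h311 : s3 (V + 11) = Data.cons (Data.ofPoint w) (Data.ofBool (f w)) := by
          rw [h32' _ (by omega), hs2, Function.update_self]
        rw [val_cond]
        simp only [Expr.eval, h31]
        by_cases hw : color u e d w = a
        · simp only [hA, hw, decide_true, if_true, Data.ofBool, Data.isPair]
          rw [val_seq, val_assign, val_assign]
          simp only [Expr.eval, h311]
          -- Success clears the counter, and one further test is needed to leave the loop.
          obtain ⟨m, rfl⟩ : ∃ m', m = m' + 1 := ⟨m - 1, by omega⟩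
          simp only [loopVal, Expr.eval, Function.update_self, Data.isPair, Bool.false_eq_true,
            if_false]
          refine hK (some w) _ ((hr3.update_high (by omega) _).update_high (by omega) _) ?_ ?_ ?_
          · rw [Function.update_of_ne (by omega), Function.update_of_ne (by omega), h37]
          · rw [Function.update_of_ne (by omega), Function.update_of_ne (by omega), h38]
          · rw [Function.update_of_ne (by omega), Function.update_self]; rfl
        · simp only [hA, hw, decide_false, Bool.false_eq_true, if_false, Data.ofBool, Data.isPair]
          rw [val_assign]
          refine ih m _ (by omega) (hr3.update_high (by omega) _) ?_ ?_ ?_ ?_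
          · rw [Function.update_of_ne (by omega), h37]
          · rw [Function.update_of_ne (by omega), h38]
          · rw [Function.update_self]; rfl
          · rw [Function.update_of_ne (by omega), h310]
  exact main R W s1 hρ hs1 h7 h8 h9 h1

theorem le_val_recordProg {K : Store → ℝ} {v : ℝ} {x y z : Cube n} {b : Bool}
    (hn : n ≤ u) (huW : u < W) (hl : D.length ≤ u ^ l) (hs : SimStore V u n a o τ D s₀ s)
    (hx : s (V + 7) = Data.ofPoint x) (hy : s (V + 8) = .cons (Data.ofPoint y) .nil)
    (hz : s (V + 9) = Data.ofExample (z, b))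
    (hK : ∀ s', SimStore V u n a o τ (insertLabel D (z, b)) s₀ s' →
      s' (V + 7) = Data.ofPoint (bitXor (bitXor x y) z) → v ≤ K s') :
    v ≤ (recordProg V l).val W f K s := by
  simp only [recordProg, val_seq, val_assign]
  refine le_val_compile (u := u) _ (by omega) ?_ huW fun s1 h1 h2 => ?_
  · rw [Function.update_of_ne (by omega), hs.driver]
  have hs1 : SimStore V u n a o τ D s₀ s1 := (hs.update_high (v := V + 11) (by omega) _).congr
    fun v hv => h2 v (by omega)
  have h2' : ∀ v < V + 11, s1 v = s v := fun v hv => by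
    rw [h2 v hv, Function.update_of_ne (by omega)]
  rw [Function.update_self] at h1
  simp only [Expr.eval, hs.memo, hz, Data.ofExample, Data.head, eval_lookupFn hn D hl z] at h1
  have hend : ∀ s2, SimStore V u n a o τ (insertLabel D (z, b)) s₀ s2 →
      s2 (V + 7) = Data.ofPoint x → s2 (V + 8) = .cons (Data.ofPoint y) .nil →
      s2 (V + 9) = Data.ofExample (z, b) → v ≤ (Prog.val W f (xorFn.compile V (V + 7)) K)
        (Function.update s2 (V + 7) (Expr.eval s2 (.cons (var (V + 1)) (.cons (var (V + 7))
          (.cons (.head (var (V + 8))) (.head (var (V + 9)))))))) := by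
    intro s2 hs2 hx2 hy2 hz2
    refine le_val_compile (u := u) _ (by omega) ?_ huW fun s3 h31 h32 => ?_
    · rw [Function.update_of_ne (by omega), hs2.driver]
    · refine hK s3 ((hs2.update_high le_rfl _).congr fun v hv => h32 v (by omega)) ?_
      rw [h31, Function.update_self]
      simp only [Expr.eval, hs2.dim, hx2, hy2, hz2, Data.ofExample, Data.head, eval_xorFn hn,
        Data.toPoint_ofPoint]
  rw [val_seq, val_cond]
  simp only [Expr.eval, h1, val_assign, val_seq]
  rcases hlz : lookupLabel z D with _ | b'
  · simp only [Data.ofLabel, Data.isPair, Bool.false_eq_true, if_false]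
    have hins : insertLabel D (z, b) = (z, b) :: D := by simp [insertLabel, hlz]
    have hd : Data.cons (s1 (V + 9)) (s1 (V + 3)) = Data.ofTable (insertLabel D (z, b)) := by
      rw [hins, h2' _ (by omega), hz, hs1.memo]; rfl
    rw [hd]
    refine hend _ (hs1.update_memo _) ?_ ?_ ?_
    · rw [Function.update_of_ne (by omega), h2' _ (by omega), hx]
    · rw [Function.update_of_ne (by omega), h2' _ (by omega), hy]
    · rw [Function.update_of_ne (by omega), h2' _ (by omega), hz]
  · simp only [Data.ofLabel, Data.isPair, if_true]
    have hins : insertLabel D (z, b) = D := by simp [insertLabel, hlz]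
    refine hend _ (by rw [hins]; exact hs1.update_high (by omega) _) ?_ ?_ ?_
    · rw [Function.update_of_ne (by omega), h2' _ (by omega), hx]
    · rw [Function.update_of_ne (by omega), h2' _ (by omega), hy]
    · rw [Function.update_of_ne (by omega), h2' _ (by omega), hz]

theorem drawVal_le_val_drawProg {K : Store → ℝ} {κ : Cube n → Bool → Memo n → ℝ} {v : ℕ}
    (hv : v < V) (hcol : ColorBound u c e d n) (huW : u < W) (hρ : u ^ ρ < W)
    (hl : D.length + 1 ≤ u ^ l) (hs : SimStore V u n a o τ D s₀ s)
    (hK : ∀ x b D' s', D'.length ≤ D.length + 2 → SimStore V u n a o τ D'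
      (Function.update s₀ v (.cons (Data.ofPoint x) (Data.ofBool b))) s' → κ x b D' ≤ K s') :
    drawVal f (fun y => decide (color u e d y = a)) k (u ^ ρ) D κ ≤
      (drawProg V c e d k ρ l v).val W f K s := by
  have hn := hcol.dim_le
  simp only [drawProg, val_seq, val_assign, val_draw]
  refine avg_mono fun x => ?_
  simp only [Expr.eval, Function.update_self, Data.head]
  refine le_val_compile (u := u) _ (by omega) ?_ huW fun s1 h1 h2 => ?_
  · rw [Function.update_of_ne (by omega), Function.update_of_ne (by omega),
      Function.update_of_ne (by omega), hs.driver]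
  have hs1 : SimStore V u n a o τ D s₀ s1 :=
    (((hs.update_high (v := V + 7) (by omega) _).update_high (v := V + 7) (by omega) _).update_high
      (v := V + 8) (by omega) _).congr fun v hv => h2 v (by omega)
  have hx1 : s1 (V + 7) = Data.ofPoint x := by
    rw [h2 _ (by omega), Function.update_of_ne (by omega), Function.update_self]
  have h1' : s1 (V + 8) =
      Data.ofNearest (nearest (fun y => decide (color u e d y = a)) k x) := by
    rw [h1, Function.update_self, ← eval_nearFn hcol a k x, ← hs.dim, ← hs.col]
    simp [Function.update]
  have hend : ∀ (x' : Cube n) (D' : Memo n) (s2 : Store), D'.length ≤ D.length + 1 →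
      SimStore V u n a o τ D' s₀ s2 → s2 (V + 7) = Data.ofPoint x' →
      memoVal D' x' (κ x') ≤ (labelProg V l).val W f
        (fun s => K (Function.update s v (Data.cons (s (V + 7)) (s (V + 8))))) s2 := by
    intro x' D' s2 hD' hs2 hx2
    refine memoVal_le_val_labelProg hn huW (by omega) hs2 hx2 fun b D'' s3 hD'' hs3 h7 h8 => ?_
    rw [h7, h8]
    exact hK x' b D'' _ (by omega) (hs3.update_low hv _)
  rw [val_seq, val_cond]
  simp only [Expr.eval, h1', val_assign, val_seq]
  rcases hnear : nearest (fun y => decide (color u e d y = a)) k x with _ | y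
  · simp only [Data.ofNearest, Data.isPair, Bool.false_eq_true, if_false, Option.elim_none]
    refine hend x D _ (by omega) (hs1.update_high (by omega) _) ?_
    rw [Function.update_of_ne (by omega), hx1]
  · simp only [Data.ofNearest, Data.isPair, if_true, Option.elim_some]
    refine pick_le_val_searchProg hcol huW hρ hs1 fun z s2 hs2 h7 h8 h9 => ?_
    rw [hx1] at h7
    rw [h1', hnear] at h8
    rw [val_cond]
    rcases z with _ | z
    · simp only [Option.elim_none] at h9 ⊢
      simp only [Expr.eval, h9, Data.isPair, Bool.false_eq_true, if_false, val_assign]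
      refine hend x D _ (by omega) (hs2.update_high (by omega) _) ?_
      rw [Function.update_of_ne (by omega), h7]
    · simp only [Option.elim_some] at h9 ⊢
      simp only [Expr.eval, h9, Data.ofExample, Data.isPair, if_true]
      exact le_val_recordProg hn huW (by omega) hs2 h7 h8 h9 fun s3 hs3 h37 =>
        hend _ _ s3 (length_insertLabel_le D _) hs3 h37

/-- The simulated runs are runs of the simulating program. -/
theorem simExpect_le_stackVal {Ψ K : Store → ℝ} (hcol : ColorBound u c e d n) {W₀ : ℕ}
    (huW : u < W₀) (hρ : u ^ ρ < W₀) (hK0 : ∀ s, 0 ≤ K s)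
    (hK : ∀ s₀ D s, SimStore V u n a o τ D s₀ s → Ψ s₀ ≤ K s) (t : ℕ) {W : ℕ}
    (hW : W₀ + t ≤ W) (todo : List Prog) (htodo : ∀ p ∈ todo, p.bound ≤ V) (s₀ s : Store)
    (D : Memo n) (hD : D.length + 2 * t ≤ u ^ l) (hs : SimStore V u n a o τ D s₀ s) :
    simExpect f (fun y => decide (color u e d y = a)) k (u ^ ρ) Ψ t todo s₀ D ≤
      stackVal W f (todo.map (Prog.simulate V c e d k ρ l)) K s := by
  induction t generalizing W todo s₀ s D with
  | zero =>
    rcases todo with _ | ⟨p, r⟩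
    · exact hK _ _ _ hs
    · exact stackVal_nonneg hK0 _ _
  | succ t ih =>
    -- A step of the simulated program makes at most one test of its own loops. The part `t` of the
    -- bound pays for these and shrinks with the time left, while `W₀` stays available for the
    -- subroutines.
    obtain ⟨W, rfl⟩ : ∃ W', W = W' + 1 := ⟨W - 1, by omega⟩
    have hW' : W₀ + t ≤ W + 1 := by omega
    have hD' : D.length + 2 * t ≤ u ^ l := by omega
    rcases todo with _ | ⟨p, r⟩
    · exact hK _ _ _ hs
    · rw [List.forall_mem_cons] at htodo
      obtain ⟨hp, hr⟩ := htodo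
      rw [List.map_cons]
      cases p with
      | assign v e' =>
        obtain ⟨hv, he⟩ := max_le_iff.mp hp
        rw [Prog.simulate, stackVal_cons, val_assign, Expr.eval_congr hs.low e' he]
        exact ih hW' r hr _ _ D hD' (hs.update_low hv _)
      | seq p q =>
        obtain ⟨h1, h2⟩ := max_le_iff.mp hp
        exact ih hW' (p :: q :: r) (by simp [h1, h2]; exact hr) _ _ D hD' hs
      | cond e' p q =>
        obtain ⟨h1, h2⟩ := max_le_iff.mp hp
        obtain ⟨h3, h4⟩ := max_le_iff.mp h2
        rw [Prog.simulate, stackVal_cons, val_cond, simExpect, Expr.eval_congr hs.low e' h1]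
        split_ifs
        · exact ih hW' (p :: r) (by simp [h3]; exact hr) _ _ D hD' hs
        · exact ih hW' (q :: r) (by simp [h4]; exact hr) _ _ D hD' hs
      | loop e' p =>
        obtain ⟨h1, h2⟩ := max_le_iff.mp hp
        rw [simExpect, ← Expr.eval_congr hs.low e' h1]
        refine le_trans ?_ (stackVal_loop_le hK0 e' (p.simulate V c e d k ρ l) _ s)
        have := ih (W := W) (by omega)
          (if (e'.eval s).isPair then p :: Prog.loop e' p :: r else r) ?_ s₀ s D hD' hs
        · refine this.trans (le_of_eq ?_)
          congr 1
          split_ifs <;> rfl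
        · split_ifs
          · simp only [List.forall_mem_cons]
            exact ⟨h2, hp, hr⟩
          · exact hr
      | flip v => exact avg_mono fun b => ih hW' r hr _ _ D hD' (hs.update_low hp _)
      | draw v =>
        rw [Prog.simulate, stackVal_cons, simExpect]
        exact drawVal_le_val_drawProg hp hcol (by omega) (by omega) (by omega) hs
          fun x b D' s' hl' hs' => ih hW' r hr _ _ D' (by omega) hs'
      | query v =>
        rw [Prog.simulate, stackVal_cons, simExpect]
        exact le_val_queryProg hp hcol.dim_le (by omega) (by omega) hs
          fun b D' s' hl' hs' => ih hW' r hr _ _ D' (by omega) hs'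

end

end simulation

/-! ### Programs without queries -/

/-- Programs that make no queries. -/
def Prog.QueryFree : Prog → Prop
  | .seq p q => p.QueryFree ∧ q.QueryFree
  | .cond _ p q => p.QueryFree ∧ q.QueryFree
  | .loop _ p => p.QueryFree
  | .query _ => False
  | _ => True

theorem Prog.Deterministic.queryFree {p : Prog} (h : p.Deterministic) : p.QueryFree := by
  induction p with
  | seq p q ihp ihq => exact ⟨ihp h.1, ihq h.2⟩
  | cond e p q ihp ihq => exact ⟨ihp h.1, ihq h.2⟩
  | loop e p ih => exact ih h
  | query v => exact h
  | _ => trivial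

theorem obeys_of_queryFree {n : ℕ} (rule : QueryRule) (f : Cube n → Bool) (c : Config n)
    (h : ∀ p ∈ c.todo, p.QueryFree) : Obeys rule f c := by
  intro t
  induction t generalizing c with
  | zero =>
    intro c' hc' v r hr
    obtain rfl : c' = c := by simpa [runFor] using hc'
    exact (h (.query v) (by simp [hr])).elim
  | succ t ih =>
    intro c'' hc''
    rw [runFor_succ, PMF.mem_support_bind_iff] at hc''
    obtain ⟨c', hc', hc''⟩ := hc''
    refine ih c' ?_ c'' hc''
    rcases c with ⟨_ | ⟨p, r⟩, s, S⟩
    · obtain rfl : c' = ⟨[], s, S⟩ := by simpa [step] using hc'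
      exact h
    · simp only [List.forall_mem_cons] at h
      obtain ⟨hp, hr⟩ := h
      cases p with
      | assign v e =>
        simp only [step, PMF.support_pure, Set.mem_singleton_iff] at hc'
        subst hc'; exact hr
      | seq p q =>
        simp only [step, PMF.support_pure, Set.mem_singleton_iff] at hc'
        subst hc'; simp only [List.forall_mem_cons]; exact ⟨hp.1, hp.2, hr⟩
      | cond e p q =>
        simp only [step, PMF.support_pure, Set.mem_singleton_iff] at hc'
        subst hc'; simp only [List.forall_mem_cons]
        refine ⟨?_, hr⟩
        split_ifs
        · exact hp.1
        · exact hp.2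
      | loop e p =>
        simp only [step, PMF.support_pure, Set.mem_singleton_iff] at hc'
        subst hc'
        dsimp only
        split_ifs
        · simp only [List.forall_mem_cons]; exact ⟨hp, hp, hr⟩
        · exact hr
      | flip v =>
        simp only [step, PMF.mem_support_bind_iff, PMF.support_pure, Set.mem_singleton_iff] at hc'
        obtain ⟨b, -, rfl⟩ := hc'; exact hr
      | draw v =>
        simp only [step, PMF.mem_support_bind_iff, PMF.support_pure, Set.mem_singleton_iff] at hc'
        obtain ⟨b, -, rfl⟩ := hc'; exact hr
      | query v => exact hp.elim

theorem Fn.compile_queryFree (w b : ℕ) (F : Fn) : (F.compile w b).QueryFree :=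
  (F.compile_deterministic w b).queryFree

theorem Prog.simulate_queryFree (V c e d k ρ l : ℕ) (p : Prog) :
    (p.simulate V c e d k ρ l).QueryFree := by
  induction p <;> simp_all [Prog.simulate, Prog.QueryFree, drawProg, queryProg, labelProg,
    searchProg, recordProg, Fn.compile_queryFree]

/-! ### The learner -/

section learner

open LocalQueries.Expr (var)

/-- Set the variables below `m` to `nil`. -/
def clearProg : ℕ → Prog
  | 0 => .assign 0 .nil
  | m + 1 => .seq (clearProg m) (.assign m .nil)

theorem clearProg_queryFree (m : ℕ) : (clearProg m).QueryFree := by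
  induction m <;> simp_all [clearProg, Prog.QueryFree]

theorem val_clearProg {n W : ℕ} {f : Cube n → Bool} (K : Store → ℝ) (s : Store) (m : ℕ) :
    (clearProg (m + 1)).val W f K s = K fun v => if v < m + 1 then .nil else s v := by
  induction m generalizing K with
  | zero =>
    simp only [clearProg, val_seq, val_assign, Function.update_idem]
    congr 1; funext v
    rcases Nat.eq_zero_or_pos v with rfl | hv
    · simp [Expr.eval]
    · rw [Function.update_of_ne (by omega), if_neg (by omega)]
  | succ m ih =>
    rw [clearProg, val_seq, ih, val_assign]
    congr 1; funext v
    by_cases hv : v = m + 1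
    · subst hv; simp [Expr.eval]
    · rw [Function.update_of_ne hv]
      congr 1
      simp only [eq_iff_iff]; omega

/-- Set variable `V` to the sum of the three inputs and two, and variable `V + 1` to the first
input. -/
def initProg (V : ℕ) : Prog :=
  .seq (.assign V (.cons .nil (.cons .nil .nil))) (.seq ((incFn 1).compile 0 V)
    (.seq ((incFn 1).compile 1 V) (.seq ((incFn 1).compile 2 V) (.assign (V + 1) (var 0)))))

theorem le_val_initProg {n V W a b c : ℕ} {f : Cube n → Bool} {K : Store → ℝ} {s : Store} {v : ℝ}
    (hV : 3 ≤ V) (ha : a < W) (hb : b < W) (hc : c < W) (h0 : s 0 = Data.ofNat a)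
    (h1 : s 1 = Data.ofNat b) (h2 : s 2 = Data.ofNat c)
    (hK : ∀ s', s' V = Data.ofNat (a + b + c + 2) → s' (V + 1) = Data.ofNat a → v ≤ K s') :
    v ≤ (initProg V).val W f K s := by
  simp only [initProg, val_seq, val_assign]
  set s0 := Function.update s V (Expr.eval s (.cons .nil (.cons .nil .nil))) with hs0
  have e0 : ∀ x < V, s0 x = s x := fun x hx => Function.update_of_ne (by omega) _ _
  have eV : s0 V = Data.ofNat 2 := by rw [hs0, Function.update_self]; rfl
  refine le_val_compile (u := a) _ (by omega) (by rw [e0 _ (by omega), h0]) ha fun s1 h11 h12 => ?_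
  refine le_val_compile (u := b) _ (by omega) (by rw [h12 _ (by omega), e0 _ (by omega), h1]) hb
    fun s2 h21 h22 => ?_
  refine le_val_compile (u := c) _ (by omega)
    (by rw [h22 _ (by omega), h12 _ (by omega), e0 _ (by omega), h2]) hc fun s3 h31 h32 => ?_
  rw [eV, eval_incFn] at h11
  rw [h11, eval_incFn] at h21
  rw [h21, eval_incFn] at h31
  refine hK _ ?_ ?_
  · rw [Function.update_of_ne (by omega), h31]
    congr 1; ring
  · rw [Function.update_self, Expr.eval, h32 _ (by omega), h22 _ (by omega), h12 _ (by omega),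
      e0 _ (by omega), h0]

/-- Collect `u ^ q` random examples in variable `V + 5`. -/
def tableProg (V q : ℕ) : Prog :=
  .seq (.assign (V + 5) .nil) (.seq (.assign (V + 6) .nil) (.seq ((incFn q).compile V (V + 6))
    (.loop (var (V + 6)) (.seq (.assign (V + 6) (.tail (var (V + 6)))) (.seq (.draw (V + 7))
      (.assign (V + 5) (.cons (var (V + 7)) (var (V + 5)))))))))

/-- The expectation of `F` at a list with `m` additional random points. -/
noncomputable def drawList {n : ℕ} (F : List (Cube n) → ℝ) : ℕ → List (Cube n) → ℝ
  | 0, xs => F xs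
  | m + 1, xs => avg fun x => drawList F m (x :: xs)

/-- The table of the labels of a list of points. -/
def labelTable {n : ℕ} (f : Cube n → Bool) (xs : List (Cube n)) : Memo n :=
  xs.map fun x => (x, f x)

theorem lookupLabel_labelTable {n : ℕ} (f : Cube n → Bool) (xs : List (Cube n)) (x : Cube n) :
    lookupLabel x (labelTable f xs) = if x ∈ xs then some (f x) else none := by
  induction xs with
  | nil => rfl
  | cons y xs ih =>
    rw [labelTable, List.map_cons, lookupLabel, ← labelTable, ih]
    by_cases h : x = y <;> simp [h]

theorem drawList_le_val_tableProg {n V W q u : ℕ} {f : Cube n → Bool} {K : Store → ℝ} {s : Store}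
    {F : List (Cube n) → ℝ} (huW : u < W) (hq : u ^ q < W) (h0 : s V = Data.ofNat u)
    (hK : ∀ xs s', xs.length = u ^ q → (∀ v < V + 5, s' v = s v) →
      s' (V + 5) = Data.ofTable (labelTable f xs) → F xs ≤ K s') :
    drawList F (u ^ q) [] ≤ (tableProg V q).val W f K s := by
  simp only [tableProg, val_seq, val_assign]
  refine le_val_compile (u := u) _ (by omega) ?_ huW fun s1 h1 h2 => ?_
  · rw [Function.update_of_ne (by omega), Function.update_of_ne (by omega), h0]
  rw [Function.update_self] at h1
  simp only [Expr.eval] at h1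
  rw [← Data.ofNat_zero, eval_incFn, add_zero] at h1
  have h5 : s1 (V + 5) = Data.ofTable (labelTable f []) := by
    rw [h2 _ (by omega), Function.update_of_ne (by omega), Function.update_self]; rfl
  have hlow : ∀ v < V + 5, s1 v = s v := fun v hv => by
    rw [h2 _ (by omega), Function.update_of_ne (by omega), Function.update_of_ne (by omega)]
  rw [val_loop]
  have main : ∀ i m (xs : List (Cube n)) s1, i < m → xs.length + i = u ^ q →
      (∀ v < V + 5, s1 v = s v) → s1 (V + 5) = Data.ofTable (labelTable f xs) →
      s1 (V + 6) = Data.ofNat i → drawList F i xs ≤ loopVal W f (var (V + 6))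
        (.seq (.assign (V + 6) (.tail (var (V + 6)))) (.seq (.draw (V + 7))
          (.assign (V + 5) (.cons (var (V + 7)) (var (V + 5)))))) K m s1 := by
    intro i
    induction i with
    | zero =>
      rintro (_ | m) xs s1 hm hxs hlow h5 h6
      · omega
      · simp only [loopVal, Expr.eval, h6, Data.ofNat_zero, Data.isPair, Bool.false_eq_true,
          if_false, drawList]
        exact hK xs s1 hxs hlow h5
    | succ i ih =>
      rintro (_ | m) xs s1 hm hxs hlow h5 h6
      · omega
      · simp only [loopVal, Expr.eval, h6, Data.ofNat_succ, Data.isPair, if_true, drawList]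
        rw [val_seq, val_assign, val_seq, val_draw]
        refine avg_mono fun x => ?_
        rw [val_assign]
        refine ih m (x :: xs) _ (by omega) (by simp; omega) ?_ ?_ ?_
        · intro v hv
          rw [Function.update_of_ne (by omega), Function.update_of_ne (by omega),
            Function.update_of_ne (by omega), hlow v hv]
        · rw [Function.update_self]
          simp only [Expr.eval]
          rw [Function.update_self, Function.update_of_ne (by omega),
            Function.update_of_ne (by omega), h5]
          rfl
        · rw [Function.update_of_ne (by omega), Function.update_of_ne (by omega),
            Function.update_self]
          simp only [Expr.eval, h6, Data.ofNat_succ, Data.tail]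
  exact main _ _ [] s1 hq (by simp) hlow h5 h1

/-- Run the simulation of `L` for the current colour. -/
def colorProg (V c e d k ρ l γ : ℕ) (L : Prog) : Prog :=
  .seq (.assign (V + 3) .nil) (.seq (.assign (V + 7) .nil) (.seq ((incFn γ).compile V (V + 7))
    (.seq (clearProg V) (.seq (.assign 0 (var (V + 1))) (.seq (.assign 1 (var (V + 7)))
      (.seq (.assign 2 (var (V + 7))) (.seq (L.simulate V c e d k ρ l)
        (.assign (V + 4) (.cons (var 0) (var (V + 4)))))))))))

/-- Run the simulation of `L` for all colours. -/
def colorsProg (V c e d k ρ l γ : ℕ) (L : Prog) : Prog :=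
  .seq (.assign (V + 4) .nil) (.seq (.assign (V + 7) .nil) (.seq ((incFn c).compile V (V + 7))
    (.seq (.assign (V + 2) (var (V + 7))) (.loop (var (V + 2)) (.seq
      (.assign (V + 2) (.tail (var (V + 2)))) (colorProg V c e d k ρ l γ L))))))

/-- The learner that uses random examples only. -/
def learnerProg (V c e d k ρ l γ : ℕ) (L : Prog) : Prog :=
  .seq (initProg V) (.seq (tableProg V l) (.seq (colorsProg V c e d k ρ l γ L)
    (.assign 0 (.cons (var V) (.cons (var (V + 5)) (var (V + 4)))))))

theorem learnerProg_queryFree (V c e d k ρ l γ : ℕ) (L : Prog) :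
    (learnerProg V c e d k ρ l γ L).QueryFree := by
  simp [learnerProg, initProg, tableProg, colorsProg, colorProg, Prog.QueryFree,
    Fn.compile_queryFree, clearProg_queryFree, Prog.simulate_queryFree]

/-- The initial store of the simulated learner. -/
def innerStore (n m : ℕ) : Store := fun v =>
  [Data.ofNat n, Data.ofNat m, Data.ofNat m].getD v .nil

variable {V u n a c e d k ρ l γ W W₀ T : ℕ} {f : Cube n → Bool} {L : Prog}

/-- The simulated learner succeeds with probability at least `p`, and whatever follows is then worth
at least `v`; unsuccessful runs are counted as zero. Clearing the variables below `V` gives each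
simulated run a fresh store. -/
theorem le_val_colorProg {K : Store → ℝ} {s : Store} {P : Data → Prop} {p v : ℝ} {o τ : Data}
    (hV : 3 ≤ V) (hL : L.bound ≤ V) (hcol : ColorBound u c e d n) (huW : u < W₀)
    (hρ : u ^ ρ < W₀) (hW : W₀ + T ≤ W) (hT : 2 * T ≤ u ^ l)
    (hp : p ≤ simExpect f (fun y => decide (color u e d y = a)) k (u ^ ρ)
      (payoff fun s => P (s 0)) T [L] (innerStore n (u ^ γ)) [])
    (hdrv : s V = Data.ofNat u) (hdim : s (V + 1) = Data.ofNat n) (ha : s (V + 2) = Data.ofNat a)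
    (ho : s (V + 4) = o) (hτ : s (V + 5) = τ) (hv : 0 ≤ v) (hK0 : ∀ s, 0 ≤ K s)
    (hK : ∀ d s', P d → s' V = Data.ofNat u → s' (V + 1) = Data.ofNat n →
      s' (V + 2) = Data.ofNat a → s' (V + 4) = .cons d o → s' (V + 5) = τ → v ≤ K s') :
    p * v ≤ (colorProg V c e d k ρ l γ L).val W f K s := by
  simp only [colorProg, val_seq, val_assign]
  refine le_val_compile (u := u) _ (by omega) ?_ (by omega) fun s1 h1 h2 => ?_
  · rw [Function.update_of_ne (by omega), Function.update_of_ne (by omega), hdrv]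
  rw [Function.update_self] at h1
  simp only [Expr.eval] at h1
  rw [← Data.ofNat_zero, eval_incFn, add_zero] at h1
  have h2' : ∀ v < V + 7, v ≠ V + 3 → s1 v = s v := fun v hv hne => by
    rw [h2 v hv, Function.update_of_ne (by omega), Function.update_of_ne hne]
  have h3 : s1 (V + 3) = .nil := by
    rw [h2 _ (by omega), Function.update_of_ne (by omega), Function.update_self]; rfl
  obtain ⟨V', rfl⟩ : ∃ V', V = V' + 1 := ⟨V - 1, by omega⟩
  rw [val_seq, val_clearProg, val_seq, val_assign, val_seq, val_assign, val_seq, val_assign, val_seq]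
  set V := V' + 1 with hVdef
  set s2 : Store := fun v => if v < V then .nil else s1 v with hs2
  have hs2' : ∀ v, V ≤ v → s2 v = s1 v := fun v hv => by rw [hs2]; exact if_neg (by omega)
  simp only [Expr.eval]
  rw [Function.update_of_ne (show V + 7 ≠ 0 by omega), hs2' (V + 1) (by omega),
    Function.update_of_ne (show V + 7 ≠ 1 by omega),
    Function.update_of_ne (show V + 7 ≠ 0 by omega), hs2' (V + 7) (by omega), h1,
    h2' (V + 1) (by omega) (by omega), hdim]
  have hhigh : ∀ v, V ≤ v → Function.update (Function.update (Function.update s2 0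
      (Data.ofNat n)) 1 (Data.ofNat (u ^ γ))) 2 (Data.ofNat (u ^ γ)) v = s1 v := fun v hv => by
    rw [Function.update_of_ne (by omega), Function.update_of_ne (by omega),
      Function.update_of_ne (by omega), hs2' v hv]
  have hsim : SimStore V u n a o τ [] (innerStore n (u ^ γ)) (Function.update (Function.update
      (Function.update s2 0 (Data.ofNat n)) 1 (Data.ofNat (u ^ γ))) 2 (Data.ofNat (u ^ γ))) := by
    constructor
    · intro v hv
      rcases v with _ | _ | _ | v
      · rfl
      · rfl
      · rfl
      · rw [Function.update_of_ne (by omega), Function.update_of_ne (by omega),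
          Function.update_of_ne (by omega), hs2]
        simp [hv, innerStore]
    all_goals rw [hhigh _ (by omega)]
    · rw [h2' _ (by omega) (by omega), hdrv]
    · rw [h2' _ (by omega) (by omega), hdim]
    · rw [h2' _ (by omega) (by omega), ha]
    · rw [h3]; rfl
    · rw [h2' _ (by omega) (by omega), ho]
    · rw [h2' _ (by omega) (by omega), hτ]
  refine le_trans ?_ (simExpect_le_stackVal (Ψ := fun s => v * payoff (fun s => P (s 0)) s) hcol
    huW hρ (fun s => hK0 _) (fun s₀ D s hs => ?_) T hW [L] (by simpa using hL) _ _ []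
    (by simpa using hT) hsim)
  · rw [simExpect_mul_left, mul_comm]
    exact mul_le_mul_of_nonneg_left hp hv
  · by_cases hP : P (s₀ 0)
    · rw [payoff_of (P := fun s : Store => P (s 0)) hP, mul_one]
      refine hK (s₀ 0) _ hP ?_ ?_ ?_ ?_ ?_
      · rw [Function.update_of_ne (by omega), hs.driver]
      · rw [Function.update_of_ne (by omega), hs.dim]
      · rw [Function.update_of_ne (by omega), hs.col]
      · rw [Function.update_self]
        simp only [Expr.eval, hs.out, hs.low 0 (by omega)]
      · rw [Function.update_of_ne (by omega), hs.tab]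
    · rw [payoff, if_neg hP, mul_zero]
      exact hK0 _

theorem le_val_colorsProg {K : Store → ℝ} {s : Store} {P : ℕ → Data → Prop} {p v : ℝ} {τ : Data}
    (hV : 3 ≤ V) (hL : L.bound ≤ V) (hcol : ColorBound u c e d n) (huW : u < W₀)
    (hρ : u ^ ρ < W₀) (hc : u ^ c < W₀) (hW : W₀ + T ≤ W) (hT : 2 * T ≤ u ^ l)
    (hp0 : 0 ≤ p)
    (hp : ∀ a, p ≤ simExpect f (fun y => decide (color u e d y = a)) k (u ^ ρ)
      (payoff fun s => P a (s 0)) T [L] (innerStore n (u ^ γ)) [])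
    (hdrv : s V = Data.ofNat u) (hdim : s (V + 1) = Data.ofNat n)
    (hτ : s (V + 5) = τ) (hv : 0 ≤ v) (hK0 : ∀ s, 0 ≤ K s)
    (hK : ∀ (ds : List Data) s', ds.length = u ^ c → (∀ j (hj : j < ds.length), P j ds[j]) →
      s' V = Data.ofNat u → s' (V + 4) = Data.ofList ds → s' (V + 5) = τ → v ≤ K s') :
    p ^ (u ^ c) * v ≤ (colorsProg V c e d k ρ l γ L).val W f K s := by
  simp only [colorsProg, val_seq, val_assign]
  refine le_val_compile (u := u) _ (by omega) ?_ (by omega) fun s1 h1 h2 => ?_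
  · rw [Function.update_of_ne (by omega), Function.update_of_ne (by omega), hdrv]
  rw [Function.update_self] at h1
  simp only [Expr.eval] at h1
  rw [← Data.ofNat_zero, eval_incFn, add_zero] at h1
  have hlow : ∀ v, v < V + 7 → v ≠ V + 4 → s1 v = s v := fun v hv h4 => by
    rw [h2 _ hv, Function.update_of_ne (by omega), Function.update_of_ne (by omega)]
  have h4 : s1 (V + 4) = .nil := by
    rw [h2 _ (by omega), Function.update_of_ne (by omega), Function.update_self]; rfl
  rw [val_seq, val_assign, val_loop]
  -- Colours are handled in decreasing order and outputs are put in front, so position `j` of the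
  -- list belongs to colour `i + j`, and in the end to colour `j`. The `i` colours still to come,
  -- each with fresh randomness, account for the factor `p ^ i`.
  refine le_loopVal (I := fun i s => s (V + 2) = Data.ofNat i ∧ s V = Data.ofNat u ∧
    s (V + 1) = Data.ofNat n ∧ s (V + 5) = τ ∧ ∃ ds : List Data, ds.length + i = u ^ c ∧
      s (V + 4) = Data.ofList ds ∧ ∀ j (hj : j < ds.length), P (i + j) ds[j])
    (v := fun i => p ^ i * v) (fun i s hs => hs.1) ?_ ?_ (show u ^ c < W by omega) ?_
  · rintro i s m ⟨hi, hdrv, hdim, hτ, ds, hlen, hds, hP⟩ ih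
    rw [val_seq, val_assign]
    simp only [Expr.eval, hi, Data.ofNat_succ, Data.tail]
    refine le_trans (le_of_eq (by ring)) (le_val_colorProg (v := p ^ i * v) hV hL hcol huW hρ hW hT
      (hp i) ?_ ?_ (Function.update_self ..) (o := Data.ofList ds) ?_ (τ := τ) ?_ (by positivity)
      (fun s => loopVal_nonneg hK0 _ _) ?_)
    iterate 4
      · rw [Function.update_of_ne (by omega)]
        assumption
    intro a s' ha h1 h2 h3 h4 h5
    refine ih s' ⟨h3, h1, h2, h5, a :: ds, by simp; omega, h4, fun j hj => ?_⟩
    rcases j with _ | j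
    · exact ha
    · have := hP j (by simpa using hj)
      rw [show i + (j + 1) = i + 1 + j by ring]
      exact this
  · rintro s ⟨hi, hdrv, hdim, hτ, ds, hlen, hds, hP⟩
    simp only [pow_zero, one_mul]
    exact hK ds s (by omega) (fun j hj => by simpa using hP j hj) hdrv hds hτ
  · refine ⟨by rw [Function.update_self]; exact h1, ?_, ?_, ?_, [], by simp, ?_, by simp⟩
    all_goals rw [Function.update_of_ne (by omega)]
    · rw [hlow _ (by omega) (by omega), hdrv]
    · rw [hlow _ (by omega) (by omega), hdim]
    · rw [hlow _ (by omega) (by omega), hτ]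
    · rw [h4]; rfl

theorem le_val_learnerProg {n₁ n₂ : ℕ} {K : Store → ℝ} {s : Store} {P : ℕ → Data → Prop}
    {F : List (Cube n) → ℝ} {p : ℝ}
    (hV : 3 ≤ V) (hL : L.bound ≤ V) (hu : u = n + n₁ + n₂ + 2) (hcol : ColorBound u c e d n)
    (huW : u < W₀) (hρ : u ^ ρ < W₀) (hc : u ^ c < W₀) (hl : u ^ l < W₀) (hW : W₀ + T ≤ W)
    (hT : 2 * T ≤ u ^ l) (hp0 : 0 ≤ p)
    (hp : ∀ a, p ≤ simExpect f (fun y => decide (color u e d y = a)) k (u ^ ρ)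
      (payoff fun s => P a (s 0)) T [L] (innerStore n (u ^ γ)) [])
    (h0 : s 0 = Data.ofNat n) (h1 : s 1 = Data.ofNat n₁) (h2 : s 2 = Data.ofNat n₂)
    (hF : ∀ xs, 0 ≤ F xs) (hK0 : ∀ s, 0 ≤ K s)
    (hK : ∀ (xs : List (Cube n)) (ds : List Data) s', xs.length = u ^ l → ds.length = u ^ c →
      (∀ j (hj : j < ds.length), P j ds[j]) → s' 0 = .cons (Data.ofNat u)
        (.cons (Data.ofTable (labelTable f xs)) (Data.ofList ds)) → F xs ≤ K s') :
    drawList (fun xs => p ^ (u ^ c) * F xs) (u ^ l) [] ≤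
      (learnerProg V c e d k ρ l γ L).val W f K s := by
  rw [learnerProg, val_seq]
  refine le_val_initProg hV (by omega) (by omega) (by omega) h0 h1 h2 fun s1 h3 h4 => ?_
  rw [← hu] at h3
  rw [val_seq]
  refine drawList_le_val_tableProg (u := u) (by omega) (by omega) h3 fun xs s2 hxs hlow h5 => ?_
  rw [val_seq]
  refine le_val_colorsProg hV hL hcol huW hρ hc hW hT hp0 hp (by rw [hlow _ (by omega), h3])
    (by rw [hlow _ (by omega), h4]) h5 (hF xs) (fun s => hK0 _) fun ds s3 hlen hP h6 h7 h8 => ?_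
  rw [val_assign]
  refine hK xs ds _ hxs hlen hP ?_
  rw [Function.update_self]
  simp only [Expr.eval, h6, h7, h8]

end learner

/-! ### Samples that contain all points -/

section drawList
variable {n : ℕ} {F : List (Cube n) → ℝ} {v : ℝ}

theorem le_drawList (h : ∀ xs, v ≤ F xs) (m : ℕ) (xs : List (Cube n)) : v ≤ drawList F m xs := by
  induction m generalizing xs with
  | zero => exact h xs
  | succ m ih => exact le_avg fun x => ih _

/-- Each draw multiplies the expected number of missing points by `1 - 1 / N`, where `N` is the size
of the cube; the bound is linear in that number, so the induction loses nothing. -/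
theorem mul_le_drawList (h : ∀ xs, v * (1 - ∑ y, if y ∈ xs then 0 else 1) ≤ F xs) (m : ℕ)
    (xs : List (Cube n)) :
    v * (1 - (1 - 1 / (Fintype.card (Cube n) : ℝ)) ^ m * ∑ y, if y ∈ xs then 0 else 1) ≤
      drawList F m xs := by
  induction m generalizing xs with
  | zero => simpa [drawList] using h xs
  | succ m ih =>
    refine le_trans (le_of_eq ?_) (avg_mono fun x => ih (x :: xs))
    have hS : ∀ x, (∑ y, if y ∈ x :: xs then (0 : ℝ) else 1) =
        (∑ y, if y ∈ xs then (0 : ℝ) else 1) - if x ∈ xs then 0 else 1 := by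
      intro x
      have h1 : (if x ∈ xs then (0 : ℝ) else 1) =
          ∑ y, if y = x then (if y ∈ xs then 0 else 1) else 0 := by simp
      rw [h1, ← Finset.sum_sub_distrib]
      refine Finset.sum_congr rfl fun y _ => ?_
      by_cases h1 : y = x <;> by_cases h2 : y ∈ xs <;> simp [h1, h2]
    simp only [hS]
    rw [avg_mul_left, avg_sub, avg_const, avg_mul_left, avg_sub, avg_const]
    simp only [avg]
    ring

end drawList

/-! ### The evaluator -/

section evaluator

open LocalQueries.Expr (var)

/-- Evaluate a hypothesis that consists of a table and of one hypothesis for each colour. -/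
def evalProg (V c e d l : ℕ) (E : Prog) : Prog :=
  .seq (.assign V (.head (var 0))) (.seq
    (.assign (V + 1) (.cons (.head (.tail (var 0))) (var 2))) (.seq
    ((lookupFn l).compile V (V + 1)) (.cond (var (V + 1)) (.assign 0 (.head (var (V + 1))))
      (.seq (.assign (V + 1) (var 2)) (.seq ((colorFn c e d).compile V (V + 1)) (.seq
        (.assign (V + 1) (.cons (var (V + 1)) (.tail (.tail (var 0))))) (.seq
        ((dropFn c).compile V (V + 1)) (.seq (.assign 0 (.head (var (V + 1)))) E))))))))

theorem tail_iterate_ofList (ds : List Data) (j : ℕ) (hj : j < ds.length) :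
    (Data.tail^[j] (Data.ofList ds)).head = ds[j] := by
  induction j generalizing ds with
  | zero =>
    rcases ds with _ | ⟨d, ds⟩
    · simp at hj
    · rfl
  | succ j ih =>
    rcases ds with _ | ⟨d, ds⟩
    · simp at hj
    · rw [Function.iterate_succ_apply]
      exact ih ds (by simpa using hj)

/-- A hypothesis consists of `u`, the table and the list of hypotheses indexed by colour. The given
evaluator runs at the end in a store that agrees below `V` with its own initial store, and
`expect_le_stackVal` turns its bound of `T` steps into a bound on its loops. -/
theorem evaluates_evalProg {V u n c e d l W T : ℕ} {f : Cube n → Bool} {E : Prog}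
    {xs : List (Cube n)} {ds : List Data} {h : ℕ → Cube n → Bool} (hV : 3 ≤ V) (hE : E.bound ≤ V)
    (hcol : ColorBound u c e d n) (huW : u < W) (hT : T ≤ W) (hxs : xs.length ≤ u ^ l)
    (hds : ds.length = u ^ c) (hev : ∀ j (hj : j < ds.length), Evaluates E ds[j] T (h j)) :
    Evaluates (evalProg V c e d l E)
      (.cons (Data.ofNat u) (.cons (Data.ofTable (labelTable f xs)) (Data.ofList ds)))
      ((evalProg V c e d l E).cost W) fun x => if x ∈ xs then f x else h (color u e d x) x := by
  have hlt : ∀ x : Cube n, color u e d x < ds.length := fun x => hds ▸ hcol.color_lt x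
  refine ⟨?_, fun x => ?_⟩
  · have := (hev _ (hlt fun _ => false)).1
    simp [evalProg, Prog.Deterministic, Fn.compile_deterministic, this]
  set τ := Data.ofTable (labelTable f xs) with hτ
  set h' : Bool := if x ∈ xs then f x else h (color u e d x) x with hh'
  refine support_runFor_of_expect (P := fun s => (s 0).isPair = h') ?_
  have hK0 := payoff_nonneg fun s : Store => (s 0).isPair = h'
  rw [← zero_add ((evalProg V c e d l E).cost W)]
  refine le_trans ?_ (val_le_expect (r := []) hK0 (fun s => by rw [expect_nil]) _)
  simp only [start, evalProg, val_seq, val_assign]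
  set s := Function.update (Function.update (fun v => [Data.cons (Data.ofNat u)
    (Data.cons τ (Data.ofList ds)), Data.ofNat n, Data.ofPoint x].getD v .nil) V _) (V + 1) _ with hs
  have hs0 : ∀ v < V, s v = [Data.cons (Data.ofNat u) (Data.cons τ (Data.ofList ds)),
      Data.ofNat n, Data.ofPoint x].getD v .nil := fun v hv => by
    rw [hs, Function.update_of_ne (by omega), Function.update_of_ne (by omega)]
  refine le_val_compile (u := u) _ (by omega) ?_ huW fun s1 h1 h2 => ?_
  · rw [hs, Function.update_of_ne (by omega), Function.update_self]; rfl
  have hs1 : ∀ v < V, s1 v = _ := fun v hv => (h2 v (by omega)).trans (hs0 v hv)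
  rw [hs, Function.update_self] at h1
  simp only [Expr.eval] at h1
  rw [Function.update_of_ne (by omega), Function.update_of_ne (by omega)] at h1
  simp only [List.getD_cons_zero, List.getD_cons_succ, Data.tail, Data.head] at h1
  rw [hτ, eval_lookupFn hcol.dim_le _ (by simpa [labelTable] using hxs),
    lookupLabel_labelTable] at h1
  have hsV : s1 V = Data.ofNat u := by
    rw [h2 _ (by omega), hs, Function.update_of_ne (by omega), Function.update_self]; rfl
  rw [val_cond]
  simp only [Expr.eval, h1]
  by_cases hx : x ∈ xs
  · simp only [hx, if_true, Data.ofLabel, Data.isPair, val_assign]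
    rw [one_le_payoff, Function.update_self]
    simp only [Expr.eval, h1, hx, if_true, Data.ofLabel, Data.head, hh']
    cases f x <;> rfl
  · simp only [hx, if_false, Data.ofLabel, Data.isPair, Bool.false_eq_true]
    rw [val_seq, val_assign, val_seq]
    refine le_val_compile (u := u) _ (by omega) ?_ huW fun s2 h3 h4 => ?_
    · rw [Function.update_of_ne (by omega), hsV]
    rw [Function.update_self] at h3
    simp only [Expr.eval] at h3
    rw [hs1 2 (by omega)] at h3
    simp only [List.getD_cons_zero, List.getD_cons_succ] at h3
    rw [eval_colorFn_ofPoint hcol] at h3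
    have hs2 : ∀ v ≤ V, s2 v = s1 v := fun v hv => by
      rw [h4 v (by omega), Function.update_of_ne (by omega)]
    rw [val_seq, val_assign, val_seq]
    refine le_val_compile (u := u) _ (by omega) ?_ huW fun s3 h5 h6 => ?_
    · rw [Function.update_of_ne (by omega), hs2 _ le_rfl, hsV]
    rw [Function.update_self] at h5
    simp only [Expr.eval, h3] at h5
    rw [hs2 0 (by omega), hs1 0 (by omega)] at h5
    simp only [List.getD_cons_zero, Data.tail] at h5
    rw [eval_dropFn (hcol.color_lt x).le] at h5
    rw [val_seq, val_assign]
    simp only [Expr.eval, h5, tail_iterate_ofList ds _ (hlt x)]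
    have := expect_of_support_runFor (P := fun s => (s 0).isPair = h (color u e d x) x)
      ((hev _ (hlt x)).2 x)
    refine this.trans (expect_le_stackVal hK0 (fun s s' hss => ?_) T hT [E] (by simpa using hE)
      _ _ fun v hv => ?_)
    · simp only [payoff, hss 0 (by omega), hh', hx, if_false]
      exact le_rfl
    · rcases v with _ | v
      · rw [Function.update_self]; rfl
      · rw [Function.update_of_ne (by omega), h6 _ (by omega), Function.update_of_ne (by omega),
          hs2 _ (by omega), hs1 _ hv]
        rfl

end evaluator

/-! ### Putting the colours together and choosing the parameters -/

theorem Evaluates.mono {n : ℕ} {E : Prog} {d : Data} {T T' : ℕ} {h : Cube n → Bool}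
    (hE : Evaluates E d T h) (hT : T ≤ T') : Evaluates E d T' h := by
  refine ⟨hE.1, fun x => support_runFor_of_expect (P := fun s => (s 0).isPair = h x) ?_⟩
  exact (expect_of_support_runFor (P := fun s => (s 0).isPair = h x) (hE.2 x)).trans
    (expect_mono_time (payoff_nonneg _) hT _ _)

theorem sum_mistakes {n M : ℕ} {col : Cube n → ℕ} (hcol : ∀ x, col x < M)
    (h : ℕ → Cube n → Bool) (f : Cube n → Bool) :
    ∑ a ∈ Finset.range M, mistakes (fun y => decide (col y = a)) (h a) f =
      ∑ x, if h (col x) x ≠ f x then (1 : ℝ) else 0 := by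
  simp only [mistakes]
  rw [Finset.sum_comm]
  refine Finset.sum_congr rfl fun x _ => ?_
  rw [Finset.sum_eq_single (col x)]
  · simp
  · intro a _ ha
    simp [ha.symm]
  · intro hx
    exact absurd (Finset.mem_range.mpr (hcol x)) hx

/-- The classes partition the cube, so the mistakes of the pieces add up, with a loss `η` for each
class. Replacing a value by the true label never hurts. -/
theorem err_le_of_mistakes_le {n M : ℕ} {col : Cube n → ℕ} (hcol : ∀ x, col x < M)
    {h : ℕ → Cube n → Bool} {f g h' : Cube n → Bool} {η : ℝ}
    (hh : ∀ a < M, mistakes (fun y => decide (col y = a)) (h a) f ≤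
      mistakes (fun y => decide (col y = a)) g f + η * Fintype.card (Cube n))
    (hh' : ∀ x, h' x = f x ∨ h' x = h (col x) x) : err h' f ≤ err g f + M * η := by
  have hN : (0 : ℝ) < Fintype.card (Cube n) := by exact_mod_cast Fintype.card_pos
  refine le_of_mul_le_mul_right ?_ hN
  rw [add_mul, err_mul_card, err_mul_card, ← sum_mistakes hcol fun _ => g]
  calc (∑ x, if h' x ≠ f x then (1 : ℝ) else 0) ≤ ∑ x, if h (col x) x ≠ f x then 1 else 0 := by
        refine Finset.sum_le_sum fun x _ => ?_
        rcases hh' x with hx | hx <;> rw [hx]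
        simp only [ne_eq, not_true_eq_false, if_false]
        split_ifs <;> norm_num
    _ ≤ ∑ a ∈ Finset.range M, (mistakes (fun y => decide (col y = a)) g f +
          η * Fintype.card (Cube n)) := by
        rw [← sum_mistakes hcol]
        exact Finset.sum_le_sum fun a ha => hh a (Finset.mem_range.mp ha)
    _ = _ := by
        rw [Finset.sum_add_distrib, Finset.sum_const, Finset.card_range, nsmul_eq_mul]
        ring

theorem le_expect_of_le_toOuterMeasure {n : ℕ} {f : Cube n → Bool} {c : Config n} {t : ℕ}
    {P : Store → Prop} {p : ℝ} (hc : ∀ c' ∈ (runFor f c t).support, c'.todo = [])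
    (h : ENNReal.ofReal p ≤ (runFor f c t).toOuterMeasure {c | P c.store}) :
    p ≤ expect f (payoff P) t c.todo c.store := by
  rw [← ENNReal.ofReal_le_ofReal_iff (expect_nonneg (payoff_nonneg P) _ _ _),
    ← toOuterMeasure_runFor]
  exact h.trans (PMF.toOuterMeasure_mono _ fun c' hc' => ⟨hc c' hc'.2, hc'.1⟩)

theorem le_toOuterMeasure_of_le_expect {n : ℕ} {f : Cube n → Bool} {c : Config n} {t : ℕ}
    {P : Store → Prop} {p : ℝ} (h : p ≤ expect f (payoff P) t c.todo c.store) :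
    ENNReal.ofReal p ≤ (runFor f c t).toOuterMeasure {c | P c.store} := by
  refine (ENNReal.ofReal_le_ofReal h).trans ?_
  rw [← toOuterMeasure_runFor]
  exact PMF.toOuterMeasure_mono _ fun c' hc' => hc'.1.2

theorem sparse_color {u k n : ℕ} (hn : n < u) (a : ℕ) :
    Sparse (fun y : Cube n => decide (color u (2 * k + 1) (2 * k) y = a)) k := by
  intro x y z hy hz hxy hxz
  simp only [decide_eq_true_eq] at hy hz
  refine color_injective hn (hy.trans hz.symm) ((hammingDist_triangle_left y z x).trans ?_)
  omega

theorem timeBound_le_pow {K n u γ : ℕ} {ε : ℝ} (hu : 2 ≤ u) (hn : n ≤ u) (hγ : 1 ≤ γ)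
    (hε : ⌈1 / ε⌉₊ = u ^ γ) : timeBound K n ε ε ≤ u ^ (K + (γ + 2) * K) := by
  have h1 : u ≤ u ^ γ := Nat.le_self_pow (by omega) u
  have h2 : 4 ≤ u ^ 2 := Nat.pow_le_pow_left hu 2
  rw [timeBound, hε, pow_add, pow_mul]
  refine Nat.mul_le_mul ?_ (Nat.pow_le_pow_left ?_ K)
  · exact (Nat.lt_two_pow_self).le.trans (Nat.pow_le_pow_left hu K)
  · calc n + u ^ γ + u ^ γ + 1 ≤ u ^ γ * 4 := by omega
      _ ≤ u ^ γ * u ^ 2 := Nat.mul_le_mul_left _ h2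
      _ = u ^ (γ + 2) := (pow_add ..).symm

theorem pow_le_timeBound {u n J : ℕ} {ε δ : ℝ} (hu : u = n + ⌈1 / ε⌉₊ + ⌈1 / δ⌉₊ + 2) :
    u ^ J ≤ timeBound (2 ^ J) n ε δ := by
  rw [timeBound]
  set X := n + ⌈1 / ε⌉₊ + ⌈1 / δ⌉₊ with hX
  calc u ^ J ≤ (2 * (X + 1)) ^ J := Nat.pow_le_pow_left (by omega) J
    _ = 2 ^ J * (X + 1) ^ J := mul_pow ..
    _ ≤ _ := Nat.mul_le_mul_left _ (Nat.pow_le_pow_right (by omega) Nat.lt_two_pow_self.le)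

section
variable {V u n n₁ n₂ c e d k ρ l γ W W₀ T B B' : ℕ} {f : Cube n → Bool} {L E : Prog}

/-- Stated once for three uses: sure halting, success in large dimensions through the colour
hypotheses (`G`), and success on small cubes through the table (`F`). -/
theorem drawList_le_expect_learnerProg {s : Store} {G : ℕ → (Cube n → Bool) → Prop}
    {Q : Store → Prop} {F : List (Cube n) → ℝ} {p : ℝ} (hV : 3 ≤ V) (hL : L.bound ≤ V)
    (hE : E.bound ≤ V) (hu : u = n + n₁ + n₂ + 2) (hcol : ColorBound u c e d n)
    (huW : u < W₀) (hρ : u ^ ρ < W₀) (hc : u ^ c < W₀) (hl : u ^ l < W₀) (hW : W₀ + T ≤ W)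
    (hT : 2 * T ≤ u ^ l) (hp0 : 0 ≤ p)
    (hp : ∀ a, p ≤ simExpect f (fun y => decide (color u e d y = a)) k (u ^ ρ)
      (payoff fun s => ∃ h, Evaluates E (s 0) T h ∧ G a h) T [L] (innerStore n (u ^ γ)) [])
    (h0 : s 0 = Data.ofNat n) (h1 : s 1 = Data.ofNat n₁) (h2 : s 2 = Data.ofNat n₂)
    (hB : (learnerProg V c e d k ρ l γ L).cost W ≤ B) (hB' : (evalProg V c e d l E).cost W ≤ B')
    (hF : ∀ xs, 0 ≤ F xs)
    (hQ : ∀ xs (h : ℕ → Cube n → Bool) s', (∀ j < u ^ c, G j (h j)) →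
      Evaluates (evalProg V c e d l E) (s' 0) B'
        (fun x => if x ∈ xs then f x else h (color u e d x) x) → F xs ≤ payoff Q s') :
    drawList (fun xs => p ^ (u ^ c) * F xs) (u ^ l) [] ≤
      expect f (payoff Q) B [learnerProg V c e d k ρ l γ L] s := by
  have hK0 := payoff_nonneg Q
  refine le_trans ?_ (expect_mono_time hK0 ((zero_add _).le.trans hB) _ s)
  refine le_trans ?_ (val_le_expect (r := []) hK0 (fun s => by rw [expect_nil]) _)
  refine le_val_learnerProg (P := fun a d => ∃ h, Evaluates E d T h ∧ G a h) hV hL hu hcol huW hρ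
    hc hl hW hT hp0 hp h0 h1 h2 hF hK0 fun xs ds s' hxs hds hP hs' => ?_
  have : ∀ j, ∃ h : Cube n → Bool, ∀ hj : j < ds.length, Evaluates E ds[j] T h ∧ G j h := by
    intro j
    by_cases hj : j < ds.length
    · obtain ⟨h, hh⟩ := hP j hj
      exact ⟨h, fun _ => hh⟩
    · exact ⟨fun _ => false, fun h => absurd h hj⟩
  choose h hh using this
  refine hQ xs h s' (fun j hj => (hh j (hds ▸ hj)).2) ?_
  rw [hs']
  exact (evaluates_evalProg hV hE hcol (by omega) (by omega) hxs.le hds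
    fun j hj => (hh j hj).1).mono hB'

end

/-- Simulated runs of a learner in large dimensions. -/
theorem le_simExpect_of_pow_le {n u c k γ T : ℕ} {C : ConceptClass} {L E : Prog}
    {f : Cube n → Bool} {ε : ℝ} (hu : 2 ≤ u) (hn : n < u)
    (hε : ε = 1 / (u : ℝ) ^ γ) (hT : T ≤ u ^ c)
    (hN : u ^ (3 * γ + c + 1) ≤ Fintype.card (Cube n)) {s0 : Store}
    (hobey : ∀ g : Cube n → Bool, Obeys (kLocal k) g ⟨[L], s0, []⟩)
    (hprob : ∀ g : Cube n → Bool, 1 - ε ≤ expect g (payoff fun s => ∃ h : Cube n → Bool,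
      Evaluates E (s 0) T h ∧ ∀ c ∈ C n, err h g ≤ err c g + ε) T [L] s0) (a : ℕ) :
    1 - 3 * ε ≤ simExpect f (fun y => decide (color u (2 * k + 1) (2 * k) y = a)) k
      (u ^ (c + k + γ)) (payoff fun s => ∃ h : Cube n → Bool, Evaluates E (s 0) T h ∧
        ∀ c ∈ C n, mistakes (fun y => decide (color u (2 * k + 1) (2 * k) y = a)) h f ≤
          mistakes (fun y => decide (color u (2 * k + 1) (2 * k) y = a)) c f +
            3 * ε * Fintype.card (Cube n)) T [L] s0 [] := by
  have hU : (2 : ℝ) ≤ u := by exact_mod_cast hu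
  have hU0 : (0 : ℝ) < u := by linarith
  have hε0 : 0 < ε := by rw [hε]; positivity
  have hTr : (T : ℝ) ≤ (u : ℝ) ^ c := by exact_mod_cast hT
  have hNr : (u : ℝ) ^ (3 * γ + c + 1) ≤ Fintype.card (Cube n) := by exact_mod_cast hN
  have hNpos : (0 : ℝ) < Fintype.card (Cube n) := by exact_mod_cast Fintype.card_pos
  set N : ℝ := ((Fintype.card (Cube n) : ℕ) : ℝ) with hNdef
  -- The slack on `A` is also chosen as `ε`: the labels of a run fill at most a fraction `ε` of the
  -- cube. The Chebyshev term and the loss from bounded searches are at most `ε` each, which with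
  -- the learner's own failure probability makes `3 * ε`.
  have h1 : (2 * T : ℝ) ≤ ε * N := by
    calc (2 * T : ℝ) ≤ u * (u : ℝ) ^ c := by gcongr
      _ ≤ ε * ((u : ℝ) ^ (3 * γ + c + 1)) := by
        rw [hε, one_div, ← div_eq_inv_mul, le_div_iff₀ (by positivity), ← pow_succ', ← pow_add]
        exact pow_le_pow_right₀ (by linarith) (by omega)
      _ ≤ ε * N := by gcongr
  have key := le_simExpect_of_learner (f := f) (sparse_color (k := k) hn a) (u ^ (c + k + γ))
    hobey hprob hε0 h1
  rw [show ε + 2 * ε = 3 * ε by ring] at key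
  refine le_trans ?_ key
  have h2 : 1 / (ε ^ 2 * N) ≤ ε := by
    rw [div_le_iff₀ (by positivity), show ε * (ε ^ 2 * N) = ε ^ 3 * N by ring]
    calc (1 : ℝ) = ε ^ 3 * (u : ℝ) ^ (3 * γ) := by
          rw [hε, div_pow, one_pow, ← pow_mul, mul_comm γ 3]
          field_simp
      _ ≤ ε ^ 3 * (u : ℝ) ^ (3 * γ + c + 1) := by
          gcongr
          · linarith
          · omega
      _ ≤ ε ^ 3 * N := by gcongr
  have h3 : (T : ℝ) * ((n + 1) ^ k / ((u ^ (c + k + γ) : ℕ) + 1)) ≤ ε := by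
    have h4 : (n + 1 : ℝ) ≤ u := by exact_mod_cast hn
    calc (T : ℝ) * ((n + 1) ^ k / ((u ^ (c + k + γ) : ℕ) + 1)) ≤
          (u : ℝ) ^ c * ((u : ℝ) ^ k / (u : ℝ) ^ (c + k + γ)) := by
          push_cast
          gcongr
          linarith
      _ = ε := by
          rw [hε, pow_add, pow_add]
          field_simp
  linarith

/-- Local queries can be simulated with random examples. -/
theorem EfficientlyAgnosticallyLearnable.noQueries {k : ℕ} {C : ConceptClass}
    (hC : EfficientlyAgnosticallyLearnable (kLocal k) C) :
    EfficientlyAgnosticallyLearnable LocalQueries.noQueries C := by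
  obtain ⟨L, E, K, hLE⟩ := hC
  -- Exponents of `u`: `c` for the number of colours (`colorBound` at distance `2 * k`), `γ` for the
  -- inverse accuracy of the simulated learner, `cT` for its time, `cN` for the size above which the
  -- cube counts as large, `ρ` for the length of a search, `l` for the size of the table and of the
  -- memo, and `w` for the loops of the subroutines.
  obtain ⟨c, hc⟩ : ∃ c, c = (2 * k + 3) * (2 * k) + 2 := ⟨_, rfl⟩
  obtain ⟨γ, hγ⟩ : ∃ γ, γ = c + 3 := ⟨_, rfl⟩
  obtain ⟨cT, hcT⟩ : ∃ cT, cT = K + (γ + 2) * K := ⟨_, rfl⟩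
  obtain ⟨cN, hcN⟩ : ∃ cN, cN = 3 * γ + cT + 1 := ⟨_, rfl⟩
  obtain ⟨ρ, hρ⟩ : ∃ ρ, ρ = cT + k + γ := ⟨_, rfl⟩
  obtain ⟨l, hl⟩ : ∃ l, l = 2 * cN + 1 := ⟨_, rfl⟩
  obtain ⟨w, hw⟩ : ∃ w, w = ρ + l + c + 2 := ⟨_, rfl⟩
  obtain ⟨V, hV, hVL, hVE⟩ : ∃ V, 3 ≤ V ∧ L.bound ≤ V ∧ E.bound ≤ V :=
    ⟨3 + L.bound + E.bound, by omega, by omega, by omega⟩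
  set L' := learnerProg V c (2 * k + 1) (2 * k) k ρ l γ L with hL'
  set E' := evalProg V c (2 * k + 1) (2 * k) l E with hE'
  obtain ⟨J₁, hJ₁⟩ := exists_cost_le_pow L' (w + 1)
  obtain ⟨J₂, hJ₂⟩ := exists_cost_le_pow E' (w + 1)
  refine ⟨L', E', 2 ^ (J₁ + J₂), fun n ε δ hε hδ f => ?_⟩
  obtain ⟨u, hu⟩ : ∃ u, u = n + ⌈1 / ε⌉₊ + ⌈1 / δ⌉₊ + 2 := ⟨_, rfl⟩
  obtain ⟨B, hB⟩ : ∃ B, B = timeBound (2 ^ (J₁ + J₂)) n ε δ := ⟨_, rfl⟩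
  rw [← hB]
  have hu2 : 2 ≤ u := by omega
  have hpow : ∀ {i j}, i ≤ j → u ^ i ≤ u ^ j := fun h => Nat.pow_le_pow_right (by omega) h
  have hpowlt : ∀ {i j}, i < j → u ^ i < u ^ j := fun h => Nat.pow_lt_pow_right (by omega) h
  have hB₁ : L'.cost (u ^ (w + 1)) ≤ B :=
    (hJ₁ u hu2).trans ((hpow (Nat.le_add_right ..)).trans (hB ▸ pow_le_timeBound hu))
  have hB₂ : E'.cost (u ^ (w + 1)) ≤ B :=
    (hJ₂ u hu2).trans ((hpow (Nat.le_add_left ..)).trans (hB ▸ pow_le_timeBound hu))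
  have hU : (2 : ℝ) ≤ u := by exact_mod_cast hu2
  have hU0 : (0 : ℝ) < u := by linarith
  have huε : 1 / (u : ℝ) ≤ ε := by
    rw [one_div_le hU0 hε]
    exact (Nat.le_ceil _).trans (by exact_mod_cast (by omega))
  have huδ : 1 / (u : ℝ) ≤ δ := by
    rw [one_div_le hU0 hδ]
    exact (Nat.le_ceil _).trans (by exact_mod_cast (by omega))
  obtain ⟨ε₁, hε₁⟩ : ∃ ε₁, ε₁ = 1 / (u : ℝ) ^ γ := ⟨_, rfl⟩
  have hε₁0 : 0 < ε₁ := by rw [hε₁]; positivity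
  have hceil : ⌈1 / ε₁⌉₊ = u ^ γ := by
    rw [hε₁, one_div_one_div, ← Nat.cast_pow, Nat.ceil_natCast]
  obtain ⟨T, hT⟩ : ∃ T, T = timeBound K n ε₁ ε₁ := ⟨_, rfl⟩
  have hTle : T ≤ u ^ cT := by
    rw [hT, hcT]
    exact timeBound_le_pow hu2 (by omega) (by omega) hceil
  have hstart : learnerStart L n ε₁ ε₁ = ⟨[L], innerStore n (u ^ γ), []⟩ := by
    rw [learnerStart, hceil]; rfl
  have hLE' := hLE n ε₁ ε₁ hε₁0 hε₁0
  rw [hstart, ← hT] at hLE'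
  have hobey : ∀ g : Cube n → Bool, Obeys (kLocal k) g ⟨[L], innerStore n (u ^ γ), []⟩ :=
    fun g => (hLE' g).1
  have hhalt : ∀ g : Cube n → Bool, 1 ≤ expect g (payoff fun s => ∃ h : Cube n → Bool,
      Evaluates E (s 0) T h) T [L] (innerStore n (u ^ γ)) := fun g =>
    expect_of_support_runFor (c := ⟨[L], innerStore n (u ^ γ), []⟩)
      (P := fun s => ∃ h : Cube n → Bool, Evaluates E (s 0) T h) (hLE' g).2.1
  have hprob : ∀ g : Cube n → Bool, 1 - ε₁ ≤ expect g (payoff fun s => ∃ h : Cube n → Bool,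
      Evaluates E (s 0) T h ∧ ∀ c ∈ C n, err h g ≤ err c g + ε₁) T [L] (innerStore n (u ^ γ)) :=
    fun g => le_expect_of_le_toOuterMeasure (c := ⟨[L], innerStore n (u ^ γ), []⟩)
      (P := fun s => ∃ h : Cube n → Bool, Evaluates E (s 0) T h ∧ ∀ c ∈ C n,
        err h g ≤ err c g + ε₁) (fun c' hc' => ((hLE' g).2.1 c' hc').1) (hLE' g).2.2
  have hcol : ColorBound u c (2 * k + 1) (2 * k) n := hc ▸ colorBound hu2 (by omega) (2 * k)
  have h2T : 2 * T ≤ u ^ l := by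
    calc 2 * T ≤ u * u ^ cT := Nat.mul_le_mul hu2 hTle
      _ = u ^ (cT + 1) := (pow_succ' ..).symm
      _ ≤ u ^ l := hpow (by omega)
  have hW : u ^ w + T ≤ u ^ (w + 1) := by
    have h1 : T ≤ u ^ w := hTle.trans (hpow (by omega))
    calc u ^ w + T ≤ u ^ w * 2 := by omega
      _ ≤ u ^ w * u := Nat.mul_le_mul_left _ hu2
      _ = u ^ (w + 1) := (pow_succ ..).symm
  have hrun := fun (G : ℕ → (Cube n → Bool) → Prop) (Q : Store → Prop) (F : List (Cube n) → ℝ)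
      (p : ℝ) (hp0 : 0 ≤ p) (hp : ∀ a, p ≤ simExpect f
        (fun y => decide (color u (2 * k + 1) (2 * k) y = a)) k (u ^ ρ)
        (payoff fun s => ∃ h, Evaluates E (s 0) T h ∧ G a h) T [L] (innerStore n (u ^ γ)) [])
      (hF : ∀ xs, 0 ≤ F xs) (hQ : ∀ xs (h : ℕ → Cube n → Bool) s', (∀ j < u ^ c, G j (h j)) →
        Evaluates E' (s' 0) B
          (fun x => if x ∈ xs then f x else h (color u (2 * k + 1) (2 * k) x) x) →
        F xs ≤ payoff Q s') =>
    drawList_le_expect_learnerProg (s := (learnerStart L' n ε δ).store) hV hVL hVE hu hcol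
      (by simpa using hpowlt (show 1 < w by omega)) (hpowlt (by omega)) (hpowlt (by omega))
      (hpowlt (by omega)) hW h2T hp0 hp rfl rfl rfl hB₁ hB₂ hF hQ
  -- Halting with an evaluable output holds in every simulated run, including those in which a
  -- search failed, because the original learner guarantees it for every target.
  have hsure : ∀ a, 1 ≤ simExpect f (fun y => decide (color u (2 * k + 1) (2 * k) y = a)) k (u ^ ρ)
      (payoff fun s => ∃ h : Cube n → Bool, Evaluates E (s 0) T h ∧ True) T [L]
      (innerStore n (u ^ γ)) [] := fun a => by
    simp only [and_true]
    exact one_le_simExpect T _ _ _ fun g _ => hhalt g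
  refine ⟨obeys_of_queryFree LocalQueries.noQueries f (learnerStart L' n ε δ) ?_, ?_, ?_⟩
  · intro p hp
    obtain rfl : p = L' := by simpa [learnerStart, start] using hp
    exact learnerProg_queryFree ..
  · refine support_runFor_of_expect (P := fun s => ∃ h : Cube n → Bool, Evaluates E' (s 0) B h) ?_
    refine le_trans ?_ (hrun (fun _ _ => True) _ (fun _ => 1) 1 zero_le_one hsure
      (fun _ => zero_le_one) fun xs h s' _ hs' => one_le_payoff.mpr ⟨_, hs'⟩)
    exact le_drawList (fun _ => by simp) _ _
  · refine le_toOuterMeasure_of_le_expect (P := fun s => ∃ h : Cube n → Bool,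
      Evaluates E' (s 0) B h ∧ ∀ g ∈ C n, err h f ≤ err g f + ε) ?_
    refine (show 1 - δ ≤ 1 - 1 / (u : ℝ) by linarith).trans ?_
    rcases le_or_gt (u ^ cN) (Fintype.card (Cube n)) with hN | hN
    · have h3 : ((u ^ c : ℕ) : ℝ) * (3 * ε₁) ≤ 1 / u := by
        -- The choice `γ = c + 3` makes the loss `3 * ε₁` over all `u ^ c` colours equal to `3 / u ^
        -- 3`, below `1 / u`. The same bound is used for the error and, through Bernoulli's
        -- inequality, for the failure probability.
        rw [hε₁, hγ, Nat.cast_pow, pow_add]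
        have : (u : ℝ) ^ c * (3 * (1 / ((u : ℝ) ^ c * u ^ 3))) = 3 / (u : ℝ) ^ 3 := by field_simp
        rw [this, div_le_div_iff₀ (by positivity) hU0]
        nlinarith [mul_le_mul hU hU (by norm_num) hU0.le]
      have h4 : 3 * ε₁ ≤ 1 / u := by
        refine le_trans ?_ h3
        refine le_mul_of_one_le_left (by positivity) ?_
        exact_mod_cast Nat.one_le_pow _ _ (by omega)
      have h5 : 1 / (u : ℝ) ≤ 1 := by
        rw [div_le_one hU0]; linarith
      have hp := le_simExpect_of_pow_le (f := f) (k := k) (c := cT) hu2 (by omega) hε₁ hTle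
        (hcN ▸ hN) hobey hprob
      rw [← hρ] at hp
      refine le_trans ?_ (hrun (fun a h => ∀ g ∈ C n,
        mistakes (fun y => decide (color u (2 * k + 1) (2 * k) y = a)) h f ≤
          mistakes (fun y => decide (color u (2 * k + 1) (2 * k) y = a)) g f +
            3 * ε₁ * Fintype.card (Cube n)) _ (fun _ => 1) (1 - 3 * ε₁) (by linarith) hp
        (fun _ => zero_le_one) fun xs h s' hh hs' => one_le_payoff.mpr ⟨_, hs', fun g hg => ?_⟩)
      · refine le_drawList (fun _ => ?_) _ _
        have := one_add_mul_le_pow (show -2 ≤ -(3 * ε₁) by linarith) (u ^ c)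
        rw [mul_one, sub_eq_add_neg 1 (3 * ε₁)]
        linarith
      · refine (err_le_of_mistakes_le hcol.color_lt (fun a ha => hh a ha g hg) fun x => ?_).trans
          (by linarith)
        split_ifs
        · exact Or.inl rfl
        · exact Or.inr rfl
    · have hNpos : (0 : ℝ) < Fintype.card (Cube n) := by exact_mod_cast Fintype.card_pos
      refine le_trans ?_ (hrun (fun _ _ => True) _ (fun xs => if ∀ x, x ∈ xs then 1 else 0) 1
        zero_le_one hsure (fun _ => by split_ifs <;> norm_num) fun xs h s' _ hs' => ?_)
      · refine le_trans ?_ (mul_le_drawList (v := 1) (fun xs => ?_) _ [])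
        · have h1 := mul_one_sub_pow_le (p := 1 / (Fintype.card (Cube n) : ℝ)) (by positivity)
            (by rw [div_le_one hNpos]; exact_mod_cast Fintype.card_pos) (u ^ l)
          have h2 : (Fintype.card (Cube n) : ℝ) ≤ (u : ℝ) ^ cN := by exact_mod_cast hN.le
          set N : ℝ := ((Fintype.card (Cube n) : ℕ) : ℝ) with hNdef
          -- The expected number of points missing from the table. Writing it as `N ^ 2` times the
          -- quantity bounded in `mul_one_sub_pow_le` explains `l = 2 * cN + 1`.
          have h3 : (1 - 1 / N) ^ (u ^ l) * N ≤ 1 / u := by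
            calc (1 - 1 / N) ^ (u ^ l) * N = N ^ 2 * (1 / N * (1 - 1 / N) ^ (u ^ l)) := by
                  field_simp
              _ ≤ ((u : ℝ) ^ cN) ^ 2 * (1 / (u : ℝ) ^ l) := by
                  refine mul_le_mul (by gcongr) (h1.trans ?_) ?_ (by positivity)
                  · push_cast
                    exact one_div_le_one_div_of_le (by positivity) (by linarith)
                  · refine mul_nonneg (by positivity) (pow_nonneg ?_ _)
                    rw [sub_nonneg, div_le_one hNpos, hNdef]
                    exact_mod_cast Fintype.card_pos
              _ = 1 / u := by
                  rw [hl, pow_succ (u : ℝ) (2 * cN), ← pow_mul, mul_comm cN 2]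
                  field_simp
          simp only [List.not_mem_nil, if_false, Finset.sum_const, Finset.card_univ, nsmul_eq_mul,
            mul_one, one_mul]
          linarith
        · simp only [one_pow, one_mul]
          split_ifs with hx
          · simp [hx]
          · push Not at hx
            obtain ⟨x, hx⟩ := hx
            have := Finset.single_le_sum (f := fun y => if y ∈ xs then (0 : ℝ) else 1)
              (fun y _ => by split_ifs <;> norm_num) (Finset.mem_univ x)
            simp only [hx, if_false] at this
            linarith
      · split_ifs with hx
        · refine one_le_payoff.mpr ⟨_, hs', fun g hg => ?_⟩
          have h1 : err (fun x => if x ∈ xs then f x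
              else h (color u (2 * k + 1) (2 * k) x) x) f = 0 := by simp [err, hx]
          rw [h1]
          exact add_nonneg (div_nonneg (Nat.cast_nonneg _) (Nat.cast_nonneg _)) hε.le
        · exact payoff_nonneg _ _

end LocalQueries

theorem mainTheorem4 (k : ℕ) (C : LocalQueries.ConceptClass)
    (hC : LocalQueries.EfficientlyAgnosticallyLearnable (LocalQueries.kLocal k) C) :
    LocalQueries.EfficientlyAgnosticallyLearnable LocalQueries.noQueries C :=
  hC.noQueries
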